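/- Let $1\le k\le n$ be integers and let $p\ge k+1$ be a real number. Write $\bar g$ and $\bar\nabla$ for the round metric and Levi-Civita connection of the unit sphere $\mathbb{S}^n\subset\mathbb{R}^{n+1}$ and $dx$ for its Lebesgue measure. For a positive function $h\in C^\infty(\mathbb{S}^n)$ put $r_{ij}=\bar\nabla_i\bar\nabla_j h+\bar g_{ij}h$. If $r_{ij}$ is positive definite, then $h$ is the support function of a smooth, closed, strictly convex hypersurface of $\mathbb{R}^{n+1}$ that encloses the origin in its interior, and the eigenvalues of $r_{ij}$ with respect to $\bar g$ are its principal radii of curvature. Let $\sigma_k$ be their $k$th elementary symmetric polynomial, normalized so that $\sigma_k(1,\dots,1)=1$. Let $\varphi\in C^\infty(\mathbb{S}^n)$ be positive and such that $\bar\nabla_i\bar\nabla_j\varphi^{\frac1{p+k-1}}+\bar g_{ij}\varphi^{\frac1{p+k-1}}$ is positive definite on $\mathbb{S}^n$, and let $M_0$ be a smooth, closed, strictly convex hypersurface enclosing the origin in its interior, with support function $h_0$. Then there are constants $l,L>0$, depending only on $n,k,p$, on $M_0$ and on $\varphi$, with the following property. Let $0<T\le\infty$ and let $h(\cdot,\tau)$,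 $\tau\in[0,T)$, be any smooth solution of the normalized flow \[\partial_\tau h=\varphi h^{2-p}\sigma_k-h\,\frac{\int_{\mathbb{S}^n}h\sigma_k\,dx}{\int_{\mathbb{S}^n}\frac1\varphi\,dx},\qquad h(\cdot,0)=h_0,\] through support functions of smooth, closed, strictly convex hypersurfaces enclosing the origin in their interiors. Then all principal curvatures $\kappa_i(\cdot,\tau)$ of the hypersurface with support function $h(\cdot,\tau)$ satisfy \[l\le\kappa_i(\cdot,\tau)\le L\qquad\text{for all }\tau\in[0,T).\] -/

import Mathlib

open MeasureTheory
open scoped Manifold ContDiff RealInnerProductSpace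

/-- The ambient Euclidean space `ℝⁿ⁺¹`. -/
abbrev Amb (n : ℕ) : Type := EuclideanSpace ℝ (Fin (n + 1))

/-- The unit sphere `𝕊ⁿ` in `ℝⁿ⁺¹`. -/
abbrev Sph (n : ℕ) : Type := Metric.sphere (0 : Amb n) 1

/-- The tangent space `T_x 𝕊ⁿ = x^⊥`, with the inner product induced from `ℝⁿ⁺¹`
(that is, with the round metric). -/
noncomputable abbrev TSph {n : ℕ} (x : Sph n) : Submodule ℝ (Amb n) := (ℝ ∙ (x : Amb n))ᗮ

open Classical in
/-- The extension of a map on the sphere to `ℝⁿ⁺¹ \ {0}` that is constant along rays,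
`y ↦ f (y / |y|)` (and the value `0` at the origin, which is never used). -/
noncomputable def radialExt {n : ℕ} {G : Type*} [Zero G] (f : Sph n → G) (y : Amb n) : G :=
  if hy : y = 0 then 0
  else f ⟨‖y‖⁻¹ • y, by
    rw [mem_sphere_zero_iff_norm, norm_smul, norm_inv, norm_norm,
      inv_mul_cancel₀ (norm_ne_zero_iff.mpr hy)]⟩

/-- The differential at `x` of a vector-valued map on the sphere, in the direction of the
tangent vector `v`. -/
noncomputable def sphDeriv {n : ℕ} (f : Sph n → Amb n) (x : Sph n) :
    TSph x →ₗ[ℝ] Amb n :=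
  (fderiv ℝ (radialExt f) (x : Amb n)).toLinearMap ∘ₗ (TSph x).subtype

/-- The gradient of a function on the sphere with respect to the round metric, as a vector
of `ℝⁿ⁺¹` tangent to the sphere at `x` (the radial derivative of the extension is zero). -/
noncomputable def sphGrad {n : ℕ} (f : Sph n → ℝ) (x : Sph n) : Amb n :=
  gradient (radialExt f) (x : Amb n)

/-- The covariant Hessian of `f` at `x` for the round metric, as the endomorphism
`v ↦ ∇_v (grad f)` of the tangent space. The Levi-Civita connection of the sphere is the
tangential part of the derivative in `ℝⁿ⁺¹`. -/
noncomputable def sphHess {n : ℕ} (f : Sph n → ℝ) (x : Sph n) : TSph x →ₗ[ℝ] TSph x :=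
  (TSph x).orthogonalProjectionOnto.toLinearMap ∘ₗ sphDeriv (sphGrad f) x

/-- The tensor `∇_i ∇_j f + g_ij f`, as an endomorphism of the tangent space. For a support
function this is the tensor `r_ij` whose eigenvalues are the principal radii of curvature. -/
noncomputable def radiiOp {n : ℕ} (f : Sph n → ℝ) (x : Sph n) : TSph x →ₗ[ℝ] TSph x :=
  sphHess f x + f x • LinearMap.id

/-- `∇_i ∇_j f + g_ij f` is positive definite at every point of the sphere. -/
def SphStrictlyConvex {n : ℕ} (f : Sph n → ℝ) : Prop :=
  ∀ (x : Sph n) (v : TSph x), v ≠ 0 → 0 < ⟪radiiOp f x v, v⟫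

/-- The principal radii of curvature at the point with outer unit normal `x`: the eigenvalues
of `r_ij` with respect to the round metric, with multiplicity. -/
noncomputable def principalRadii {n : ℕ} (h : Sph n → ℝ) (x : Sph n) : Multiset ℝ :=
  (radiiOp h x).charpoly.roots

/-- The `k`-th elementary symmetric polynomial of the principal radii of curvature,
normalized so that `σ_k (1, …, 1) = 1`. -/
noncomputable def sigmaK {n : ℕ} (k : ℕ) (h : Sph n → ℝ) (x : Sph n) : ℝ :=
  (principalRadii h x).esymm k / (n.choose k : ℝ)

/-- `h` is the support function of a smooth, closed, strictly convex hypersurface of `ℝⁿ⁺¹`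
that encloses the origin in its interior. -/
structure IsConvexSupport {n : ℕ} (h : Sph n → ℝ) : Prop where
  smooth : ContMDiff (𝓡 n) 𝓘(ℝ, ℝ) ∞ h
  pos : ∀ x, 0 < h x
  convex : SphStrictlyConvex h

/-- The parametrization of the hypersurface with support function `h` by its outer unit
normal (the inverse of the Gauss map), `x ↦ h(x) x + grad h(x)`. -/
noncomputable def gaussParam {n : ℕ} (h : Sph n → ℝ) (x : Sph n) : Amb n :=
  h x • (x : Amb n) + sphGrad h x

/-- `κ` is a principal curvature, at the point with outer unit normal `x`, of the hypersurface
with support function `h`: in some principal direction `dν(v) = κ dX(v)`, where `X` is the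
parametrization by the unit normal, so that `ν` is the identity and `dν(v) = v`. -/
def IsPrincipalCurvature {n : ℕ} (h : Sph n → ℝ) (x : Sph n) (κ : ℝ) : Prop :=
  ∃ v : TSph x, v ≠ 0 ∧ (v : Amb n) = κ • sphDeriv (gaussParam h) x v

/-- The Lebesgue (surface area) measure on the sphere. -/
noncomputable def sphMeasure (n : ℕ) : Measure (Sph n) := (volume : Measure (Amb n)).toSphere

/-- `η = ∫ h σ_k dx / ∫ φ⁻¹ dx`. -/
noncomputable def etaFlow {n : ℕ} (k : ℕ) (φ h : Sph n → ℝ) : ℝ :=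
  (∫ x, h x * sigmaK k h x ∂(sphMeasure n)) / (∫ x, 1 / φ x ∂(sphMeasure n))

/-- The time interval `[0, T)`, where `T` may be `∞`. -/
def timeInterval (T : EReal) : Set ℝ := {τ : ℝ | 0 ≤ τ ∧ (τ : EReal) < T}

/-- `h (·, τ)`, `0 ≤ τ < T`, are the support functions of a smooth solution of the normalized
flow `∂_τ h = φ h^{2-p} σ_k - η h` by smooth, closed, strictly convex hypersurfaces enclosing
the origin, with initial support function `h₀`. -/
structure IsNormalizedFlow {n : ℕ} (k : ℕ) (p : ℝ) (φ h₀ : Sph n → ℝ) (T : EReal)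
    (h : ℝ → Sph n → ℝ) : Prop where
  initial : h 0 = h₀
  smooth : ContMDiffOn ((𝓡 n).prod 𝓘(ℝ, ℝ)) 𝓘(ℝ, ℝ) ∞ (fun q : Sph n × ℝ => h q.2 q.1)
    (Set.univ ×ˢ timeInterval T)
  support : ∀ τ ∈ timeInterval T, IsConvexSupport (h τ)
  evolution : ∀ τ ∈ timeInterval T, ∀ x : Sph n,
    HasDerivWithinAt (fun s => h s x)
      (φ x * h τ x ^ (2 - p) * sigmaK k (h τ) x - h τ x * etaFlow k φ (h τ))
      (timeInterval T) τ

/-! Extend the support function to `H`, positively homogeneous of degree one away from the origin.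
The gradient of `H` parametrizes the hypersurface by its normal; the Hessian of `H` at a unit vector
`x` kills `x` and has the principal radii as its remaining eigenvalues (`radialExt_gaussParam`,
`inner_radiiOp`, `principalRadii_eq`). The flow becomes `∂H = H (Ψ - η)`, where `Ψ = φ h^(1-p) σ_k`
is extended with degree zero, and covariant calculus on the sphere becomes commuting directional
derivatives together with Euler's identity. It remains to bound `D²H` from both sides on unit
tangent vectors, by maximum principles in the form of `pos_of_first_touch`.

The mean `m` of `h^p` with weight `1/φ` satisfies `m' = p η (1 - m)`, hence stays between positive
constants. As `η / m` is a weighted average of `Ψ`, the spatial maximum of `Ψ m^((p-k-1)/p)` cannot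
increase and its minimum cannot decrease; this bounds `Ψ` from both sides (`normPsi_bounds`,
`flowPsi_bounds`).

Where `h` is maximal no radius exceeds `h`, so the lower bound for `Ψ` bounds `h^(p-1-k)`; the upper
bound for `Ψ` then gives `σ_k ≤ (M h)^k` everywhere (`sig_le`). With this, `|∇H|² < K H²` is
preserved for large `K` (`HomFlow.gradient_touch`). A bound for the logarithmic gradient is a
Harnack inequality on the sphere, and with the control of `m` it bounds `h` from above and below
(`support_bounds`). In the borderline case `p = k + 1` the function `Ψ` does not see the scale of
`h`, so these bounds cannot be read off from `Ψ` alone.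

The core is a positive lower bound for `h D²H(v,v)` on the unit tangent bundle. Where it first
touches a level `μ`, a variation of both the base point and the vector gives a second order
condition exactly strong enough for the inverse concavity of `σ_k^(1/k)` (`inverse_concavity`).
Combined with the joint convexity of the prefactor in the homogeneous extension `U` of
`φ^(1/(p+k-1))` and in `H`, it bounds the second derivative of the speed from below. The convexity
assumption on `φ` enters as `D²U ≥ u U` on unit tangent vectors and leaves a positive term that
excludes touching when `μ` is small (`HomFlow.hess_touch`). Once all radii are bounded below, the
bound on `σ_k` bounds each of them above, and the curvatures are their reciprocals. -/

section

open Filter Topology Finset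

/-! ### Second-order Taylor data at the origin -/

/-- `g` has value `a`, first derivative `b` and second derivative `c` at `0`. -/
def Jet2 (g : ℝ → ℝ) (a b c : ℝ) : Prop :=
  g 0 = a ∧ ∃ g' : ℝ → ℝ, (∀ᶠ t in 𝓝 0, HasDerivAt g (g' t) t) ∧ g' 0 = b ∧ HasDerivAt g' c 0

namespace Jet2

variable {f g : ℝ → ℝ} {a b c a' b' c' : ℝ}

theorem const (a : ℝ) : Jet2 (fun _ => a) a 0 0 :=
  ⟨rfl, fun _ => 0, .of_forall fun t => hasDerivAt_const t a, rfl, hasDerivAt_const 0 0⟩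

theorem id : Jet2 (fun t => t) 0 1 0 :=
  ⟨rfl, fun _ => 1, .of_forall fun t => hasDerivAt_id t, rfl, hasDerivAt_const 0 1⟩

theorem add (hf : Jet2 f a b c) (hg : Jet2 g a' b' c') :
    Jet2 (fun t => f t + g t) (a + a') (b + b') (c + c') := by
  obtain ⟨rfl, f', h1, rfl, h2⟩ := hf
  obtain ⟨rfl, g', h3, rfl, h4⟩ := hg
  exact ⟨rfl, fun t => f' t + g' t, by filter_upwards [h1, h3] with t h h' using h.add h', rfl,
    h2.add h4⟩

theorem mul (hf : Jet2 f a b c) (hg : Jet2 g a' b' c') :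
    Jet2 (fun t => f t * g t) (a * a') (b * a' + a * b') (c * a' + 2 * b * b' + a * c') := by
  obtain ⟨rfl, f', h1, rfl, h2⟩ := hf
  obtain ⟨rfl, g', h3, rfl, h4⟩ := hg
  refine ⟨rfl, fun t => f' t * g t + f t * g' t,
    by filter_upwards [h1, h3] with t h h' using h.mul h', rfl, ?_⟩
  exact ((h2.mul h3.self_of_nhds).add (h1.self_of_nhds.mul h4)).congr_deriv (by ring)

theorem congr (hf : Jet2 f a b c) (ha : a = a') (hb : b = b') (hc : c = c') : Jet2 f a' b' c' := by
  subst ha hb hc; exact hf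

theorem congr_fun (hf : Jet2 f a b c) (h : ∀ t, f t = g t) : Jet2 g a b c := by
  rwa [← funext h]

theorem congr_of_eventuallyEq (hf : Jet2 f a b c) (h : f =ᶠ[𝓝 0] g) : Jet2 g a b c := by
  obtain ⟨rfl, f', h1, rfl, h2⟩ := hf
  refine ⟨h.self_of_nhds.symm, f', ?_, rfl, h2⟩
  filter_upwards [h1, eventually_eventually_nhds.mpr h] with t h3 h4
  exact h3.congr_of_eventuallyEq (h4.mono fun _ => Eq.symm)

theorem const_mul (r : ℝ) (hf : Jet2 f a b c) :
    Jet2 (fun t => r * f t) (r * a) (r * b) (r * c) :=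
  ((const r).mul hf).congr rfl (by ring) (by ring)

theorem neg (hf : Jet2 f a b c) : Jet2 (fun t => -f t) (-a) (-b) (-c) :=
  ((hf.const_mul (-1)).congr (by ring) (by ring) (by ring)).congr_fun fun t => by ring

theorem sub (hf : Jet2 f a b c) (hg : Jet2 g a' b' c') :
    Jet2 (fun t => f t - g t) (a - a') (b - b') (c - c') :=
  ((hf.add hg.neg).congr (by ring) (by ring) (by ring)).congr_fun fun t => by ring

theorem sum {ι : Type*} (s : Finset ι) {F : ι → ℝ → ℝ} {A B C : ι → ℝ}
    (h : ∀ i ∈ s, Jet2 (F i) (A i) (B i) (C i)) :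
    Jet2 (fun t => ∑ i ∈ s, F i t) (∑ i ∈ s, A i) (∑ i ∈ s, B i) (∑ i ∈ s, C i) := by
  classical
  induction s using Finset.induction_on with
  | empty => simpa using const 0
  | insert i s hi ih =>
    simp only [Finset.sum_insert hi]
    exact (h i (by simp)).add (ih fun j hj => h j (by simp [hj]))

theorem rpow (hf : Jet2 f a b c) (ha : 0 < a) (s : ℝ) :
    Jet2 (fun t => f t ^ s) (a ^ s) (s * a ^ (s - 1) * b)
      (s * (s - 1) * a ^ (s - 2) * b ^ 2 + s * a ^ (s - 1) * c) := by
  obtain ⟨rfl, f', h1, rfl, h2⟩ := hf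
  have hcont : ContinuousAt f 0 := h1.self_of_nhds.continuousAt
  have hpos : ∀ᶠ t in 𝓝 0, 0 < f t := hcont.eventually (lt_mem_nhds ha)
  refine ⟨rfl, fun t => s * f t ^ (s - 1) * f' t, ?_, rfl, ?_⟩
  · filter_upwards [h1, hpos] with t h3 h4
    exact (h3.rpow_const (p := s) (Or.inl h4.ne')).congr_deriv (by ring)
  · have h5 := (h1.self_of_nhds.rpow_const (p := s - 1) (Or.inl ha.ne')).const_mul s
    refine (h5.mul h2).congr_deriv ?_
    rw [show s - 1 - 1 = s - 2 by ring]
    ring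

/-- Necessary first- and second-order conditions at a minimum. -/
theorem of_nonneg (hf : Jet2 f 0 b c) (h : ∀ᶠ t in 𝓝 0, 0 ≤ f t) : b = 0 ∧ 0 ≤ c := by
  obtain ⟨h0, f', h1, rfl, h2⟩ := hf
  have hb : f' 0 = 0 := by
    have hmin : IsLocalMin f 0 := by
      filter_upwards [h] with t ht
      rwa [h0]
    exact hmin.hasDerivAt_eq_zero h1.self_of_nhds
  refine ⟨hb, ?_⟩
  by_contra! hc
  -- If `c < 0`, the derivative vanishes at `0` and is negative just to the right of it, so the mean
  -- value theorem makes `f` itself negative there.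
  have h3 : ∀ᶠ t in 𝓝[>] (0 : ℝ), f' t < 0 := by
    have h4 := h2.tendsto_slope
    have h5 : ∀ᶠ t in 𝓝[≠] (0 : ℝ), slope f' 0 t < 0 := h4.eventually (gt_mem_nhds hc)
    have h6 : ∀ᶠ t in 𝓝[>] (0 : ℝ), slope f' 0 t < 0 :=
      h5.filter_mono (nhdsWithin_mono _ fun t ht => ne_of_gt ht)
    filter_upwards [h6, self_mem_nhdsWithin] with t ht htpos
    have htpos : 0 < t := htpos
    rw [slope_def_field, hb, sub_zero, sub_zero] at ht
    by_contra! hcon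
    exact absurd ht (not_lt.mpr (div_nonneg hcon htpos.le))
  have h7 := h3.and ((h1.and h).filter_mono nhdsWithin_le_nhds)
  obtain ⟨δ, hδ, hI⟩ := mem_nhdsGT_iff_exists_Ioc_subset.mp h7
  have hδ' : (0 : ℝ) < δ := hδ
  have hD : ∀ t ∈ Set.Icc 0 δ, HasDerivAt f (f' t) t := by
    intro t ht
    rcases ht.1.eq_or_lt with rfl | hpos
    · exact h1.self_of_nhds
    · exact (hI ⟨hpos, ht.2⟩).2.1
  obtain ⟨ξ, hξ, hξ2⟩ := exists_hasDerivAt_eq_slope f f' hδ'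
    (fun t ht => (hD t ht).continuousAt.continuousWithinAt)
    (fun t ht => hD t ⟨ht.1.le, ht.2.le⟩)
  have h8 : f' ξ < 0 := (hI ⟨hξ.1, hξ.2.le⟩).1
  have h9 : 0 ≤ f δ := (hI ⟨hδ', le_rfl⟩).2.2
  rw [h0] at hξ2
  rw [hξ2] at h8
  have : 0 ≤ (f δ - 0) / (δ - 0) := by
    apply div_nonneg <;> linarith
  linarith

end Jet2

/-! ### Elementary symmetric functions and sums of principal minors -/

section Minors

variable {ι : Type*} [DecidableEq ι]

/-- The matrix whose rows in `I` are those of `M` and whose other rows are those of the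
identity matrix. -/
def keepRows (I : Finset ι) (M : Matrix ι ι ℝ) : Matrix ι ι ℝ :=
  Matrix.of fun i j => if i ∈ I then M i j else (1 : Matrix ι ι ℝ) i j

theorem keepRows_diagonal (I : Finset ι) (l : ι → ℝ) :
    keepRows I (Matrix.diagonal l) =
      Matrix.diagonal (fun i => if i ∈ I then l i else 1) := by
  ext i j
  by_cases hi : i ∈ I <;> simp [keepRows, hi, Matrix.diagonal_apply, Matrix.one_apply]

variable [Fintype ι]

/-- The `k`-th elementary symmetric function of a finite family. -/
def esymmFn (k : ℕ) (l : ι → ℝ) : ℝ := ∑ I ∈ powersetCard k univ, ∏ i ∈ I, l i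

/-- The partial derivative of `esymmFn k` in the `j`-th variable. -/
def esymmD (k : ℕ) (l : ι → ℝ) (j : ι) : ℝ :=
  ∑ I ∈ powersetCard k univ with j ∈ I, ∏ i ∈ I.erase j, l i

/-- The sum of the principal `k × k` minors, each written as a determinant in which the rows
outside of the index set are those of the identity matrix. -/
def minorSum (k : ℕ) (M : Matrix ι ι ℝ) : ℝ :=
  ∑ I ∈ powersetCard k univ, Matrix.det (keepRows I M)

/-- Every row is a sum of a row of `s • M` and a row of the identity; expand by multilinearity and
pull out one factor `s` for each row taken from `M`. -/
theorem det_one_add_smul_eq_sum (s : ℝ) (M : Matrix ι ι ℝ) :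
    Matrix.det (1 + s • M) = ∑ I : Finset ι, s ^ #I * Matrix.det (keepRows I M) := by
  have h : (s • M + 1).det = ∑ I : Finset ι, (Matrix.detRowAlternating (R := ℝ) (n := ι))
      (I.piecewise (s • M : Matrix ι ι ℝ) (1 : Matrix ι ι ℝ)) :=
    (Matrix.detRowAlternating (R := ℝ) (n := ι)).map_add_univ (s • M : Matrix ι ι ℝ)
      (1 : Matrix ι ι ℝ)
  rw [add_comm, h]
  refine Finset.sum_congr rfl fun I _ => ?_
  have h2 := (Matrix.detRowAlternating (R := ℝ) (n := ι)).map_piecewise_smul (fun _ => s)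
    (keepRows I M) I
  have h3 : I.piecewise (fun i => s • (keepRows I M) i) (keepRows I M) =
      I.piecewise (s • M : Matrix ι ι ℝ) (1 : Matrix ι ι ℝ) := by
    have hp : ∀ A A' B B' : ι → ι → ℝ, (∀ i ∈ I, ∀ j, A i j = A' i j) →
        (∀ i ∉ I, ∀ j, B i j = B' i j) → I.piecewise A B = I.piecewise A' B' := by
      intro A A' B B' hA hB
      funext i j
      by_cases hi : i ∈ I
      · simpa [hi] using hA i hi j
      · simpa [hi] using hB i hi j
    refine hp _ _ _ _ (fun i hi j => ?_) (fun i hi j => ?_)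
    · change s * keepRows I M i j = s * M i j
      simp [keepRows, hi]
    · simp [keepRows, hi]
  rw [← h3]
  refine h2.trans ?_
  simp [Matrix.det]

/-- The sum of the principal `k × k` minors is the coefficient of `s ^ k` in `det (1 + s M)`. -/
theorem minorSum_eq_of_det {M N : Matrix ι ι ℝ}
    (h : ∀ s : ℝ, Matrix.det (1 + s • M) = Matrix.det (1 + s • N)) (k : ℕ) :
    minorSum k M = minorSum k N := by
  have key : ∀ M : Matrix ι ι ℝ, minorSum k M =
      (∑ I : Finset ι, Polynomial.C (Matrix.det (keepRows I M)) * Polynomial.X ^ #I :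
        Polynomial ℝ).coeff k := by
    intro M
    rw [Polynomial.finsetSum_coeff, minorSum]
    simp only [Polynomial.coeff_C_mul_X_pow]
    rw [← Finset.sum_filter]
    refine Finset.sum_congr ?_ fun _ _ => rfl
    ext I
    simp [mem_powersetCard, eq_comm]
  rw [key M, key N]
  congr 1
  refine Polynomial.funext fun s => ?_
  have h2 := h s
  rw [det_one_add_smul_eq_sum, det_one_add_smul_eq_sum] at h2
  simp only [Polynomial.eval_finsetSum, Polynomial.eval_mul, Polynomial.eval_C,
    Polynomial.eval_pow, Polynomial.eval_X]
  simpa only [mul_comm] using h2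

/-- Basis independence is what permits differentiating `σ_k` in an eigenframe frozen at the point
under consideration, although the nearby Hessians are not diagonal in it. -/
theorem minorSum_toMatrix_eq {V : Type*} [AddCommGroup V] [Module ℝ V]
    (b c : Module.Basis ι ℝ V) (T : V →ₗ[ℝ] V) (k : ℕ) :
    minorSum k (LinearMap.toMatrix b b T) = minorSum k (LinearMap.toMatrix c c T) := by
  refine minorSum_eq_of_det (fun s => ?_) k
  have h : ∀ b : Module.Basis ι ℝ V, Matrix.det (1 + s • LinearMap.toMatrix b b T) =
      LinearMap.det (1 + s • T) := by
    intro b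
    rw [← LinearMap.det_toMatrix b]
    simp
  rw [h, h]

theorem minorSum_diagonal (k : ℕ) (l : ι → ℝ) : minorSum k (Matrix.diagonal l) = esymmFn k l := by
  refine Finset.sum_congr rfl fun I _ => ?_
  rw [keepRows_diagonal, Matrix.det_diagonal, Finset.prod_ite_mem, Finset.univ_inter]

theorem det_hasDerivAt {R : ℝ → Matrix ι ι ℝ} {R' : Matrix ι ι ℝ} {t : ℝ}
    (h : ∀ i j, HasDerivAt (fun s => R s i j) (R' i j) t) :
    HasDerivAt (fun s => Matrix.det (R s)) (∑ j, Matrix.det ((R t).updateRow j (R' j))) t := by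
  have hrow : ∀ M : Matrix ι ι ℝ, M.det =
      ∑ σ : Equiv.Perm ι, ((Equiv.Perm.sign σ : ℤ) : ℝ) * ∏ i, M i (σ i) := by
    intro M
    rw [← Matrix.det_transpose, Matrix.det_apply']
    rfl
  have h1 : HasDerivAt (fun s => ∑ σ : Equiv.Perm ι, ((Equiv.Perm.sign σ : ℤ) : ℝ) *
      ∏ i, R s i (σ i)) (∑ σ : Equiv.Perm ι, ((Equiv.Perm.sign σ : ℤ) : ℝ) *
      ∑ j, (∏ i ∈ univ.erase j, R t i (σ i)) • R' j (σ j)) t := by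
    refine HasDerivAt.fun_sum fun σ _ => HasDerivAt.const_mul _ ?_
    exact HasDerivAt.fun_finsetProd fun i _ => h i (σ i)
  convert h1 using 1
  · funext s
    exact hrow _
  · simp only [hrow, Finset.mul_sum]
    rw [Finset.sum_comm]
    refine Finset.sum_congr rfl fun σ _ => Finset.sum_congr rfl fun j _ => ?_
    rw [← Finset.prod_erase_mul _ _ (mem_univ j), Matrix.updateRow_self, smul_eq_mul]
    congr 2
    refine Finset.prod_congr rfl fun i hi => ?_
    rw [Matrix.updateRow_ne (Finset.ne_of_mem_erase hi)]

theorem det_updateRow_diagonal (d r : ι → ℝ) (j : ι) :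
    Matrix.det ((Matrix.diagonal d).updateRow j r) = r j * ∏ i ∈ univ.erase j, d i := by
  rw [← Matrix.cramer_transpose_apply, Matrix.diagonal_transpose,
    Matrix.cramer_eq_adjugate_mulVec, Matrix.adjugate_diagonal, Matrix.mulVec_diagonal, mul_comm]

/-- In the Leibniz formula a permutation that moves an index other than `j` and `l` picks an
off-diagonal zero. Only the identity and the transposition of `j` and `l` survive, and they form a
`2 × 2` minor. -/
theorem det_updateRow_updateRow_diagonal (d r s : ι → ℝ) {j l : ι} (hjl : l ≠ j) :
    Matrix.det (((Matrix.diagonal d).updateRow j r).updateRow l s) =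
      (r j * s l - r l * s j) * ∏ i ∈ (univ.erase j).erase l, d i := by
  rw [← Matrix.det_transpose, Matrix.det_apply']
  have hne : (1 : Equiv.Perm ι) ≠ Equiv.swap j l := by
    intro h
    have := congrArg (fun σ : Equiv.Perm ι => σ j) h
    simp only [Equiv.Perm.one_apply, Equiv.swap_apply_left] at this
    exact hjl this.symm
  have hsplit : ∀ f : ι → ℝ, ∏ i, f i = f j * (f l * ∏ i ∈ (univ.erase j).erase l, f i) := by
    intro f
    rw [Finset.mul_prod_erase _ _ (Finset.mem_erase.mpr ⟨hjl, mem_univ _⟩),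
      Finset.mul_prod_erase _ _ (mem_univ j)]
  have hent : ∀ i, i ∈ (univ.erase j).erase l → ∀ m,
      (((Matrix.diagonal d).updateRow j r).updateRow l s) i m = Matrix.diagonal d i m := by
    intro i hi m
    rw [Matrix.updateRow_ne (Finset.ne_of_mem_erase hi),
      Matrix.updateRow_ne (Finset.ne_of_mem_erase (Finset.mem_of_mem_erase hi))]
  have hj : ∀ m, (((Matrix.diagonal d).updateRow j r).updateRow l s) j m = r m := by
    intro m
    rw [Matrix.updateRow_ne hjl.symm, Matrix.updateRow_self]
  have hl : ∀ m, (((Matrix.diagonal d).updateRow j r).updateRow l s) l m = s m := by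
    intro m
    rw [Matrix.updateRow_self]
  rw [← Finset.sum_subset (Finset.subset_univ ({1, Equiv.swap j l} : Finset (Equiv.Perm ι)))]
  · rw [Finset.sum_pair hne, Equiv.Perm.sign_one, Equiv.Perm.sign_swap hjl.symm]
    simp only [Matrix.transpose_apply]
    rw [hsplit, hsplit, hj, hl, hj, hl]
    have e1 : ∏ i ∈ (univ.erase j).erase l, (((Matrix.diagonal d).updateRow j r).updateRow l s) i
        ((1 : Equiv.Perm ι) i) = ∏ i ∈ (univ.erase j).erase l, d i :=
      Finset.prod_congr rfl fun i hi => (hent i hi _).trans (Matrix.diagonal_apply_eq d i)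
    have e2 : ∏ i ∈ (univ.erase j).erase l, (((Matrix.diagonal d).updateRow j r).updateRow l s) i
        (Equiv.swap j l i) = ∏ i ∈ (univ.erase j).erase l, d i :=
      Finset.prod_congr rfl fun i hi => by
        rw [hent i hi, Equiv.swap_apply_of_ne_of_ne
          (Finset.ne_of_mem_erase (Finset.mem_of_mem_erase hi)) (Finset.ne_of_mem_erase hi)]
        exact Matrix.diagonal_apply_eq d i
    rw [e1, e2]
    simp only [Equiv.Perm.one_apply, Equiv.swap_apply_left, Equiv.swap_apply_right]
    push_cast
    ring
  · intro σ _ hσ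
    by_cases hfix : ∀ i ∈ (univ.erase j).erase l, σ i = i
    · exfalso
      apply hσ
      have hout : ∀ i, i ≠ j → i ≠ l → σ i = i := fun i h1 h2 =>
        hfix i (by simp [h1, h2])
      have hj2 : σ j = j ∨ σ j = l := by
        by_contra! hcon
        exact hcon.1 (σ.injective (hout _ hcon.1 hcon.2))
      have hl2 : σ l = j ∨ σ l = l := by
        by_contra! hcon
        exact hcon.2 (σ.injective (hout _ hcon.1 hcon.2))
      rw [Finset.mem_insert, Finset.mem_singleton]
      rcases hj2 with hj2 | hj2
      · left
        ext i
        by_cases h1 : i = j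
        · rw [h1, hj2]; rfl
        by_cases h2 : i = l
        · rcases hl2 with h3 | h3
          · exact absurd (σ.injective (h3.trans hj2.symm)) hjl
          · rw [h2, h3]; rfl
        rw [hout i h1 h2]; rfl
      · right
        ext i
        by_cases h1 : i = j
        · rw [h1, hj2, Equiv.swap_apply_left]
        by_cases h2 : i = l
        · rcases hl2 with h3 | h3
          · rw [h2, h3, Equiv.swap_apply_right]
          · exact absurd (σ.injective (h3.trans hj2.symm)) hjl
        rw [hout i h1 h2, Equiv.swap_apply_of_ne_of_ne h1 h2]
    · push Not at hfix
      obtain ⟨i, hi, hne2⟩ := hfix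
      apply mul_eq_zero_of_right
      refine Finset.prod_eq_zero (mem_univ i) ?_
      rw [Matrix.transpose_apply, hent i hi]
      exact Matrix.diagonal_apply_ne d hne2.symm

end Minors

/-! ### Derivatives of principal minor sums at a diagonal matrix, and inequalities for elementary
symmetric functions -/

section Minors

variable {ι : Type*} [DecidableEq ι] [Fintype ι]

/-- The second derivative of the sum of principal minors at a diagonal matrix, in the direction
of a matrix `B`. -/
def minorHess (k : ℕ) (l : ι → ℝ) (B : Matrix ι ι ℝ) : ℝ :=
  ∑ I ∈ powersetCard k univ, ∑ j ∈ I, ∑ i ∈ I.erase j,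
    (B j j * B i i - B j i * B i j) * ∏ m ∈ (I.erase j).erase i, l m

theorem sum_esymmD_mul (k : ℕ) (l x : ι → ℝ) :
    ∑ j, esymmD k l j * x j =
      ∑ I ∈ powersetCard k univ, ∑ j ∈ I, x j * ∏ i ∈ I.erase j, l i := by
  simp only [esymmD, Finset.sum_mul, Finset.sum_filter, ite_mul, zero_mul]
  rw [Finset.sum_comm]
  refine Finset.sum_congr rfl fun I _ => ?_
  rw [Finset.sum_ite_mem, Finset.univ_inter]
  exact Finset.sum_congr rfl fun j _ => mul_comm _ _

theorem sum_esymmD_mul_self (k : ℕ) (l : ι → ℝ) :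
    ∑ j, esymmD k l j * l j = k * esymmFn k l := by
  rw [sum_esymmD_mul, esymmFn, Finset.mul_sum]
  refine Finset.sum_congr rfl fun I hI => ?_
  rw [Finset.sum_congr rfl fun j hj => Finset.mul_prod_erase I l hj, Finset.sum_const,
    (Finset.mem_powersetCard.mp hI).2, nsmul_eq_mul]

theorem prod_univ_erase_ite (I : Finset ι) (l : ι → ℝ) (j : ι) :
    ∏ i ∈ univ.erase j, (if i ∈ I then l i else 1) = ∏ i ∈ I.erase j, l i := by
  rw [Finset.prod_ite_mem]
  congr 1
  ext i
  simp

theorem prod_univ_erase_erase_ite (I : Finset ι) (l : ι → ℝ) (j m : ι) :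
    ∏ i ∈ (univ.erase j).erase m, (if i ∈ I then l i else 1) = ∏ i ∈ (I.erase j).erase m, l i := by
  rw [Finset.prod_ite_mem]
  congr 1
  ext i
  simp only [mem_inter, mem_erase, mem_univ, and_true]
  tauto

/-- At a diagonal matrix a minor with one row replaced only sees the diagonal entry of that row, so
off-diagonal variations do not contribute to first order. -/
theorem minorSum_hasDerivAt {M : ℝ → Matrix ι ι ℝ} {M' : Matrix ι ι ℝ} {t : ℝ} {l : ι → ℝ} (k : ℕ)
    (h : ∀ i j, HasDerivAt (fun s => M s i j) (M' i j) t) (hM : M t = Matrix.diagonal l) :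
    HasDerivAt (fun s => minorSum k (M s)) (∑ j, esymmD k l j * M' j j) t := by
  have h1 : ∀ I : Finset ι, HasDerivAt (fun s => Matrix.det (keepRows I (M s)))
      (∑ j ∈ I, M' j j * ∏ i ∈ I.erase j, l i) t := by
    intro I
    have h2 : ∀ i j, HasDerivAt (fun s => keepRows I (M s) i j)
        (Matrix.of (fun i j => if i ∈ I then M' i j else 0) i j) t := by
      intro i j
      by_cases hi : i ∈ I
      · simpa [keepRows, hi] using h i j
      · simpa [keepRows, hi] using hasDerivAt_const t ((1 : Matrix ι ι ℝ) i j)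
    refine (det_hasDerivAt h2).congr_deriv ?_
    rw [hM, keepRows_diagonal]
    simp only [det_updateRow_diagonal, prod_univ_erase_ite, Matrix.of_apply, ite_mul, zero_mul]
    rw [Finset.sum_ite_mem, Finset.univ_inter]
  rw [sum_esymmD_mul]
  exact HasDerivAt.fun_sum fun I _ => h1 I

/-- Differentiate row by row twice: hitting the same row again gives a row of `C`, hitting two
different rows gives two rows of `B`. -/
theorem det_jet2 {M : ℝ → Matrix ι ι ℝ} {A B C : Matrix ι ι ℝ}
    (h : ∀ i j, Jet2 (fun t => M t i j) (A i j) (B i j) (C i j)) :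
    Jet2 (fun t => Matrix.det (M t)) A.det (∑ j, (A.updateRow j (B j)).det)
      (∑ j, ((A.updateRow j (C j)).det +
        ∑ i ∈ univ.erase j, ((A.updateRow j (B j)).updateRow i (B i)).det)) := by
  choose h0 M' h1 h2 h3 using h
  have hA : M 0 = A := by ext i j; exact h0 i j
  have hB : ∀ j, (fun i => M' j i 0) = B j := fun j => funext (h2 j)
  subst hA
  have h1' : ∀ᶠ t in 𝓝 0, ∀ i j, HasDerivAt (fun t => M t i j) (M' i j t) t :=
    eventually_all.mpr fun i => eventually_all.mpr fun j => h1 i j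
  refine ⟨rfl, fun t => ∑ j, ((M t).updateRow j (fun i => M' j i t)).det, ?_, ?_, ?_⟩
  · filter_upwards [h1'] with t ht
    exact det_hasDerivAt (R' := Matrix.of fun i j => M' i j t) ht
  · simp only [hB]
  · refine HasDerivAt.fun_sum fun j _ => ?_
    have h4 : ∀ i m, HasDerivAt (fun t => ((M t).updateRow j (fun i => M' j i t)) i m)
        ((B.updateRow j (C j)) i m) 0 := by
      intro i m
      by_cases hi : i = j
      · subst hi
        simpa only [Matrix.updateRow_self] using h3 i m
      · simpa only [Matrix.updateRow_ne hi, h2] using h1'.self_of_nhds i m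
    refine (det_hasDerivAt h4).congr_deriv ?_
    rw [← Finset.add_sum_erase _ _ (mem_univ j), hB]
    congr 1
    · rw [Matrix.updateRow_idem, Matrix.updateRow_self]
    · refine Finset.sum_congr rfl fun i hi => ?_
      rw [Matrix.updateRow_ne (Finset.ne_of_mem_erase hi)]

theorem minorSum_jet2 {M : ℝ → Matrix ι ι ℝ} {B C : Matrix ι ι ℝ} {l : ι → ℝ} (k : ℕ)
    (h : ∀ i j, Jet2 (fun t => M t i j) (Matrix.diagonal l i j) (B i j) (C i j)) :
    Jet2 (fun t => minorSum k (M t)) (esymmFn k l) (∑ j, esymmD k l j * B j j)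
      (∑ j, esymmD k l j * C j j + minorHess k l B) := by
  have h1 : ∀ I : Finset ι, Jet2 (fun t => Matrix.det (keepRows I (M t))) (∏ i ∈ I, l i)
      (∑ j ∈ I, B j j * ∏ i ∈ I.erase j, l i)
      (∑ j ∈ I, (C j j * ∏ i ∈ I.erase j, l i + ∑ i ∈ I.erase j,
        (B j j * B i i - B j i * B i j) * ∏ m ∈ (I.erase j).erase i, l m)) := by
    intro I
    have h2 : ∀ i j, Jet2 (fun s => keepRows I (M s) i j) (keepRows I (Matrix.diagonal l) i j)
        (Matrix.of (fun i j => if i ∈ I then B i j else 0) i j)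
        (Matrix.of (fun i j => if i ∈ I then C i j else 0) i j) := by
      intro i j
      by_cases hi : i ∈ I
      · simpa [keepRows, hi] using h i j
      · simpa [keepRows, hi] using Jet2.const ((1 : Matrix ι ι ℝ) i j)
    refine (det_jet2 h2).congr ?_ ?_ ?_
    · rw [keepRows_diagonal, Matrix.det_diagonal, Finset.prod_ite_mem, Finset.univ_inter]
    · rw [keepRows_diagonal]
      simp only [det_updateRow_diagonal, prod_univ_erase_ite, Matrix.of_apply, ite_mul, zero_mul]
      rw [Finset.sum_ite_mem, Finset.univ_inter]
    · rw [keepRows_diagonal]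
      have h3 : ∀ j, ∑ i ∈ univ.erase j,
          (((Matrix.diagonal fun i => if i ∈ I then l i else 1).updateRow j
            (Matrix.of (fun i j => if i ∈ I then B i j else 0) j)).updateRow i
            (Matrix.of (fun i j => if i ∈ I then B i j else 0) i)).det =
          if j ∈ I then ∑ i ∈ I.erase j,
            (B j j * B i i - B j i * B i j) * ∏ m ∈ (I.erase j).erase i, l m else 0 := by
        intro j
        refine (Finset.sum_congr rfl fun i hi =>
          det_updateRow_updateRow_diagonal _ _ _ (Finset.ne_of_mem_erase hi)).trans ?_
        simp only [prod_univ_erase_erase_ite, Matrix.of_apply]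
        by_cases hj : j ∈ I
        · simp only [hj, if_true]
          refine (Finset.sum_subset (Finset.erase_subset_erase j (subset_univ I)) ?_).symm.trans ?_
          · intro i hi hi2
            have : i ∉ I := fun h => hi2 (mem_erase.mpr ⟨Finset.ne_of_mem_erase hi, h⟩)
            simp [this]
          · refine Finset.sum_congr rfl fun i hi => ?_
            simp [Finset.mem_of_mem_erase hi]
        · simp [hj]
      simp only [h3, det_updateRow_diagonal, prod_univ_erase_ite, Matrix.of_apply, ite_mul,
        zero_mul]
      rw [Finset.sum_add_distrib, Finset.sum_add_distrib, Finset.sum_ite_mem, Finset.sum_ite_mem,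
        Finset.univ_inter]
  have h4 := Jet2.sum (powersetCard k univ) fun I _ => h1 I
  refine h4.congr rfl (sum_esymmD_mul k l _).symm ?_
  rw [sum_esymmD_mul k l (fun j => C j j), minorHess, ← Finset.sum_add_distrib]
  exact Finset.sum_congr rfl fun I _ => Finset.sum_add_distrib

theorem contDiffOn_minorSum {V : Type*} [NormedAddCommGroup V] [NormedSpace ℝ V] {s : Set V}
    {M : V → Matrix ι ι ℝ} (k : ℕ) (h : ∀ i j, ContDiffOn ℝ ∞ (fun x => M x i j) s) :
    ContDiffOn ℝ ∞ (fun x => minorSum k (M x)) s := by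
  refine ContDiffOn.sum fun I _ => ?_
  simp only [Matrix.det_apply']
  refine ContDiffOn.sum fun σ _ => contDiffOn_const.mul (contDiffOn_prod fun i _ => ?_)
  by_cases hi : σ i ∈ I
  · simpa [keepRows, hi] using h (σ i) i
  · simpa [keepRows, hi] using contDiffOn_const

theorem esymmFn_nonneg (k : ℕ) {l : ι → ℝ} (hl : ∀ i, 0 ≤ l i) : 0 ≤ esymmFn k l :=
  Finset.sum_nonneg fun _ _ => Finset.prod_nonneg fun i _ => hl i

theorem esymmD_nonneg (k : ℕ) {l : ι → ℝ} (hl : ∀ i, 0 ≤ l i) (j : ι) : 0 ≤ esymmD k l j :=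
  Finset.sum_nonneg fun _ _ => Finset.prod_nonneg fun i _ => hl i

theorem esymmFn_le_pow (k : ℕ) {l : ι → ℝ} (hl : ∀ i, 0 ≤ l i) {r : ℝ} (hr : ∀ i, l i ≤ r) :
    esymmFn k l ≤ (Fintype.card ι).choose k * r ^ k := by
  have h : ∀ I ∈ powersetCard k (univ : Finset ι), ∏ i ∈ I, l i ≤ r ^ k := by
    intro I hI
    rw [← (Finset.mem_powersetCard.mp hI).2, ← Finset.prod_const]
    exact Finset.prod_le_prod (fun i _ => hl i) fun i _ => hr i
  refine (Finset.sum_le_sum h).trans ?_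
  simp [Finset.card_powersetCard]

theorem pow_le_esymmFn {k : ℕ} {l : ι → ℝ} {o : ι} {r : ℝ} (hr : 0 ≤ r) (hl : ∀ i, 0 ≤ l i)
    (hlo : ∀ i, i ≠ o → r ≤ l i) (hk : k ≤ Fintype.card ι - 1) : r ^ k ≤ esymmFn k l := by
  have hc : k ≤ #(univ.erase o) := by rwa [Finset.card_erase_of_mem (mem_univ o), Finset.card_univ]
  obtain ⟨I, hI, hIc⟩ := Finset.exists_subset_card_eq hc
  have h1 : r ^ k ≤ ∏ i ∈ I, l i := by
    rw [← hIc, ← Finset.prod_const]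
    exact Finset.prod_le_prod (fun _ _ => hr) fun i hi => hlo i (Finset.ne_of_mem_erase (hI hi))
  exact h1.trans (Finset.single_le_sum (f := fun I => ∏ i ∈ I, l i)
    (fun J _ => Finset.prod_nonneg fun i _ => hl i) (Finset.mem_powersetCard.mpr ⟨subset_univ _, hIc⟩))

/-- Complete `m` by `k - 1` further indices other than `o`; this single product is already large
enough. It turns an upper bound for `σ_k` and a lower bound for all radii into an upper bound for
each radius. -/
theorem mul_pow_le_esymmFn {k : ℕ} {l : ι → ℝ} {o m : ι} {r : ℝ} (hr : 0 ≤ r) (hl : ∀ i, 0 ≤ l i)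
    (hlo : ∀ i, i ≠ o → r ≤ l i) (hm : m ≠ o) (hk1 : 1 ≤ k) (hk : k ≤ Fintype.card ι - 1) :
    l m * r ^ (k - 1) ≤ esymmFn k l := by
  have hc : k - 1 ≤ #((univ.erase o).erase m) := by
    rw [Finset.card_erase_of_mem (by simp [hm]), Finset.card_erase_of_mem (mem_univ o),
      Finset.card_univ]
    omega
  obtain ⟨I, hI, hIc⟩ := Finset.exists_subset_card_eq hc
  have hmI : m ∉ I := fun h => by simpa using hI h
  have h1 : l m * r ^ (k - 1) ≤ ∏ i ∈ insert m I, l i := by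
    rw [Finset.prod_insert hmI, ← hIc, ← Finset.prod_const]
    refine mul_le_mul_of_nonneg_left ?_ (hl m)
    exact Finset.prod_le_prod (fun _ _ => hr) fun i hi =>
      hlo i (Finset.ne_of_mem_erase (Finset.mem_of_mem_erase (hI hi)))
  refine h1.trans (Finset.single_le_sum (f := fun I => ∏ i ∈ I, l i)
    (fun J _ => Finset.prod_nonneg fun i _ => hl i) (Finset.mem_powersetCard.mpr ⟨subset_univ _, ?_⟩))
  rw [Finset.card_insert_of_notMem hmI, hIc]
  omega

/-- A replacement for the Newton–Maclaurin inequality. In each product of `k` factors avoiding `o`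
one factor is at most `r`, for otherwise this product alone would exceed `r ^ k`; removing that
factor leaves a term of a partial derivative. Products containing `o` vanish. -/
theorem esymmFn_le_mul_sum_esymmD {k : ℕ} (hk : 1 ≤ k) {l : ι → ℝ} (hl : ∀ i, 0 ≤ l i) {o : ι}
    (ho : l o = 0) {r : ℝ} (hr : 0 < r) (h : esymmFn k l ≤ r ^ k) :
    esymmFn k l ≤ r * ∑ j ∈ univ.erase o, esymmD k l j := by
  have h0 : ∑ j ∈ univ.erase o, esymmD k l j =
      ∑ I ∈ powersetCard k univ, ∑ j ∈ I, (if j = o then 0 else 1) * ∏ i ∈ I.erase j, l i := by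
    rw [← sum_esymmD_mul, ← Finset.sum_erase_add _ _ (mem_univ o)]
    simp only [if_true, mul_zero, add_zero]
    refine Finset.sum_congr rfl fun j hj => ?_
    rw [if_neg (Finset.ne_of_mem_erase hj), mul_one]
  rw [h0, Finset.mul_sum]
  refine Finset.sum_le_sum fun I hI => ?_
  have hnn : ∀ j ∈ I, 0 ≤ (if j = o then (0 : ℝ) else 1) * ∏ i ∈ I.erase j, l i := fun j _ =>
    mul_nonneg (by split_ifs <;> norm_num) (Finset.prod_nonneg fun i _ => hl i)
  by_cases hoI : o ∈ I
  · rw [Finset.prod_eq_zero hoI ho]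
    exact mul_nonneg hr.le (Finset.sum_nonneg hnn)
  have hIc := (Finset.mem_powersetCard.mp hI).2
  obtain ⟨j, hj, hjr⟩ : ∃ j ∈ I, l j ≤ r := by
    by_contra! hcon
    have h1 : r ^ k < ∏ i ∈ I, l i := by
      rw [← hIc, ← Finset.prod_const]
      exact Finset.prod_lt_prod_of_nonempty (fun _ _ => hr) hcon
        (Finset.card_pos.mp (by omega))
    have h2 : ∏ i ∈ I, l i ≤ esymmFn k l := Finset.single_le_sum (f := fun I => ∏ i ∈ I, l i)
      (fun J _ => Finset.prod_nonneg fun i _ => hl i) hI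
    linarith
  have hjo : j ≠ o := fun h => hoI (h ▸ hj)
  have h3 := Finset.single_le_sum hnn hj
  rw [if_neg hjo, one_mul] at h3
  rw [← Finset.mul_prod_erase I l hj]
  exact mul_le_mul hjr h3 (Finset.prod_nonneg fun i _ => hl i) hr.le

end Minors

/-! ### Inverse concavity of the elementary symmetric functions -/

section Minors

variable {ι : Type*} [DecidableEq ι] [Fintype ι]

/-- Exchanging `o` for `m` is a bijection between the two families of index sets and leaves the
remaining product unchanged. -/
theorem sum_powersetCard_exchange (k : ℕ) (l : ι → ℝ) {o m : ι} (hmo : m ≠ o) :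
    ∑ I ∈ powersetCard k univ with o ∈ I ∧ m ∉ I, ∏ i ∈ I.erase o, l i =
      ∑ I ∈ powersetCard k univ with o ∉ I ∧ m ∈ I, ∏ i ∈ I.erase m, l i := by
  have hcard : ∀ {a b : ι} {I : Finset ι}, a ∈ I → b ∉ I → #(insert b (I.erase a)) = #I := by
    intro a b I ha hb
    rw [Finset.card_insert_of_notMem (fun h => hb (Finset.mem_of_mem_erase h)),
      Finset.card_erase_of_mem ha]
    have := Finset.card_pos.mpr ⟨a, ha⟩
    omega
  refine Finset.sum_nbij' (fun I => insert m (I.erase o)) (fun I => insert o (I.erase m))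
    ?_ ?_ ?_ ?_ ?_
  · intro I hI
    simp only [mem_filter, mem_powersetCard, subset_univ, true_and] at hI ⊢
    refine ⟨(hcard hI.2.1 hI.2.2).trans hI.1, ?_, by simp⟩
    simp [hmo.symm]
  · intro I hI
    simp only [mem_filter, mem_powersetCard, subset_univ, true_and] at hI ⊢
    refine ⟨(hcard hI.2.2 hI.2.1).trans hI.1, by simp, ?_⟩
    simp [hmo]
  · intro I hI
    simp only [mem_filter, mem_powersetCard, subset_univ, true_and] at hI
    rw [Finset.erase_insert (fun h => hI.2.2 (Finset.mem_of_mem_erase h)),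
      Finset.insert_erase hI.2.1]
  · intro I hI
    simp only [mem_filter, mem_powersetCard, subset_univ, true_and] at hI
    rw [Finset.erase_insert (fun h => hI.2.1 (Finset.mem_of_mem_erase h)),
      Finset.insert_erase hI.2.2]
  · intro I hI
    simp only [mem_filter, mem_powersetCard, subset_univ, true_and] at hI
    rw [Finset.erase_insert (fun h => hI.2.2 (Finset.mem_of_mem_erase h))]

/-- The quadratic inequality behind the inverse concavity of `σ_k ^ (1 / k)`, for a single
product of `k` variables. -/
theorem prod_inverse_concavity {k : ℕ} {l : ι → ℝ} {o m : ι} (hl : ∀ i, i ≠ o → 0 < l i)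
    {B C : Matrix ι ι ℝ} (hsymm : ∀ i j, B i j = B j i) {s : ℝ}
    (hC : ∀ i, i ≠ o → 2 * ∑ j ∈ univ.erase o, B i j ^ 2 / l j - (if i = m then 2 * l m else 0) -
      l i * s ≤ C i i) {I : Finset ι} (hI : #I = k) (hk : 1 ≤ k) (hoI : o ∉ I) :
    ((k : ℝ) + 1) / k * ((∏ i ∈ I, l i) * (∑ j ∈ I, B j j / l j) ^ 2) - k * (∏ i ∈ I, l i) * s -
      (if m ∈ I then 2 * l m * ∏ i ∈ I.erase m, l i else 0) ≤
    ∑ j ∈ I, C j j * ∏ i ∈ I.erase j, l i + ∑ j ∈ I, ∑ i ∈ I.erase j,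
      (B j j * B i i - B j i * B i j) * ∏ m ∈ (I.erase j).erase i, l m := by
  set P := ∏ i ∈ I, l i with hPdef
  set S := ∑ j ∈ I, B j j / l j with hSdef
  have hne : ∀ i ∈ I, i ≠ o := fun i hi h => hoI (h ▸ hi)
  have hlI : ∀ i ∈ I, 0 < l i := fun i hi => hl i (hne i hi)
  have hP : 0 < P := Finset.prod_pos hlI
  have hk0 : (0 : ℝ) < k := by exact_mod_cast hk
  have h1 : ∀ j ∈ I, ∏ i ∈ I.erase j, l i = P / l j := by
    intro j hj
    rw [eq_div_iff (hlI j hj).ne', mul_comm, Finset.mul_prod_erase I l hj]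
  have h2 : ∀ j ∈ I, ∀ i ∈ I.erase j, ∏ m ∈ (I.erase j).erase i, l m = P / l j / l i := by
    intro j hj i hi
    rw [eq_div_iff (hlI i (Finset.mem_of_mem_erase hi)).ne', mul_comm, Finset.mul_prod_erase _ l hi,
      h1 j hj]
  have key : ∀ j ∈ I, P * ((B j j / l j) ^ 2 + B j j / l j * S - s) -
      (if j = m then 2 * l m * (P / l m) else 0) ≤ C j j * ∏ i ∈ I.erase j, l i +
      ∑ i ∈ I.erase j, (B j j * B i i - B j i * B i j) * ∏ m ∈ (I.erase j).erase i, l m := by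
    intro j hj
    have hlj := hlI j hj
    -- Only the indices in `I` are needed. The factor `2` in `hC` pays both for the squares of
    -- off-diagonal entries subtracted in the `2 × 2` minors and for a second copy of the diagonal
    -- square.
    have h3 : B j j ^ 2 / l j + ∑ i ∈ I.erase j, B j i ^ 2 / l i ≤
        ∑ i ∈ univ.erase o, B j i ^ 2 / l i := by
      rw [Finset.add_sum_erase I (fun i => B j i ^ 2 / l i) hj]
      refine Finset.sum_le_sum_of_subset_of_nonneg (fun i hi => by simp [hne i hi]) fun i hi _ => ?_
      exact div_nonneg (sq_nonneg _) (hl i (Finset.ne_of_mem_erase hi)).le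
    have h4 : ∑ i ∈ I.erase j, (B j j * B i i - B j i * B i j) * ∏ m ∈ (I.erase j).erase i, l m =
        P / l j * (B j j * ∑ i ∈ I.erase j, B i i / l i - ∑ i ∈ I.erase j, B j i ^ 2 / l i) := by
      rw [Finset.mul_sum, ← Finset.sum_sub_distrib, Finset.mul_sum]
      refine Finset.sum_congr rfl fun i hi => ?_
      rw [h2 j hj i hi, hsymm i j]
      ring
    have h5 : S = B j j / l j + ∑ i ∈ I.erase j, B i i / l i :=
      (Finset.add_sum_erase I (fun i => B i i / l i) hj).symm
    have h6 := hC j (hne j hj)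
    have h7 : 0 ≤ ∑ i ∈ I.erase j, B j i ^ 2 / l i := Finset.sum_nonneg fun i hi =>
      div_nonneg (sq_nonneg _) (hlI i (Finset.mem_of_mem_erase hi)).le
    rw [h4, h1 j hj, h5]
    set D := ∑ i ∈ I.erase j, B i i / l i
    set G := ∑ i ∈ I.erase j, B j i ^ 2 / l i
    have h8 : 2 * (B j j ^ 2 / l j + G) - (if j = m then 2 * l m else 0) - l j * s ≤ C j j := by
      linarith
    have h9 : 0 < P / l j := div_pos hP hlj
    have h10 := mul_le_mul_of_nonneg_left h8 h9.le
    have h11 : P / l j * G ≥ 0 := mul_nonneg h9.le h7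
    have h12 : (if j = m then 2 * l m * (P / l m) else 0) =
        P / l j * (if j = m then 2 * l m else 0) := by
      by_cases h : j = m
      · subst h; simp only [if_true]; ring
      · simp [h]
    rw [h12]
    have h13 : P * ((B j j / l j) ^ 2 + B j j / l j * (B j j / l j + D) - s) =
        P / l j * (2 * (B j j ^ 2 / l j)) + P / l j * (B j j * D) - P / l j * (l j * s) := by
      field_simp
      ring
    rw [h13]
    nlinarith
  have hsum := Finset.sum_le_sum key
  rw [Finset.sum_sub_distrib, ← Finset.mul_sum, Finset.sum_sub_distrib, Finset.sum_add_distrib,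
    ← Finset.sum_mul, Finset.sum_const, hI, nsmul_eq_mul, Finset.sum_add_distrib] at hsum
  have h14 : ∑ j ∈ I, (if j = m then 2 * l m * (P / l m) else 0) =
      if m ∈ I then 2 * l m * ∏ i ∈ I.erase m, l i else 0 := by
    rw [Finset.sum_ite_eq' I m]
    by_cases hm : m ∈ I
    · simp only [hm, if_true, h1 m hm]
    · simp [hm]
  rw [h14] at hsum
  -- Cauchy–Schwarz over the `k` indices of `I` supplies the `1 / k` in the constant `(k + 1) / k =
  -- 1 + 1 / k`.
  have h15 : S ^ 2 ≤ k * ∑ j ∈ I, (B j j / l j) ^ 2 := by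
    have := sq_sum_le_card_mul_sum_sq (s := I) (f := fun j => B j j / l j)
    rwa [hI] at this
  have h16 : ((k : ℝ) + 1) / k * (P * S ^ 2) ≤ P * (∑ j ∈ I, (B j j / l j) ^ 2 + S * S) := by
    rw [div_mul_eq_mul_div, div_le_iff₀ hk0]
    nlinarith [mul_le_mul_of_nonneg_left h15 hP.le]
  refine le_trans ?_ hsum
  linarith

/-- A lower bound for the second derivative of `σ_k` along a curve of matrices degenerate in the
direction `o`, from inverse concavity. -/
theorem inverse_concavity {k : ℕ} (hk : 1 ≤ k) {l : ι → ℝ} {o m : ι} (hmo : m ≠ o) (ho : l o = 0)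
    (hl : ∀ i, i ≠ o → 0 < l i) {B C : Matrix ι ι ℝ} (hsymm : ∀ i j, B i j = B j i)
    (hoo : B o o = 0) (hom : B o m = -l m) (hoj : ∀ j, j ≠ m → B o j = 0) {s : ℝ}
    (hC : ∀ i, i ≠ o → 2 * ∑ j ∈ univ.erase o, B i j ^ 2 / l j - (if i = m then 2 * l m else 0) -
      l i * s ≤ C i i) (hCo : C o o = 2 * l m) (hσ : 0 < esymmFn k l) :
    ((k : ℝ) + 1) / k * ((∑ j, esymmD k l j * B j j) ^ 2 / esymmFn k l) - k * esymmFn k l * s ≤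
      ∑ j, esymmD k l j * C j j + minorHess k l B := by
  have hk0 : (0 : ℝ) < k := by exact_mod_cast hk
  have hl0 : ∀ i, 0 ≤ l i := fun i => by
    by_cases h : i = o
    · rw [h, ho]
    · exact (hl i h).le
  -- `u` records what is left over set by set. A set with `o` but without `m` gains `2 l m` times
  -- its remaining product from `C o o`; if it contains `m` too, the two ordered pairs of `o` and
  -- `m` in `minorHess` cancel this gain. A set with `m` but without `o` loses the same kind of term
  -- through `hC`. Gains and losses balance by the exchange of `o` and `m`.
  set u : Finset ι → ℝ := fun I => (if o ∈ I ∧ m ∉ I then 2 * l m * ∏ i ∈ I.erase o, l i else 0) -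
    (if o ∉ I ∧ m ∈ I then 2 * l m * ∏ i ∈ I.erase m, l i else 0) with hu
  have hu0 : ∑ I ∈ powersetCard k univ, u I = 0 := by
    simp only [hu]
    rw [Finset.sum_sub_distrib, ← Finset.sum_filter, ← Finset.sum_filter, ← Finset.mul_sum,
      ← Finset.mul_sum, sum_powersetCard_exchange k l hmo, sub_self]
  have herase : ∀ {I : Finset ι} {j}, o ∈ I → j ≠ o → ∏ i ∈ I.erase j, l i = 0 := fun h hj =>
    Finset.prod_eq_zero (mem_erase.mpr ⟨hj.symm, h⟩) ho
  have key : ∀ I ∈ powersetCard k univ,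
      ((k : ℝ) + 1) / k * ((∏ i ∈ I, l i) * (∑ j ∈ I, B j j / l j) ^ 2) -
        k * (∏ i ∈ I, l i) * s + u I ≤
      ∑ j ∈ I, C j j * ∏ i ∈ I.erase j, l i + ∑ j ∈ I, ∑ i ∈ I.erase j,
      (B j j * B i i - B j i * B i j) * ∏ m ∈ (I.erase j).erase i, l m := by
    intro I hI
    have hIc := (Finset.mem_powersetCard.mp hI).2
    by_cases hoI : o ∈ I
    · have h1 : ∑ j ∈ I, C j j * ∏ i ∈ I.erase j, l i = 2 * l m * ∏ i ∈ I.erase o, l i := by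
        rw [Finset.sum_eq_single_of_mem o hoI, hCo]
        intro j _ hj
        rw [herase hoI hj, mul_zero]
      have hin : ∀ j ∈ I, ∑ i ∈ I.erase j,
          (B j j * B i i - B j i * B i j) * ∏ m ∈ (I.erase j).erase i, l m =
          (if j = o then (if m ∈ I then -(l m * ∏ i ∈ I.erase o, l i) else 0) else 0) +
          (if j = m then -(l m * ∏ i ∈ I.erase o, l i) else 0) := by
        intro j hj
        by_cases hjo : j = o
        · subst hjo
          rw [if_pos rfl, if_neg hmo.symm, add_zero]
          have h2 : ∀ i ∈ I.erase j, i ≠ m →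
              (B j j * B i i - B j i * B i j) * ∏ m ∈ (I.erase j).erase i, l m = 0 := by
            intro i hi him
            rw [hoo, hoj i him]
            ring
          by_cases hm : m ∈ I
          · rw [if_pos hm, Finset.sum_eq_single_of_mem m (mem_erase.mpr ⟨hmo, hm⟩) h2, hoo,
              hsymm m j, hom, ← Finset.mul_prod_erase (I.erase j) l (mem_erase.mpr ⟨hmo, hm⟩)]
            ring
          · rw [if_neg hm]
            exact Finset.sum_eq_zero fun i hi => h2 i hi fun h =>
              hm (h ▸ Finset.mem_of_mem_erase hi)
        · rw [if_neg hjo, zero_add]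
          rw [Finset.sum_eq_single_of_mem o (mem_erase.mpr ⟨fun h => hjo h.symm, hoI⟩)]
          · rw [hoo, hsymm j o]
            by_cases hjm : j = m
            · subst hjm
              rw [if_pos rfl, hom, Finset.erase_right_comm,
                ← Finset.mul_prod_erase (I.erase o) l (mem_erase.mpr ⟨hjo, hj⟩)]
              ring
            · rw [if_neg hjm, hoj j hjm]
              ring
          · intro i _ hio
            have : ∏ m ∈ (I.erase j).erase i, l m = 0 :=
              Finset.prod_eq_zero (mem_erase.mpr ⟨fun h => hio h.symm,
                mem_erase.mpr ⟨fun h => hjo h.symm, hoI⟩⟩) ho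
            rw [this, mul_zero]
      rw [h1, Finset.sum_congr rfl hin, Finset.sum_add_distrib, Finset.sum_ite_eq' I o,
        Finset.sum_ite_eq' I m, if_pos hoI, Finset.prod_eq_zero hoI ho]
      by_cases hm : m ∈ I
      · simp only [hu, hoI, hm]
        simp only [not_true_eq_false, and_false, and_true, if_false, if_true]
        linarith
      · simp only [hu, hoI, hm]
        simp
    · have h := prod_inverse_concavity hl hsymm hC hIc hk hoI
      simp only [hu, hoI, false_and, if_false, not_false_eq_true, true_and, zero_sub]
      linarith
  have hS : ∑ j, esymmD k l j * B j j =
      ∑ I ∈ powersetCard k univ, (∏ i ∈ I, l i) * ∑ j ∈ I, B j j / l j := by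
    rw [sum_esymmD_mul]
    refine Finset.sum_congr rfl fun I _ => ?_
    rw [Finset.mul_sum]
    refine Finset.sum_congr rfl fun j hj => ?_
    by_cases hjo : j = o
    · rw [hjo, hoo]; simp
    · rw [← Finset.mul_prod_erase I l hj]
      have := (hl j hjo).ne'
      field_simp
  -- Cauchy–Schwarz over the index sets, weighted by their products. Sets containing `o` have weight
  -- zero, which makes the junk value of the division by `l o = 0` harmless.
  have hcs : (∑ j, esymmD k l j * B j j) ^ 2 ≤ esymmFn k l *
      ∑ I ∈ powersetCard k univ, (∏ i ∈ I, l i) * (∑ j ∈ I, B j j / l j) ^ 2 := by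
    rw [hS]
    refine Finset.sum_sq_le_sum_mul_sum_of_sq_le_mul _ (fun I _ => Finset.prod_nonneg fun i _ => hl0 i)
      (fun I _ => mul_nonneg (Finset.prod_nonneg fun i _ => hl0 i) (sq_nonneg _)) fun I _ => le_of_eq (by ring)
  have hsum := Finset.sum_le_sum key
  rw [Finset.sum_add_distrib, hu0, Finset.sum_sub_distrib, ← Finset.mul_sum, ← Finset.sum_mul,
    ← Finset.mul_sum, Finset.sum_add_distrib, ← sum_esymmD_mul k l fun j => C j j] at hsum
  have hq : (∑ j, esymmD k l j * B j j) ^ 2 / esymmFn k l ≤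
      ∑ I ∈ powersetCard k univ, (∏ i ∈ I, l i) * (∑ j ∈ I, B j j / l j) ^ 2 := by
    rw [div_le_iff₀ hσ, mul_comm]
    exact hcs
  have hk1 : 0 ≤ ((k : ℝ) + 1) / k := by positivity
  have := mul_le_mul_of_nonneg_left hq hk1
  have hdef : ∑ I ∈ powersetCard k univ, ∏ i ∈ I, l i = esymmFn k l := rfl
  rw [hdef] at hsum
  have hdef2 : minorHess k l B = ∑ I ∈ powersetCard k univ, ∑ j ∈ I, ∑ i ∈ I.erase j,
    (B j j * B i i - B j i * B i j) * ∏ m ∈ (I.erase j).erase i, l m := rfl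
  rw [← hdef2] at hsum
  linarith

end Minors

/-! ### Directional derivatives away from the origin -/

section Directional

variable {V : Type*} [NormedAddCommGroup V] [NormedSpace ℝ V]

/-- The directional derivative of `F` along the constant vector field `v`. -/
noncomputable def pd (v : V) (F : V → ℝ) : V → ℝ := fun y => fderiv ℝ F y v

variable {F G : V → ℝ}

theorem pd_smooth (hF : ContDiffOn ℝ ∞ F {0}ᶜ) (v : V) : ContDiffOn ℝ ∞ (pd v F) {0}ᶜ :=
  (hF.fderiv_of_isOpen isOpen_compl_singleton (by norm_num)).clm_apply contDiffOn_const

theorem differentiableAt_of_smooth (hF : ContDiffOn ℝ ∞ F {0}ᶜ) {y : V} (hy : y ≠ 0) :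
    DifferentiableAt ℝ F y :=
  (hF.contDiffAt (isOpen_compl_singleton.mem_nhds hy)).differentiableAt (by norm_num)

theorem pd_congr (h : ∀ y, y ≠ 0 → F y = G y) (v : V) {y : V} (hy : y ≠ 0) :
    pd v F y = pd v G y := by
  have : F =ᶠ[𝓝 y] G := by
    filter_upwards [isOpen_compl_singleton.mem_nhds hy] with z hz using h z hz
  rw [pd, pd, this.fderiv_eq]

theorem pd_comm (hF : ContDiffOn ℝ ∞ F {0}ᶜ) (v w : V) {y : V} (hy : y ≠ 0) :
    pd v (pd w F) y = pd w (pd v F) y := by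
  have hc := hF.contDiffAt (isOpen_compl_singleton.mem_nhds hy)
  have hsymm : IsSymmSndFDerivAt ℝ F y := hc.isSymmSndFDerivAt (by simp; norm_cast)
  have hd : DifferentiableAt ℝ (fderiv ℝ F) y :=
    (hc.fderiv_right (m := 1) (by norm_cast)).differentiableAt (by norm_num)
  have h : ∀ v w : V, pd v (pd w F) y = fderiv ℝ (fderiv ℝ F) y v w := by
    intro v w
    unfold pd
    rw [fderiv_clm_apply hd (differentiableAt_const w)]
    simp
  rw [h, h]
  exact hsymm v w

theorem pd_smul_left (c : ℝ) (v : V) (F : V → ℝ) (y : V) : pd (c • v) F y = c * pd v F y :=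
  map_smul _ _ _

theorem pd_sum_left {ι : Type*} (s : Finset ι) (v : ι → V) (F : V → ℝ) (y : V) :
    pd (∑ i ∈ s, v i) F y = ∑ i ∈ s, pd (v i) F y :=
  map_sum _ _ _

theorem hasDerivAt_line (hF : ContDiffOn ℝ ∞ F {0}ᶜ) (x v : V) {t : ℝ} (h : x + t • v ≠ 0) :
    HasDerivAt (fun s : ℝ => F (x + s • v)) (pd v F (x + t • v)) t := by
  have h1 := (differentiableAt_of_smooth hF h).hasFDerivAt
  have h2 : HasDerivAt (fun s : ℝ => x + s • v) v t := by
    simpa using ((hasDerivAt_id t).smul_const v).const_add x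
  exact h1.comp_hasDerivAt t h2

theorem jet2_line (hF : ContDiffOn ℝ ∞ F {0}ᶜ) {x : V} (hx : x ≠ 0) (v : V) :
    Jet2 (fun t : ℝ => F (x + t • v)) (F x) (pd v F x) (pd v (pd v F) x) := by
  refine ⟨by simp, fun t => pd v F (x + t • v), ?_, by simp, ?_⟩
  · have hc : ContinuousAt (fun t : ℝ => x + t • v) 0 := by fun_prop
    have : ∀ᶠ t in 𝓝 (0 : ℝ), x + t • v ≠ 0 :=
      hc.eventually (isOpen_compl_singleton.mem_nhds (by simpa using hx))
    filter_upwards [this] with t ht using hasDerivAt_line hF x v ht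
  · simpa using hasDerivAt_line (pd_smooth hF v) x v (t := 0) (by simpa using hx)

theorem Jet2.unique {g : ℝ → ℝ} {a b c a' b' c' : ℝ} (h : Jet2 g a b c) (h' : Jet2 g a' b' c') :
    a = a' ∧ b = b' ∧ c = c' := by
  obtain ⟨rfl, f, h1, rfl, h2⟩ := h
  obtain ⟨h0, f', h3, rfl, h4⟩ := h'
  have he : f =ᶠ[𝓝 0] f' := by
    filter_upwards [h1, h3] with t ht ht' using ht.unique ht'
  exact ⟨h0, he.self_of_nhds, h2.unique (h4.congr_of_eventuallyEq he)⟩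

theorem pd_mul (hF : ContDiffOn ℝ ∞ F {0}ᶜ) (hG : ContDiffOn ℝ ∞ G {0}ᶜ) (v : V) {y : V}
    (hy : y ≠ 0) : pd v (fun z => F z * G z) y = pd v F y * G y + F y * pd v G y := by
  unfold pd
  rw [fderiv_fun_mul (differentiableAt_of_smooth hF hy) (differentiableAt_of_smooth hG hy)]
  simp
  ring

theorem pd_sub (hF : ContDiffOn ℝ ∞ F {0}ᶜ) (hG : ContDiffOn ℝ ∞ G {0}ᶜ) (v : V) {y : V}
    (hy : y ≠ 0) : pd v (fun z => F z - G z) y = pd v F y - pd v G y := by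
  unfold pd
  rw [fderiv_fun_sub (differentiableAt_of_smooth hF hy) (differentiableAt_of_smooth hG hy)]
  rfl

theorem pd_const_mul (hF : ContDiffOn ℝ ∞ F {0}ᶜ) (c : ℝ) (v : V) {y : V} (hy : y ≠ 0) :
    pd v (fun z => c * F z) y = c * pd v F y := by
  unfold pd
  rw [fderiv_const_mul (differentiableAt_of_smooth hF hy)]
  rfl

/-- `F` is positively homogeneous of degree `m`. -/
def PosHom (m : ℤ) (F : V → ℝ) : Prop := ∀ c : ℝ, 0 < c → ∀ y, y ≠ 0 → F (c • y) = c ^ m * F y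

theorem PosHom.pd {m : ℤ} (hF : ContDiffOn ℝ ∞ F {0}ᶜ) (h : PosHom m F) (v : V) :
    PosHom (m - 1) (pd v F) := by
  intro c hc y hy
  have hcy : c • y ≠ 0 := smul_ne_zero hc.ne' hy
  have h1 : HasFDerivAt (fun z => F (c • z)) ((fderiv ℝ F (c • y)).comp
      (c • ContinuousLinearMap.id ℝ V)) y :=
    (differentiableAt_of_smooth hF hcy).hasFDerivAt.comp y
      ((c • ContinuousLinearMap.id ℝ V).hasFDerivAt)
  have h2 : HasFDerivAt (fun z => F (c • z)) (c ^ m • fderiv ℝ F y) y := by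
    refine ((differentiableAt_of_smooth hF hy).hasFDerivAt.const_mul (c ^ m)).congr_of_eventuallyEq
      ?_
    filter_upwards [isOpen_compl_singleton.mem_nhds hy] with z hz using h c hc z hz
  have h3 := congrArg (fun L : V →L[ℝ] ℝ => L v) (h1.unique h2)
  simp only [ContinuousLinearMap.comp_apply, _root_.smul_apply,
    ContinuousLinearMap.id_apply, map_smul, smul_eq_mul] at h3
  unfold _root_.pd
  rw [zpow_sub_one₀ hc.ne']
  field_simp
  linarith

theorem PosHom.euler {m : ℤ} (hF : ContDiffOn ℝ ∞ F {0}ᶜ) (h : PosHom m F) {x : V} (hx : x ≠ 0) :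
    _root_.pd x F x = m * F x := by
  have h1 : HasDerivAt (fun t : ℝ => F (x + t • x)) (_root_.pd x F x) 0 := by
    simpa using hasDerivAt_line hF x x (t := 0) (by simpa using hx)
  have h2 : HasDerivAt (fun t : ℝ => (1 + t) ^ m * F x) (m * F x) 0 := by
    have h3 : HasDerivAt (fun t : ℝ => 1 + t) 1 0 := (hasDerivAt_id (0 : ℝ)).const_add 1
    have h4 := (hasDerivAt_zpow m (1 + 0 : ℝ) (Or.inl (by norm_num))).comp (0 : ℝ) h3
    simpa using h4.mul_const (F x)
  refine h1.unique (h2.congr_of_eventuallyEq ?_)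
  filter_upwards [lt_mem_nhds (show (-1 : ℝ) < 0 by norm_num)] with t ht
  have : x + t • x = (1 + t) • x := by rw [add_smul, one_smul]
  rw [this, h _ (by linarith) x hx]

end Directional

/-! ### Joint smoothness in space and time, and interchange of time and space derivatives -/

section TimeDependent

variable {V : Type*} [NormedAddCommGroup V] [NormedSpace ℝ V] {I : Set ℝ} {F : ℝ → V → ℝ}

theorem smooth_slice (hF : ContDiffOn ℝ ∞ (fun q : ℝ × V => F q.1 q.2) (I ×ˢ {0}ᶜ)) {τ : ℝ}
    (hτ : τ ∈ I) : ContDiffOn ℝ ∞ (F τ) {0}ᶜ := by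
  have h : ContDiffOn ℝ ∞ (fun y : V => ((τ, y) : ℝ × V)) {0}ᶜ :=
    (contDiff_const.prodMk contDiff_id).contDiffOn
  exact hF.comp h fun y hy => ⟨hτ, hy⟩

/-- The interval may contain its initial time, so the total derivative is taken within the set;
unique differentiability makes it smooth up to that time. In spatial directions it is the ordinary
derivative of the slice. -/
theorem pd_smooth_joint (hI : UniqueDiffOn ℝ I)
    (hF : ContDiffOn ℝ ∞ (fun q : ℝ × V => F q.1 q.2) (I ×ˢ {0}ᶜ)) (v : V) :
    ContDiffOn ℝ ∞ (fun q : ℝ × V => pd v (F q.1) q.2) (I ×ˢ {0}ᶜ) := by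
  have hS : UniqueDiffOn ℝ (I ×ˢ ({0}ᶜ : Set V)) := hI.prod isOpen_compl_singleton.uniqueDiffOn
  have h1 : ContDiffOn ℝ ∞ (fun q => fderivWithin ℝ (fun q : ℝ × V => F q.1 q.2) (I ×ˢ {0}ᶜ) q
      ((0, v) : ℝ × V)) (I ×ˢ ({0}ᶜ : Set V)) :=
    (hF.fderivWithin hS (by norm_num)).clm_apply contDiffOn_const
  refine h1.congr ?_
  rintro ⟨τ, y⟩ ⟨hτ, hy⟩
  have hd : DifferentiableWithinAt ℝ (fun q : ℝ × V => F q.1 q.2) (I ×ˢ {0}ᶜ) (τ, y) :=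
    (hF (τ, y) ⟨hτ, hy⟩).differentiableWithinAt (by norm_num)
  have h2 : HasFDerivWithinAt (fun y : V => ((τ, y) : ℝ × V))
      ((0 : V →L[ℝ] ℝ).prod (ContinuousLinearMap.id ℝ V)) {0}ᶜ y :=
    ((hasFDerivAt_const τ y).prodMk (hasFDerivAt_id y)).hasFDerivWithinAt
  have h3 := hd.hasFDerivWithinAt.comp y h2 (fun z hz => ⟨hτ, hz⟩)
  have h4 := (h3.hasFDerivAt (isOpen_compl_singleton.mem_nhds hy)).fderiv
  have h5 : pd v (F τ) y = fderiv ℝ ((fun q : ℝ × V => F q.1 q.2) ∘ fun y : V => (τ, y)) y v := rfl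
  change pd v (F τ) y = _
  rw [h5, h4]
  simp

theorem pd_hasDerivAt_time (hF : ContDiffOn ℝ ∞ (fun q : ℝ × V => F q.1 q.2) (I ×ˢ {0}ᶜ))
    {G : ℝ → V → ℝ}
    (hG : ∀ τ ∈ interior I, ∀ y, y ≠ 0 → HasDerivAt (fun s => F s y) (G τ y) τ)
    {τ : ℝ} (hτ : τ ∈ interior I) (v : V) {y : V} (hy : y ≠ 0) :
    HasDerivAt (fun s => pd v (F s) y) (pd v (G τ) y) τ := by
  set Φ : ℝ × V → ℝ := fun q => F q.1 q.2 with hΦ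
  have hopen : IsOpen (interior I ×ˢ ({0}ᶜ : Set V)) := isOpen_interior.prod isOpen_compl_singleton
  have hca : ∀ q ∈ interior I ×ˢ ({0}ᶜ : Set V), ContDiffAt ℝ ∞ Φ q := fun q hq =>
    (hF.mono (Set.prod_mono interior_subset subset_rfl)).contDiffAt (hopen.mem_nhds hq)
  have hda : ∀ q ∈ interior I ×ˢ ({0}ᶜ : Set V), DifferentiableAt ℝ Φ q := fun q hq =>
    (hca q hq).differentiableAt (by norm_num)
  have hq : ((τ, y) : ℝ × V) ∈ interior I ×ˢ ({0}ᶜ : Set V) := ⟨hτ, hy⟩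
  have hsymm : IsSymmSndFDerivAt ℝ Φ (τ, y) := (hca _ hq).isSymmSndFDerivAt (by simp; norm_cast)
  have hd2 : HasFDerivAt (fderiv ℝ Φ) (fderiv ℝ (fderiv ℝ Φ) (τ, y)) (τ, y) :=
    (((hca _ hq).fderiv_right (m := 1) (by norm_cast)).differentiableAt (by norm_num)).hasFDerivAt
  have hv : ∀ s ∈ interior I, ∀ z, z ≠ 0 → pd v (F s) z = fderiv ℝ Φ (s, z) (0, v) := by
    intro s hs z hz
    have h1 := (hda (s, z) ⟨hs, hz⟩).hasFDerivAt.comp z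
      ((hasFDerivAt_const s z).prodMk (hasFDerivAt_id z))
    have h5 : pd v (F s) z = fderiv ℝ (Φ ∘ fun y : V => (s, y)) z v := rfl
    rw [h5, HasFDerivAt.fderiv h1]
    simp
  have ht : ∀ s ∈ interior I, ∀ z, z ≠ 0 → G s z = fderiv ℝ Φ (s, z) (1, 0) := by
    intro s hs z hz
    have h1 := (hda (s, z) ⟨hs, hz⟩).hasFDerivAt.comp_hasDerivAt s
      ((hasDerivAt_id s).prodMk (hasDerivAt_const s z))
    exact (hG s hs z hz).unique h1
  have e1 : HasDerivAt (fun s => fderiv ℝ Φ (s, y) (0, v))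
      (fderiv ℝ (fderiv ℝ Φ) (τ, y) (1, 0) (0, v)) τ := by
    have h1 := hd2.comp_hasDerivAt τ ((hasDerivAt_id τ).prodMk (hasDerivAt_const τ y))
    have h2 := h1.clm_apply (hasDerivAt_const τ ((0, v) : ℝ × V))
    simpa using h2
  have e2 : HasFDerivAt (fun z => fderiv ℝ Φ (τ, z) (1, 0))
      (((fderiv ℝ (fderiv ℝ Φ) (τ, y)).comp
        ((0 : V →L[ℝ] ℝ).prod (ContinuousLinearMap.id ℝ V))).flip (1, 0)) y := by
    have h1 := hd2.comp y ((hasFDerivAt_const τ y).prodMk (hasFDerivAt_id y))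
    have h2 := h1.clm_apply (hasFDerivAt_const ((1, 0) : ℝ × V) y)
    refine h2.congr_fderiv ?_
    ext w
    simp
  have e3 : pd v (G τ) y = fderiv ℝ (fderiv ℝ Φ) (τ, y) (0, v) (1, 0) := by
    have h1 : G τ =ᶠ[𝓝 y] fun z => fderiv ℝ Φ (τ, z) (1, 0) := by
      filter_upwards [isOpen_compl_singleton.mem_nhds hy] with z hz using ht τ hτ z hz
    rw [pd, h1.fderiv_eq, e2.fderiv]
    simp
  rw [e3, hsymm]
  refine e1.congr_of_eventuallyEq ?_
  filter_upwards [isOpen_interior.mem_nhds hτ] with s hs using hv s hs y hy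

end TimeDependent

/-- A function that is positive initially, and whose time derivative is positive wherever it
touches zero for the first time, stays positive. -/
theorem pos_of_first_touch {X : Type*} [TopologicalSpace X] {I : Set ℝ} {K : Set X}
    (hK : IsCompact K) (hI : ∀ τ ∈ I, 0 ≤ τ ∧ Set.Icc 0 τ ⊆ I) {f : ℝ → X → ℝ}
    (hf : ContinuousOn (fun q : ℝ × X => f q.1 q.2) (I ×ˢ K)) (h0 : ∀ x ∈ K, 0 < f 0 x)
    (htouch : ∀ τ ∈ I, 0 < τ → ∀ x ∈ K, f τ x = 0 → (∀ y ∈ K, 0 ≤ f τ y) →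
      ∃ y ∈ K, f τ y = 0 ∧ ∃ d, 0 < d ∧ HasDerivAt (fun s => f s y) d τ) :
    ∀ τ ∈ I, ∀ x ∈ K, 0 < f τ x := by
  intro τ₁ hτ₁ x₁ hx₁
  by_contra! hneg
  obtain ⟨hτ₁0, hsub⟩ := hI τ₁ hτ₁
  -- The set of bad points is compact, hence has a point of least time; that is the time of first
  -- touching.
  set S : Set (ℝ × X) := (Set.Icc 0 τ₁ ×ˢ K) ∩ {q | f q.1 q.2 ≤ 0} with hS
  have hQ : IsCompact (Set.Icc 0 τ₁ ×ˢ K) := isCompact_Icc.prod hK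
  have hfQ : ContinuousOn (fun q : ℝ × X => f q.1 q.2) (Set.Icc 0 τ₁ ×ˢ K) :=
    hf.mono (Set.prod_mono hsub subset_rfl)
  have hSc : IsCompact S := by
    obtain ⟨u, hu, hu2⟩ := (continuousOn_iff_isClosed.mp hfQ) (Set.Iic 0) isClosed_Iic
    have : S = u ∩ (Set.Icc 0 τ₁ ×ˢ K) := by rw [← hu2, Set.inter_comm]; rfl
    rw [this, Set.inter_comm]
    exact hQ.inter_right hu
  have hSne : S.Nonempty := ⟨(τ₁, x₁), ⟨⟨hτ₁0, le_rfl⟩, hx₁⟩, hneg⟩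
  obtain ⟨⟨τ, x⟩, hq, hmin⟩ := hSc.exists_isMinOn hSne continuous_fst.continuousOn
  obtain ⟨⟨hτ, hx⟩, hle⟩ := hq
  have hτI : τ ∈ I := hsub hτ
  replace hle : f τ x ≤ 0 := hle
  replace hτ : τ ∈ Set.Icc 0 τ₁ := hτ
  replace hx : x ∈ K := hx
  have hbefore : ∀ s, 0 ≤ s → s < τ → ∀ y ∈ K, 0 < f s y := by
    intro s hs hsτ y hy
    by_contra! hcon
    have h1 : ((s, y) : ℝ × X) ∈ S := ⟨⟨⟨hs, hsτ.le.trans hτ.2⟩, hy⟩, hcon⟩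
    exact absurd (isMinOn_iff.mp hmin _ h1) (not_le.mpr hsτ)
  have hτpos : 0 < τ := by
    rcases hτ.1.eq_or_lt with h | h
    · rw [← h] at hle
      exact absurd (h0 x hx) (not_lt.mpr hle)
    · exact h
  have hnow : ∀ y ∈ K, 0 ≤ f τ y := by
    intro y hy
    have hc : ContinuousWithinAt (fun s => f s y) (Set.Ico 0 τ) τ := by
      have h1 := hfQ (τ, y) ⟨hτ, hy⟩
      have h2 : ContinuousWithinAt (fun s : ℝ => ((s, y) : ℝ × X)) (Set.Ico 0 τ) τ := by fun_prop
      exact ContinuousWithinAt.comp (f := fun s : ℝ => ((s, y) : ℝ × X)) h1 h2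
        fun s hs => ⟨⟨hs.1, hs.2.le.trans hτ.2⟩, hy⟩
    have hne : (𝓝[Set.Ico 0 τ] τ).NeBot := by
      rw [← mem_closure_iff_nhdsWithin_neBot, closure_Ico hτpos.ne]
      exact ⟨hτpos.le, le_rfl⟩
    refine ge_of_tendsto hc ?_
    filter_upwards [self_mem_nhdsWithin] with s hs using (hbefore s hs.1 hs.2 y hy).le
  have hzero : f τ x = 0 := le_antisymm hle (hnow x hx)
  -- The zero `y` with positive derivative need not be the point `x` found above, which leaves the
  -- freedom to pass to a better zero of the same slice. A positive derivative at a zero would force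
  -- negative values just before `τ`.
  obtain ⟨y, hy, hzero, d, hd, hder⟩ := htouch τ hτI hτpos x hx hzero hnow
  have h1 : ∀ᶠ s in 𝓝[≠] τ, 0 < slope (fun s => f s y) τ s :=
    hder.tendsto_slope.eventually (lt_mem_nhds hd)
  have h2 : ∀ᶠ s in 𝓝[<] τ, 0 < slope (fun s => f s y) τ s :=
    h1.filter_mono (nhdsWithin_mono _ fun t ht => ne_of_lt ht)
  have h3 : ∀ᶠ s in 𝓝[<] τ, 0 ≤ s := (le_mem_nhds hτpos).filter_mono nhdsWithin_le_nhds
  obtain ⟨s, hs1, hs2, hs3⟩ := (h2.and (h3.and self_mem_nhdsWithin)).exists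
  have hs3 : s < τ := hs3
  rw [slope_def_field, hzero, sub_zero] at hs1
  exact absurd hs1 (not_lt.mpr (div_nonpos_of_nonneg_of_nonpos (hbefore s hs2 hs3 y hy).le
    (by linarith)))

/-! ### Homogeneous extensions of functions on the sphere -/

section Extension

variable {n : ℕ}

open Classical in
/-- The radial projection of `ℝⁿ⁺¹ \ {0}` onto the sphere (with an arbitrary value at `0`). -/
noncomputable def toSph (y : Amb n) : Sph n :=
  if hy : y = 0 then ⟨EuclideanSpace.single 0 1, by simp⟩
  else ⟨‖y‖⁻¹ • y, by
    rw [mem_sphere_zero_iff_norm, norm_smul, norm_inv, norm_norm,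
      inv_mul_cancel₀ (norm_ne_zero_iff.mpr hy)]⟩

theorem coe_toSph {y : Amb n} (hy : y ≠ 0) : (toSph y : Amb n) = ‖y‖⁻¹ • y := by
  simp [toSph, hy]

theorem radialExt_eq {G : Type*} [Zero G] (f : Sph n → G) {y : Amb n} (hy : y ≠ 0) :
    radialExt f y = f (toSph y) := by
  simp [radialExt, toSph, hy]

theorem Sph.norm_coe (x : Sph n) : ‖(x : Amb n)‖ = 1 := mem_sphere_zero_iff_norm.mp x.2

theorem Sph.coe_ne_zero (x : Sph n) : (x : Amb n) ≠ 0 := by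
  intro h
  have := x.norm_coe
  rw [h, norm_zero] at this
  exact zero_ne_one this

theorem toSph_smul {c : ℝ} (hc : 0 < c) {y : Amb n} (hy : y ≠ 0) : toSph (c • y) = toSph y := by
  apply Subtype.ext
  rw [coe_toSph hy, coe_toSph (smul_ne_zero hc.ne' hy), norm_smul, Real.norm_of_nonneg hc.le,
    smul_smul, mul_inv, mul_assoc, mul_comm ‖y‖⁻¹ c, ← mul_assoc, inv_mul_cancel₀ hc.ne', one_mul]

theorem toSph_coe (x : Sph n) : toSph (x : Amb n) = x := by
  apply Subtype.ext
  rw [coe_toSph x.coe_ne_zero, x.norm_coe]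
  simp

theorem contMDiffOn_toSph :
    ContMDiffOn 𝓘(ℝ, Amb n) (𝓡 n) ∞ (toSph : Amb n → Sph n) {0}ᶜ := by
  let U : TopologicalSpace.Opens (Amb n) := ⟨{0}ᶜ, isOpen_compl_singleton⟩
  have h1 : ContMDiff 𝓘(ℝ, Amb n) 𝓘(ℝ, Amb n) ∞
      (fun u : U => (‖(u : Amb n)‖⁻¹ • (u : Amb n) : Amb n)) := by
    intro u
    have h2 : ContDiffAt ℝ ∞ (fun y : Amb n => ‖y‖⁻¹ • y) (u : Amb n) := by
      have hu : (u : Amb n) ≠ 0 := u.2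
      exact ((contDiffAt_norm ℝ hu).inv (norm_ne_zero_iff.mpr hu)).smul contDiffAt_id
    exact h2.contMDiffAt.comp u contMDiff_subtype_val.contMDiffAt
  have hmem : ∀ u : U, ‖(u : Amb n)‖⁻¹ • (u : Amb n) ∈ Metric.sphere (0 : Amb n) 1 := by
    intro u
    have hu : (u : Amb n) ≠ 0 := u.2
    rw [← coe_toSph hu]
    exact (toSph (u : Amb n)).2
  have : Fact (Module.finrank ℝ (Amb n) = n + 1) := ⟨by simp⟩
  have h3 := h1.codRestrict_sphere (n := n) hmem
  intro y hy
  have h4 := h3 (⟨y, hy⟩ : U)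
  have h5 : (Set.codRestrict _ _ hmem : U → Sph n) = fun u : U => toSph (u : Amb n) := by
    funext u
    apply Subtype.ext
    have hu : (u : Amb n) ≠ 0 := u.2
    rw [coe_toSph hu]
    rfl
  rw [h5] at h4
  exact (contMDiffAt_subtype_iff.mp h4).contMDiffWithinAt

theorem radialExt_smooth_joint {I : Set ℝ} {h : ℝ → Sph n → ℝ}
    (hh : ContMDiffOn ((𝓡 n).prod 𝓘(ℝ, ℝ)) 𝓘(ℝ, ℝ) ∞ (fun q : Sph n × ℝ => h q.2 q.1)
      (Set.univ ×ˢ I)) :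
    ContDiffOn ℝ ∞ (fun q : ℝ × Amb n => radialExt (h q.1) q.2) (I ×ˢ {0}ᶜ) := by
  have h1 : ContMDiffOn 𝓘(ℝ, ℝ × Amb n) (𝓡 n) ∞ (fun q : ℝ × Amb n => toSph q.2)
      (I ×ˢ ({0}ᶜ : Set (Amb n))) :=
    contMDiffOn_toSph.comp (contDiff_snd.contMDiff.contMDiffOn) fun q hq => hq.2
  have h2 : ContMDiffOn 𝓘(ℝ, ℝ × Amb n) 𝓘(ℝ, ℝ) ∞ (fun q : ℝ × Amb n => q.1)
      (I ×ˢ ({0}ᶜ : Set (Amb n))) := contDiff_fst.contMDiff.contMDiffOn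
  have h3 := hh.comp (h1.prodMk h2) fun q hq => ⟨Set.mem_univ _, hq.1⟩
  refine (contMDiffOn_iff_contDiffOn.mp h3).congr ?_
  rintro ⟨τ, y⟩ ⟨-, hy⟩
  exact radialExt_eq (h τ) hy

theorem radialExt_smooth {f : Sph n → ℝ} (hf : ContMDiff (𝓡 n) 𝓘(ℝ, ℝ) ∞ f) :
    ContDiffOn ℝ ∞ (radialExt f) {0}ᶜ := by
  refine (contMDiffOn_iff_contDiffOn.mp (hf.comp_contMDiffOn contMDiffOn_toSph)).congr ?_
  intro y hy
  exact radialExt_eq f hy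

/-- The extension of a function on the sphere to a positively homogeneous function of
degree one. -/
noncomputable def homExt (f : Sph n → ℝ) (y : Amb n) : ℝ := ‖y‖ * radialExt f y

theorem norm_smooth : ContDiffOn ℝ ∞ (fun y : Amb n => ‖y‖) {0}ᶜ :=
  contDiffOn_id.norm ℝ fun _ hy => hy

theorem homExt_smooth {f : Sph n → ℝ} (hf : ContMDiff (𝓡 n) 𝓘(ℝ, ℝ) ∞ f) :
    ContDiffOn ℝ ∞ (homExt f) {0}ᶜ :=
  norm_smooth.mul (radialExt_smooth hf)

theorem homExt_smooth_joint {I : Set ℝ} {h : ℝ → Sph n → ℝ}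
    (hh : ContMDiffOn ((𝓡 n).prod 𝓘(ℝ, ℝ)) 𝓘(ℝ, ℝ) ∞ (fun q : Sph n × ℝ => h q.2 q.1)
      (Set.univ ×ˢ I)) :
    ContDiffOn ℝ ∞ (fun q : ℝ × Amb n => homExt (h q.1) q.2) (I ×ˢ {0}ᶜ) := by
  have h1 : ContDiffOn ℝ ∞ (fun q : ℝ × Amb n => ‖q.2‖) (I ×ˢ {0}ᶜ) :=
    contDiffOn_snd.norm ℝ fun q hq => hq.2
  exact h1.mul (radialExt_smooth_joint hh)

theorem homExt_coe (f : Sph n → ℝ) (x : Sph n) : homExt f x = f x := by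
  rw [homExt, x.norm_coe, one_mul, radialExt_eq f x.coe_ne_zero, toSph_coe]

theorem homExt_eq (f : Sph n → ℝ) {y : Amb n} (hy : y ≠ 0) : homExt f y = ‖y‖ * f (toSph y) := by
  rw [homExt, radialExt_eq f hy]

theorem homExt_posHom (f : Sph n → ℝ) : PosHom 1 (homExt f) := by
  intro c hc y hy
  rw [homExt_eq f hy, homExt_eq f (smul_ne_zero hc.ne' hy), toSph_smul hc hy, norm_smul,
    Real.norm_of_nonneg hc.le, zpow_one, mul_assoc]

theorem inner_gradient_eq_pd (F : Amb n → ℝ) (y w : Amb n) : ⟪gradient F y, w⟫ = pd w F y :=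
  inner_gradient_left

theorem gradient_differentiableAt {F : Amb n → ℝ} (hF : ContDiffOn ℝ ∞ F {0}ᶜ) {y : Amb n}
    (hy : y ≠ 0) : DifferentiableAt ℝ (gradient F) y := by
  have hc := hF.contDiffAt (isOpen_compl_singleton.mem_nhds hy)
  have hd : DifferentiableAt ℝ (fderiv ℝ F) y :=
    (hc.fderiv_right (m := 1) (by norm_cast)).differentiableAt (by norm_num)
  exact ((InnerProductSpace.toDual ℝ (Amb n)).symm.toContinuousLinearEquiv.differentiableAt).comp y hd

theorem inner_fderiv_gradient {F : Amb n → ℝ} (hF : ContDiffOn ℝ ∞ F {0}ᶜ) {y : Amb n}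
    (hy : y ≠ 0) (v w : Amb n) : ⟪fderiv ℝ (gradient F) y v, w⟫ = pd v (pd w F) y := by
  have h1 : pd w F = fun z => ⟪gradient F z, w⟫ := funext fun z => (inner_gradient_eq_pd F z w).symm
  rw [h1, pd, fderiv_inner_apply ℝ (gradient_differentiableAt hF hy) (differentiableAt_const w)]
  simp

theorem pd_norm (x : Sph n) (w : Amb n) : pd w (fun y : Amb n => ‖y‖) x = ⟪(x : Amb n), w⟫ := by
  have h : HasFDerivAt (fun y : Amb n => ‖y‖ ^ 2) (2 • innerSL ℝ (x : Amb n)) (x : Amb n) :=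
    (hasStrictFDerivAt_norm_sq (x : Amb n)).hasFDerivAt
  have h2 := (differentiableAt_of_smooth norm_smooth x.coe_ne_zero).hasFDerivAt.pow 2
  have h3 := congrArg (fun L : Amb n →L[ℝ] ℝ => L w) (h.unique h2)
  simp [x.norm_coe] at h3
  rw [pd]
  exact h3.symm

/-- Both sides have degree zero, so it suffices to compare them on the sphere, where the product
rule for `‖y‖` times the radial extension gives `f x • x` plus the tangential gradient. -/
theorem radialExt_gaussParam {f : Sph n → ℝ} (hf : ContMDiff (𝓡 n) 𝓘(ℝ, ℝ) ∞ f) {y : Amb n}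
    (hy : y ≠ 0) : radialExt (gaussParam f) y = gradient (homExt f) y := by
  refine ext_inner_right ℝ fun w => ?_
  have hy' : 0 < ‖y‖⁻¹ := inv_pos.mpr (norm_pos_iff.mpr hy)
  have h1 := (homExt_posHom f).pd (homExt_smooth hf) w _ hy' y hy
  rw [sub_self, zpow_zero, one_mul, ← coe_toSph hy] at h1
  rw [radialExt_eq _ hy, inner_gradient_eq_pd, ← h1, gaussParam, inner_add_left,
    inner_smul_left, sphGrad, inner_gradient_eq_pd]
  set x := toSph y
  have h2 := pd_mul norm_smooth (radialExt_smooth hf) w x.coe_ne_zero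
  change pd w (homExt f) x = _ at h2
  rw [h2, pd_norm, x.norm_coe, radialExt_eq f x.coe_ne_zero, toSph_coe]
  simp
  ring

theorem inner_sphDeriv_gaussParam {f : Sph n → ℝ} (hf : ContMDiff (𝓡 n) 𝓘(ℝ, ℝ) ∞ f) (x : Sph n)
    (v : TSph x) (w : Amb n) :
    ⟪sphDeriv (gaussParam f) x v, w⟫ = pd (v : Amb n) (pd w (homExt f)) x := by
  have h : radialExt (gaussParam f) =ᶠ[𝓝 (x : Amb n)] gradient (homExt f) := by
    filter_upwards [isOpen_compl_singleton.mem_nhds x.coe_ne_zero] with y hy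
      using radialExt_gaussParam hf hy
  rw [← inner_fderiv_gradient (homExt_smooth hf) x.coe_ne_zero, ← h.fderiv_eq]
  rfl

theorem inner_coe_tangent (x : Sph n) (w : TSph x) : ⟪(x : Amb n), (w : Amb n)⟫ = 0 :=
  Submodule.mem_orthogonal_singleton_iff_inner_right.mp w.2

/-- The bridge from covariant calculus to the flat Hessian: the zeroth order term of `radiiOp` is
what separates the second derivatives of the degree-zero extension from those of the degree-one
extension. -/
theorem inner_radiiOp {f : Sph n → ℝ} (hf : ContMDiff (𝓡 n) 𝓘(ℝ, ℝ) ∞ f) (x : Sph n)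
    (v w : TSph x) :
    ⟪radiiOp f x v, w⟫ = pd (v : Amb n) (pd (w : Amb n) (homExt f)) x := by
  have hx := x.coe_ne_zero
  have hR := radialExt_smooth hf
  -- The tangential gradient is the full gradient minus its radial part; differentiating the radial
  -- part in a tangential direction and pairing with a tangent vector gives `f x` times the metric.
  have h : radialExt (sphGrad f) =ᶠ[𝓝 (x : Amb n)]
      fun y => gradient (homExt f) y - (radialExt f y * ‖y‖⁻¹) • y := by
    filter_upwards [isOpen_compl_singleton.mem_nhds hx] with y hy
    have hy : y ≠ 0 := hy
    rw [← radialExt_gaussParam hf hy, radialExt_eq _ hy, radialExt_eq _ hy, radialExt_eq _ hy,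
      gaussParam, coe_toSph hy, smul_smul]
    abel
  have hA : DifferentiableAt ℝ (fun y : Amb n => radialExt f y * ‖y‖⁻¹) x :=
    (differentiableAt_of_smooth hR hx).mul
      ((differentiableAt_of_smooth norm_smooth hx).inv (by rw [x.norm_coe]; norm_num))
  have h1 : ⟪fderiv ℝ (radialExt (sphGrad f)) (x : Amb n) (v : Amb n), (w : Amb n)⟫ =
      pd (v : Amb n) (pd (w : Amb n) (homExt f)) x - f x * ⟪(v : Amb n), (w : Amb n)⟫ := by
    rw [h.fderiv_eq, fderiv_fun_sub (gradient_differentiableAt (homExt_smooth hf) hx)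
      (hA.fun_smul differentiableAt_fun_id), fderiv_fun_smul hA differentiableAt_fun_id]
    simp only [_root_.sub_apply, inner_sub_left, inner_fderiv_gradient (homExt_smooth hf) hx]
    congr 1
    simp [inner_add_left, inner_smul_left, inner_coe_tangent, radialExt_eq f hx, toSph_coe,
      x.norm_coe]
  have h2 : ⟪radiiOp f x v, w⟫ =
      ⟪fderiv ℝ (radialExt (sphGrad f)) (x : Amb n) (v : Amb n), (w : Amb n)⟫ +
        f x * ⟪(v : Amb n), (w : Amb n)⟫ := by
    rw [radiiOp, LinearMap.add_apply, inner_add_left]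
    congr 1
    · rw [sphHess, LinearMap.comp_apply]
      exact Submodule.inner_orthogonalProjectionOnto_eq_of_mem_right w _
    · simp [inner_smul_left]
  rw [h2, h1]
  ring

end Extension

/-! ### Eigenframes of the Hessian and principal radii -/

section Frames

variable {n : ℕ}

/-- The matrix of second derivatives of `F` at `y` in an orthonormal basis. -/
noncomputable def hessMat (e : OrthonormalBasis (Fin (n + 1)) ℝ (Amb n)) (F : Amb n → ℝ)
    (y : Amb n) : Matrix (Fin (n + 1)) (Fin (n + 1)) ℝ :=
  Matrix.of fun i j => pd (e i) (pd (e j) F) y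

/-- The `k`-th elementary symmetric function of the eigenvalues of the Hessian matrix. -/
noncomputable def sig (k : ℕ) (F : Amb n → ℝ) (y : Amb n) : ℝ :=
  minorSum k (hessMat (EuclideanSpace.basisFun (Fin (n + 1)) ℝ) F y)

theorem hessMat_eq_toMatrix {F : Amb n → ℝ} (hF : ContDiffOn ℝ ∞ F {0}ᶜ) {y : Amb n} (hy : y ≠ 0)
    (e : OrthonormalBasis (Fin (n + 1)) ℝ (Amb n)) :
    hessMat e F y =
      LinearMap.toMatrix e.toBasis e.toBasis (fderiv ℝ (gradient F) y).toLinearMap := by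
  ext i j
  rw [LinearMap.toMatrix_apply, OrthonormalBasis.coe_toBasis_repr_apply,
    OrthonormalBasis.repr_apply_apply, real_inner_comm]
  rw [OrthonormalBasis.coe_toBasis]
  exact (pd_comm hF (e i) (e j) hy).trans (inner_fderiv_gradient hF hy _ _).symm

theorem sig_eq_minorSum {F : Amb n → ℝ} (hF : ContDiffOn ℝ ∞ F {0}ᶜ) {y : Amb n} (hy : y ≠ 0)
    (e : OrthonormalBasis (Fin (n + 1)) ℝ (Amb n)) (k : ℕ) :
    sig k F y = minorSum k (hessMat e F y) := by
  rw [sig, hessMat_eq_toMatrix hF hy, hessMat_eq_toMatrix hF hy]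
  exact minorSum_toMatrix_eq _ _ _ k

theorem sig_smooth {F : Amb n → ℝ} (hF : ContDiffOn ℝ ∞ F {0}ᶜ) (k : ℕ) :
    ContDiffOn ℝ ∞ (sig k F) {0}ᶜ :=
  contDiffOn_minorSum k fun _ _ => pd_smooth (pd_smooth hF _) _

theorem pd_self_pd {F : Amb n → ℝ} (hF : ContDiffOn ℝ ∞ F {0}ᶜ) (hom : PosHom 1 F) {x : Amb n}
    (hx : x ≠ 0) (w : Amb n) : pd x (pd w F) x = 0 := by
  have := (hom.pd hF w).euler (pd_smooth hF w) hx
  simpa using this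

/-- The Hessian is symmetric, kills `x` by homogeneity and is positive on the orthogonal complement
of `x`, so its kernel is the line of `x`. A spectral basis therefore contains a multiple of `x`,
which only has to be replaced by `x` itself. -/
theorem exists_eigenframe {F : Amb n → ℝ} (hF : ContDiffOn ℝ ∞ F {0}ᶜ) (hom : PosHom 1 F)
    (x : Sph n) (hconv : ∀ v, ⟪(x : Amb n), v⟫ = 0 → v ≠ 0 → 0 < pd v (pd v F) x) :
    ∃ (e : OrthonormalBasis (Fin (n + 1)) ℝ (Amb n)) (l : Fin (n + 1) → ℝ) (o : Fin (n + 1)),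
      e o = x ∧ l o = 0 ∧ (∀ i, i ≠ o → 0 < l i) ∧ hessMat e F x = Matrix.diagonal l := by
  have hx := x.coe_ne_zero
  set T : Amb n →ₗ[ℝ] Amb n := (fderiv ℝ (gradient F) (x : Amb n)).toLinearMap with hTdef
  have hT : ∀ v w, ⟪T v, w⟫ = pd v (pd w F) x := inner_fderiv_gradient hF hx
  have hsym : T.IsSymmetric := by
    intro v w
    rw [hT, real_inner_comm, hT]
    exact pd_comm hF _ _ hx
  have hTx : T x = 0 := by
    refine ext_inner_right ℝ fun w => ?_
    rw [hT, inner_zero_left]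
    exact pd_self_pd hF hom hx w
  have hfr : Module.finrank ℝ (Amb n) = n + 1 := finrank_euclideanSpace_fin
  set b := hsym.eigenvectorBasis hfr with hb
  set l := hsym.eigenvalues hfr with hl
  have hTb : ∀ i, T (b i) = l i • b i := fun i => hsym.apply_eigenvectorBasis hfr i
  obtain ⟨o, ho⟩ : ∃ o, ⟪b o, (x : Amb n)⟫ ≠ 0 := by
    by_contra! hcon
    apply hx
    rw [← b.sum_repr' (x : Amb n)]
    exact Finset.sum_eq_zero fun i _ => by rw [hcon i, zero_smul]
  have hlo : l o = 0 := by
    have h1 : ⟪T (b o), (x : Amb n)⟫ = 0 := by rw [hsym, hTx, inner_zero_right]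
    rw [hTb, inner_smul_left] at h1
    simpa [ho] using h1
  -- Otherwise the tangential part of `b o` would be a nonzero tangent vector in the kernel of `T`.
  have hbo : b o = ⟪(x : Amb n), b o⟫ • (x : Amb n) := by
    by_contra hne
    have h1 : ⟪(x : Amb n), b o - ⟪(x : Amb n), b o⟫ • (x : Amb n)⟫ = 0 := by
      rw [inner_sub_right, inner_smul_right, real_inner_self_eq_norm_sq, x.norm_coe]
      ring
    have h2 := hconv _ h1 (sub_ne_zero.mpr hne)
    rw [← hT, map_sub, map_smul, hTx, hTb, hlo, zero_smul, smul_zero, sub_zero,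
      inner_zero_left] at h2
    exact lt_irrefl _ h2
  have hc : ⟪(x : Amb n), b o⟫ ≠ 0 := by rwa [real_inner_comm]
  have horth : ∀ i, i ≠ o → ⟪(x : Amb n), b i⟫ = 0 := by
    intro i hi
    have h1 : ⟪b o, b i⟫ = 0 := b.orthonormal.2 hi.symm
    rw [hbo, inner_smul_left] at h1
    simpa [hc] using h1
  have hpos : ∀ i, i ≠ o → 0 < l i := by
    intro i hi
    have h1 := hconv (b i) (horth i hi) (b.orthonormal.ne_zero i)
    rw [← hT, hTb, inner_smul_left, real_inner_self_eq_norm_sq, b.orthonormal.1 i] at h1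
    simpa using h1
  have hon : Orthonormal ℝ (Function.update b o (x : Amb n)) := by
    constructor
    · intro i
      by_cases hi : i = o
      · subst hi; simp [x.norm_coe]
      · simp [hi]
    · intro i j hij
      by_cases hi : i = o
      · subst hi
        simp [hij.symm, horth j hij.symm]
      · by_cases hj : j = o
        · subst hj
          simp [hi, real_inner_comm, horth i hi]
        · simp [hi, hj, b.orthonormal.2 hij]
  set B := basisOfOrthonormalOfCardEqFinrank hon (by simp) with hB
  have hBc : ⇑B = Function.update b o (x : Amb n) := coe_basisOfOrthonormalOfCardEqFinrank hon _
  set e := B.toOrthonormalBasis (by rw [hBc]; exact hon) with he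
  have hec : ∀ i, e i = Function.update b o (x : Amb n) i := by
    intro i
    rw [he, Module.Basis.coe_toOrthonormalBasis, hBc]
  refine ⟨e, l, o, by rw [hec]; simp, hlo, hpos, ?_⟩
  have hTe : ∀ i, T (e i) = l i • e i := by
    intro i
    rw [hec]
    by_cases hi : i = o
    · subst hi
      simp [hTx, hlo]
    · simp [hi, hTb]
  ext i j
  change pd (e i) (pd (e j) F) x = _
  rw [← hT, hTe, inner_smul_left, Matrix.diagonal_apply]
  by_cases hij : i = j
  · subst hij
    simp
  · simp [hij, e.orthonormal.2 hij]

theorem tangent_of_frame {e : OrthonormalBasis (Fin (n + 1)) ℝ (Amb n)} {x : Sph n}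
    {o i : Fin (n + 1)} (ho : e o = x) (hi : i ≠ o) : ⟪(x : Amb n), e i⟫ = 0 := by
  rw [← ho]
  exact e.orthonormal.2 hi.symm

/-- The family of principal radii in an eigenframe, as a multiset. -/
theorem principalRadii_eq {f : Sph n → ℝ} (hf : ContMDiff (𝓡 n) 𝓘(ℝ, ℝ) ∞ f) (x : Sph n)
    {e : OrthonormalBasis (Fin (n + 1)) ℝ (Amb n)} {l : Fin (n + 1) → ℝ} {o : Fin (n + 1)}
    (ho : e o = x) (he : hessMat e (homExt f) x = Matrix.diagonal l) :
    principalRadii f x = (univ.erase o).val.map l := by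
  have hent : ∀ i j, pd (e i) (pd (e j) (homExt f)) x = Matrix.diagonal l i j := fun i j => by
    rw [← he]; rfl
  let v : {i // i ≠ o} → TSph x := fun i => ⟨e i,
    Submodule.mem_orthogonal_singleton_iff_inner_right.mpr (tangent_of_frame ho i.2)⟩
  have hv : Orthonormal ℝ v := by
    constructor
    · intro i
      exact e.orthonormal.1 i
    · intro i j hij
      exact e.orthonormal.2 fun h => hij (Subtype.ext h)
  have hcard : Fintype.card {i // i ≠ o} = Module.finrank ℝ (TSph x) := by
    have h1 : Module.finrank ℝ (Amb n) = n + 1 := finrank_euclideanSpace_fin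
    have : Fact (Module.finrank ℝ (Amb n) = n + 1) := ⟨h1⟩
    rw [Submodule.finrank_orthogonal_span_singleton (n := n) x.coe_ne_zero]
    simp
  let B : Module.Basis {i // i ≠ o} ℝ (TSph x) := Module.Basis.mk hv.linearIndependent
    (hv.linearIndependent.span_eq_top_of_card_eq_finrank' hcard).ge
  have hBv : ∀ i, B i = v i := fun i => Module.Basis.mk_apply _ _ i
  have hF := homExt_smooth hf
  have hT : ∀ i w, pd (e i) (pd w (homExt f)) x = l i * ⟪e i, w⟫ := by
    intro i w
    have h1 : fderiv ℝ (gradient (homExt f)) (x : Amb n) (e i) = l i • e i := by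
      refine InnerProductSpace.ext_inner_right_basis e.toBasis fun j => ?_
      rw [OrthonormalBasis.coe_toBasis, inner_fderiv_gradient hF x.coe_ne_zero, hent,
        inner_smul_left, Matrix.diagonal_apply]
      by_cases hij : i = j
      · subst hij
        simp
      · simp [hij, e.orthonormal.2 hij]
    rw [← inner_fderiv_gradient hF x.coe_ne_zero, h1, inner_smul_left]
    rfl
  have hrad : ∀ i, radiiOp f x (v i) = l i • v i := by
    intro i
    refine ext_inner_right ℝ fun w => ?_
    rw [inner_radiiOp hf, inner_smul_left]
    exact hT i w
  have hM : LinearMap.toMatrix B B (radiiOp f x) = Matrix.diagonal fun i : {i // i ≠ o} => l i := by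
    ext i j
    rw [LinearMap.toMatrix_apply, hBv, hrad, ← hBv, map_smul, Module.Basis.repr_self,
      Matrix.diagonal_apply]
    by_cases hij : i = j
    · subst hij
      simp
    · simp [hij]
  rw [principalRadii, ← LinearMap.charpoly_toMatrix _ B, hM, Matrix.charpoly_diagonal,
    Polynomial.roots_prod _ _ (by
      rw [Finset.prod_ne_zero_iff]
      exact fun i _ => Polynomial.X_sub_C_ne_zero _)]
  simp only [Polynomial.roots_X_sub_C, Multiset.bind_singleton]
  have hu : (univ.erase o : Finset (Fin (n + 1))) =
      (univ : Finset {i // i ≠ o}).map (Function.Embedding.subtype _) := by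
    ext i
    simp
  rw [hu, Finset.map_val, Multiset.map_map]
  rfl

/-- The full Hessian has one eigenvalue more than there are principal radii, but it is zero, so
every product involving it vanishes. -/
theorem sigmaK_eq_esymmFn {f : Sph n → ℝ} (hf : ContMDiff (𝓡 n) 𝓘(ℝ, ℝ) ∞ f) (x : Sph n)
    {e : OrthonormalBasis (Fin (n + 1)) ℝ (Amb n)} {l : Fin (n + 1) → ℝ} {o : Fin (n + 1)}
    (ho : e o = x) (hlo : l o = 0) (he : hessMat e (homExt f) x = Matrix.diagonal l) (k : ℕ) :
    sigmaK k f x = esymmFn k l / n.choose k := by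
  rw [sigmaK, principalRadii_eq hf x ho he, Finset.esymm_map_val, esymmFn]
  congr 1
  refine Finset.sum_subset (Finset.powersetCard_mono (Finset.erase_subset _ _)) fun I hI hI2 => ?_
  refine Finset.prod_eq_zero (i := o) ?_ hlo
  by_contra ho2
  apply hI2
  rw [Finset.mem_powersetCard] at hI ⊢
  exact ⟨fun i hi => mem_erase.mpr ⟨fun h => ho2 (h ▸ hi), mem_univ i⟩, hI.2⟩

theorem homExt_convex {f : Sph n → ℝ} (hf : ContMDiff (𝓡 n) 𝓘(ℝ, ℝ) ∞ f)
    (hconv : SphStrictlyConvex f) (x : Sph n) (v : Amb n) (hv : ⟪(x : Amb n), v⟫ = 0)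
    (hv0 : v ≠ 0) : 0 < pd v (pd v (homExt f)) x := by
  have h := hconv x ⟨v, Submodule.mem_orthogonal_singleton_iff_inner_right.mpr hv⟩
    (fun h => hv0 (congrArg Subtype.val h))
  rwa [inner_radiiOp hf] at h

theorem sigmaK_eq_sig {f : Sph n → ℝ} (hf : ContMDiff (𝓡 n) 𝓘(ℝ, ℝ) ∞ f)
    (hconv : SphStrictlyConvex f) (x : Sph n) (k : ℕ) :
    sigmaK k f x = sig k (homExt f) x / n.choose k := by
  obtain ⟨e, l, o, ho, hlo, -, he⟩ := exists_eigenframe (homExt_smooth hf) (homExt_posHom f) x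
    (homExt_convex hf hconv x)
  rw [sigmaK_eq_esymmFn hf x ho hlo he, sig_eq_minorSum (homExt_smooth hf) x.coe_ne_zero e, he,
    minorSum_diagonal]

end Frames

/-! ### Homogeneity of the speed, Euler identities, and first and second order conditions at extrema
-/

section Speed

theorem minorSum_smul {ι : Type*} [Fintype ι] [DecidableEq ι] (k : ℕ) (a : ℝ) (M : Matrix ι ι ℝ) :
    minorSum k (a • M) = a ^ k * minorSum k M := by
  rw [minorSum, minorSum, Finset.mul_sum]
  refine Finset.sum_congr rfl fun I hI => ?_
  have h : keepRows I (a • M) =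
      Matrix.diagonal (fun i => if i ∈ I then a else 1) * keepRows I M := by
    ext i j
    rw [Matrix.diagonal_mul]
    by_cases hi : i ∈ I <;> simp [keepRows, hi]
  rw [h, Matrix.det_mul, Matrix.det_diagonal, Finset.prod_ite_mem, Finset.univ_inter,
    Finset.prod_const, (Finset.mem_powersetCard.mp hI).2]

variable {n : ℕ}

theorem sig_smul {F : Amb n → ℝ} (hF : ContDiffOn ℝ ∞ F {0}ᶜ) (hom : PosHom 1 F) (k : ℕ) {c : ℝ}
    (hc : 0 < c) {y : Amb n} (hy : y ≠ 0) : sig k F (c • y) = (c⁻¹) ^ k * sig k F y := by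
  rw [sig, sig, ← minorSum_smul]
  congr 1
  ext i j
  have h := ((hom.pd hF (EuclideanSpace.basisFun (Fin (n + 1)) ℝ j)).pd (pd_smooth hF _)
    (EuclideanSpace.basisFun (Fin (n + 1)) ℝ i)) c hc y hy
  simpa [hessMat] using h

/-- The function `c U ^ q F ^ r σ_k(D² F)`. -/
noncomputable def speed (c q r : ℝ) (k : ℕ) (U F : Amb n → ℝ) (y : Amb n) : ℝ :=
  c * (U y ^ q * F y ^ r) * sig k F y

theorem speed_smooth {U F : Amb n → ℝ} (hU : ContDiffOn ℝ ∞ U {0}ᶜ) (hF : ContDiffOn ℝ ∞ F {0}ᶜ)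
    (hU0 : ∀ y, y ≠ 0 → 0 < U y) (hF0 : ∀ y, y ≠ 0 → 0 < F y) (c q r : ℝ) (k : ℕ) :
    ContDiffOn ℝ ∞ (speed c q r k U F) {0}ᶜ :=
  (contDiffOn_const.mul ((hU.rpow_const_of_ne fun y hy => (hU0 y hy).ne').mul
    (hF.rpow_const_of_ne fun y hy => (hF0 y hy).ne'))).mul (sig_smooth hF k)

theorem mul_speed {U F : Amb n → ℝ} {y : Amb n} (hF0 : 0 < F y) (c q r : ℝ) (k : ℕ) :
    F y * speed c q r k U F y = speed c q (r + 1) k U F y := by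
  rw [speed, speed, Real.rpow_add hF0, Real.rpow_one]
  ring

/-- Second derivatives of `F` have degree `-1`, so `σ_k` has degree `-k`, which the factors `U ^ q`
and `F ^ r` compensate. -/
theorem speed_posHom {U F : Amb n → ℝ} (hF : ContDiffOn ℝ ∞ F {0}ᶜ)
    (hU0 : ∀ y, y ≠ 0 → 0 < U y) (hF0 : ∀ y, y ≠ 0 → 0 < F y) (homU : PosHom 1 U)
    (homF : PosHom 1 F) (c : ℝ) {q r : ℝ} {k : ℕ} (hdeg : q + r = k) :
    PosHom 0 (speed c q r k U F) := by
  intro a ha y hy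
  rw [speed, speed, sig_smul hF homF k ha hy, homU a ha y hy, homF a ha y hy, zpow_one,
    Real.mul_rpow ha.le (hU0 y hy).le, Real.mul_rpow ha.le (hF0 y hy).le, zpow_zero, one_mul]
  have h : a ^ q * a ^ r * (a⁻¹) ^ k = 1 := by
    rw [← Real.rpow_add ha, hdeg, Real.rpow_natCast, inv_pow]
    exact mul_inv_cancel₀ (pow_ne_zero _ ha.ne')
  linear_combination (c * U y ^ q * F y ^ r * sig k F y) * h

theorem pd_pd_add {F : Amb n → ℝ} (hF : ContDiffOn ℝ ∞ F {0}ᶜ) {y : Amb n} (hy : y ≠ 0)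
    (a b : Amb n) (t : ℝ) : pd (a + t • b) (pd (a + t • b) F) y =
      pd a (pd a F) y + 2 * (t * pd a (pd b F) y) + t ^ 2 * pd b (pd b F) y := by
  simp only [← inner_fderiv_gradient hF hy, map_add, map_smul, inner_add_left, inner_add_right,
    inner_smul_left, inner_smul_right, RCLike.conj_to_real]
  rw [show ⟪fderiv ℝ (gradient F) y b, a⟫ = ⟪fderiv ℝ (gradient F) y a, b⟫ by
    rw [inner_fderiv_gradient hF hy, inner_fderiv_gradient hF hy, pd_comm hF _ _ hy]]
  ring

theorem pd3_rotate {F : Amb n → ℝ} (hF : ContDiffOn ℝ ∞ F {0}ᶜ) {y : Amb n} (hy : y ≠ 0)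
    (a b c : Amb n) : pd a (pd b (pd c F)) y = pd b (pd c (pd a F)) y := by
  rw [pd_comm (pd_smooth hF c) a b hy]
  exact pd_congr (fun z hz => pd_comm hF a c hz) b hy

theorem pd4_swap {F : Amb n → ℝ} (hF : ContDiffOn ℝ ∞ F {0}ᶜ) {y : Amb n} (hy : y ≠ 0)
    (a b : Amb n) : pd a (pd a (pd b (pd b F))) y = pd b (pd b (pd a (pd a F))) y := by
  have h1 : ∀ z, z ≠ 0 → pd a (pd b (pd b F)) z = pd b (pd b (pd a F)) z := fun z hz =>
    pd3_rotate hF hz a b b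
  rw [pd_congr h1 a hy, pd_comm (pd_smooth (pd_smooth hF a) b) a b hy]
  exact pd_congr (fun z hz => pd_comm (pd_smooth hF a) a b hz) b hy

/-- This and the two following identities are Euler's relation for derivatives of `F`, with `x` kept
as a constant direction. They evaluate the radial entries in the derivatives of the Hessian matrix,
where the eigenvalue is degenerate. -/
theorem pd_self_self_pd {F : Amb n → ℝ} (hF : ContDiffOn ℝ ∞ F {0}ᶜ) (hom : PosHom 1 F) {x : Amb n}
    (hx : x ≠ 0) (w : Amb n) : pd x (pd x (pd w F)) x = 0 := by
  have h := ((hom.pd hF w).pd (pd_smooth hF w) x).euler (pd_smooth (pd_smooth hF w) x) hx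
  rw [h, pd_self_pd hF hom hx, mul_zero]

theorem pd_self_pd_pd {F : Amb n → ℝ} (hF : ContDiffOn ℝ ∞ F {0}ᶜ) (hom : PosHom 1 F) {x : Amb n}
    (hx : x ≠ 0) (v w : Amb n) : pd x (pd v (pd w F)) x = -pd v (pd w F) x := by
  have h := ((hom.pd hF w).pd (pd_smooth hF w) v).euler (pd_smooth (pd_smooth hF w) v) hx
  rw [h]
  norm_num

theorem pd_self_self_pd_pd {F : Amb n → ℝ} (hF : ContDiffOn ℝ ∞ F {0}ᶜ) (hom : PosHom 1 F)
    {x : Amb n} (hx : x ≠ 0) (v w : Amb n) :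
    pd x (pd x (pd v (pd w F))) x = 2 * pd v (pd w F) x := by
  have h := (((hom.pd hF w).pd (pd_smooth hF w) v).pd (pd_smooth (pd_smooth hF w) v) x).euler
    (pd_smooth (pd_smooth (pd_smooth hF w) v) x) hx
  rw [h, pd_self_pd_pd hF hom hx]
  norm_num

theorem add_smul_ne_zero {x : Sph n} {v : Amb n} (hv : ⟪(x : Amb n), v⟫ = 0) (t : ℝ) :
    (x : Amb n) + t • v ≠ 0 := by
  intro h
  have h1 := congrArg (fun z => ⟪(x : Amb n), z⟫) h
  simp only [inner_add_right, inner_smul_right, hv, inner_zero_right, mul_zero, add_zero,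
    real_inner_self_eq_norm_sq, x.norm_coe] at h1
  norm_num at h1

theorem norm_add_smul_sq {x : Sph n} {v : Amb n} (hv : ⟪(x : Amb n), v⟫ = 0) (hv1 : ‖v‖ = 1)
    (t : ℝ) : ‖(x : Amb n) + t • v‖ ^ 2 = 1 + t ^ 2 := by
  rw [norm_add_sq_real, inner_smul_right, hv, x.norm_coe, norm_smul, hv1]
  simp

/-- An orthonormal frame at `x` with `e o = x`, diagonalizing the Hessian of `F`, with positive
eigenvalues in the tangential directions. -/
structure IsEigenframe (F : Amb n → ℝ) (x : Sph n)
    (e : OrthonormalBasis (Fin (n + 1)) ℝ (Amb n)) (l : Fin (n + 1) → ℝ) (o : Fin (n + 1)) :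
    Prop where
  base : e o = x
  zero : l o = 0
  pos : ∀ i, i ≠ o → 0 < l i
  diag : hessMat e F x = Matrix.diagonal l

namespace IsEigenframe

variable {F : Amb n → ℝ} {x : Sph n} {e : OrthonormalBasis (Fin (n + 1)) ℝ (Amb n)}
  {l : Fin (n + 1) → ℝ} {o : Fin (n + 1)}

theorem entry (h : IsEigenframe F x e l o) (i j : Fin (n + 1)) :
    pd (e i) (pd (e j) F) x = Matrix.diagonal l i j := by
  rw [← h.diag]; rfl

theorem entry_self (h : IsEigenframe F x e l o) (i : Fin (n + 1)) :
    pd (e i) (pd (e i) F) x = l i := by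
  rw [h.entry, Matrix.diagonal_apply_eq]

theorem entry_ne (h : IsEigenframe F x e l o) {i j : Fin (n + 1)} (hij : i ≠ j) :
    pd (e i) (pd (e j) F) x = 0 := by
  rw [h.entry, Matrix.diagonal_apply_ne _ hij]

theorem nonneg (h : IsEigenframe F x e l o) (i : Fin (n + 1)) : 0 ≤ l i := by
  by_cases hi : i = o
  · rw [hi, h.zero]
  · exact (h.pos i hi).le

theorem tangent (h : IsEigenframe F x e l o) {i : Fin (n + 1)} (hi : i ≠ o) :
    ⟪(x : Amb n), e i⟫ = 0 := tangent_of_frame h.base hi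

theorem sig_eq (h : IsEigenframe F x e l o) (hF : ContDiffOn ℝ ∞ F {0}ᶜ) (k : ℕ) :
    sig k F x = esymmFn k l := by
  rw [sig_eq_minorSum hF x.coe_ne_zero e, h.diag, minorSum_diagonal]

theorem sig_jet2 (h : IsEigenframe F x e l o) (hF : ContDiffOn ℝ ∞ F {0}ᶜ) (k : ℕ) (v : Amb n) :
    Jet2 (fun t : ℝ => sig k F ((x : Amb n) + t • v)) (esymmFn k l)
      (∑ i, esymmD k l i * pd v (pd (e i) (pd (e i) F)) x)
      (∑ i, esymmD k l i * pd v (pd v (pd (e i) (pd (e i) F))) x +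
        minorHess k l (Matrix.of fun i j => pd v (pd (e i) (pd (e j) F)) x)) := by
  have h1 : ∀ i j, Jet2 (fun t : ℝ => hessMat e F ((x : Amb n) + t • v) i j)
      (Matrix.diagonal l i j) ((Matrix.of fun i j => pd v (pd (e i) (pd (e j) F)) x) i j)
      ((Matrix.of fun i j => pd v (pd v (pd (e i) (pd (e j) F))) x) i j) := by
    intro i j
    rw [← h.entry i j]
    exact jet2_line (pd_smooth (pd_smooth hF (e j)) (e i)) x.coe_ne_zero v
  refine (minorSum_jet2 k h1).congr_of_eventuallyEq ?_
  have hc : ContinuousAt (fun t : ℝ => (x : Amb n) + t • v) 0 := by fun_prop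
  have : ∀ᶠ t in 𝓝 (0 : ℝ), (x : Amb n) + t • v ≠ 0 :=
    hc.eventually (isOpen_compl_singleton.mem_nhds (by simpa using x.coe_ne_zero))
  filter_upwards [this] with t ht
  exact (sig_eq_minorSum hF ht e k).symm

end IsEigenframe

theorem exists_isEigenframe {F : Amb n → ℝ} (hF : ContDiffOn ℝ ∞ F {0}ᶜ) (hom : PosHom 1 F)
    (x : Sph n) (hconv : ∀ v, ⟪(x : Amb n), v⟫ = 0 → v ≠ 0 → 0 < pd v (pd v F) x) :
    ∃ (e : OrthonormalBasis (Fin (n + 1)) ℝ (Amb n)) (l : Fin (n + 1) → ℝ) (o : Fin (n + 1)),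
      IsEigenframe F x e l o := by
  obtain ⟨e, l, o, h1, h2, h3, h4⟩ := exists_eigenframe hF hom x hconv
  exact ⟨e, l, o, h1, h2, h3, h4⟩

/-- At a point of the sphere where a function is maximal among all points of the sphere, its
degree-zero extension satisfies the first and second order conditions. -/
theorem PosHom.max_conditions {P : Amb n → ℝ} (hP : ContDiffOn ℝ ∞ P {0}ᶜ) (hom : PosHom 0 P)
    {x : Sph n} (hmax : ∀ y : Sph n, P y ≤ P x) (v : Amb n) :
    _root_.pd v P x = 0 ∧ _root_.pd v (_root_.pd v P) x ≤ 0 := by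
  have h1 := ((Jet2.const (P x)).sub (jet2_line hP x.coe_ne_zero v)).congr (sub_self _) rfl rfl
  have hc : ContinuousAt (fun t : ℝ => (x : Amb n) + t • v) 0 := by fun_prop
  have h2 : ∀ᶠ t in 𝓝 (0 : ℝ), (x : Amb n) + t • v ≠ 0 :=
    hc.eventually (isOpen_compl_singleton.mem_nhds (by simpa using x.coe_ne_zero))
  obtain ⟨h3, h4⟩ := h1.of_nonneg (by
    filter_upwards [h2] with t ht
    have h5 := hom ‖(x : Amb n) + t • v‖⁻¹ (inv_pos.mpr (norm_pos_iff.mpr ht)) _ ht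
    rw [zpow_zero, one_mul, ← coe_toSph ht] at h5
    rw [← h5]
    exact sub_nonneg.mpr (hmax _))
  constructor <;> linarith

theorem PosHom.min_conditions {P : Amb n → ℝ} (hP : ContDiffOn ℝ ∞ P {0}ᶜ) (hom : PosHom 0 P)
    {x : Sph n} (hmin : ∀ y : Sph n, P x ≤ P y) (v : Amb n) :
    _root_.pd v P x = 0 ∧ 0 ≤ _root_.pd v (_root_.pd v P) x := by
  have h1 := ((jet2_line hP x.coe_ne_zero v).sub (Jet2.const (P x))).congr (sub_self _) rfl rfl
  have hc : ContinuousAt (fun t : ℝ => (x : Amb n) + t • v) 0 := by fun_prop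
  have h2 : ∀ᶠ t in 𝓝 (0 : ℝ), (x : Amb n) + t • v ≠ 0 :=
    hc.eventually (isOpen_compl_singleton.mem_nhds (by simpa using x.coe_ne_zero))
  obtain ⟨h3, h4⟩ := h1.of_nonneg (by
    filter_upwards [h2] with t ht
    have h5 := hom ‖(x : Amb n) + t • v‖⁻¹ (inv_pos.mpr (norm_pos_iff.mpr ht)) _ ht
    rw [zpow_zero, one_mul, ← coe_toSph ht] at h5
    rw [← h5]
    exact sub_nonneg.mpr (hmin _))
  constructor <;> linarith

/-- At a maximum point of a support function, the principal radii do not exceed its value. -/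
theorem IsEigenframe.le_of_max {F : Amb n → ℝ} {x : Sph n}
    {e : OrthonormalBasis (Fin (n + 1)) ℝ (Amb n)} {l : Fin (n + 1) → ℝ} {o : Fin (n + 1)}
    (h : IsEigenframe F x e l o) (hF : ContDiffOn ℝ ∞ F {0}ᶜ) (hom : PosHom 1 F)
    (hpos : ∀ y, y ≠ 0 → 0 < F y) (hmax : ∀ y : Sph n, F y ≤ F x) (i : Fin (n + 1)) :
    l i ≤ F x := by
  have hx := hpos x x.coe_ne_zero
  by_cases hi : i = o
  · rw [hi, h.zero]; exact hx.le
  have ht := h.tangent hi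
  have he : ‖e i‖ = 1 := e.orthonormal.1 i
  have j1 := jet2_line hF x.coe_ne_zero (e i)
  -- Homogeneity turns maximality on the sphere into `F y ≤ ‖y‖ F x`. On the tangent line `‖y‖²` is
  -- `1 + t²`, so the squared inequality avoids differentiating the norm.
  have j2 := (((Jet2.const 1).add (Jet2.id.mul Jet2.id)).const_mul (F x ^ 2)).sub (j1.mul j1)
  rw [h.entry_self i] at j2
  obtain ⟨h1, h2⟩ := (j2.congr (a' := 0) (by ring) rfl rfl).of_nonneg (.of_forall fun t => by
    have hy := add_smul_ne_zero ht t
    have h3 := hom ‖(x : Amb n) + t • e i‖⁻¹ (inv_pos.mpr (norm_pos_iff.mpr hy)) _ hy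
    rw [← coe_toSph hy, zpow_one] at h3
    have h4 := hmax (toSph ((x : Amb n) + t • e i))
    rw [h3, inv_mul_le_iff₀ (norm_pos_iff.mpr hy)] at h4
    have h5 := mul_self_le_mul_self (hpos _ hy).le h4
    have h6 := norm_add_smul_sq ht he t
    nlinarith)
  have h7 : pd (e i) F x = 0 := by
    have : F x * pd (e i) F x = 0 := by linarith
    exact (mul_eq_zero.mp this).resolve_left hx.ne'
  rw [h7] at h2
  nlinarith

end Speed

/-! ### The flow of homogeneous extensions and the evolution of `Ψ` -/

section Flow

variable {n : ℕ}

/-- The normalized flow for the homogeneous extensions of the support functions, `U` being the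
homogeneous extension of `φ ^ (1 / (p + k - 1))`. -/
structure HomFlow (k : ℕ) (p c : ℝ) (U : Amb n → ℝ) (I : Set ℝ) (H : ℝ → Amb n → ℝ)
    (η : ℝ → ℝ) : Prop where
  uniq : UniqueDiffOn ℝ I
  smoothU : ContDiffOn ℝ ∞ U {0}ᶜ
  homU : PosHom 1 U
  posU : ∀ y, y ≠ 0 → 0 < U y
  smooth : ContDiffOn ℝ ∞ (fun q : ℝ × Amb n => H q.1 q.2) (I ×ˢ {0}ᶜ)
  hom : ∀ τ ∈ I, PosHom 1 (H τ)
  pos : ∀ τ ∈ I, ∀ y, y ≠ 0 → 0 < H τ y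
  conv : ∀ τ ∈ I, ∀ x : Sph n, ∀ v, ⟪(x : Amb n), v⟫ = 0 → v ≠ 0 → 0 < pd v (pd v (H τ)) x
  pde : ∀ τ ∈ interior I, ∀ y, y ≠ 0 → HasDerivAt (fun s => H s y)
    (H τ y * (speed c (p + k - 1) (1 - p) k U (H τ) y - η τ)) τ

/-- The function `φ h ^ (1 - p) σ_k`, extended to be constant along rays. -/
noncomputable def psi (k : ℕ) (p c : ℝ) (U F : Amb n → ℝ) : Amb n → ℝ :=
  speed c (p + k - 1) (1 - p) k U F

namespace HomFlow

variable {k : ℕ} {p c : ℝ} {U : Amb n → ℝ} {I : Set ℝ} {H : ℝ → Amb n → ℝ} {η : ℝ → ℝ}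

theorem slice (h : HomFlow k p c U I H η) {τ : ℝ} (hτ : τ ∈ I) : ContDiffOn ℝ ∞ (H τ) {0}ᶜ :=
  smooth_slice h.smooth hτ

theorem psi_smooth (h : HomFlow k p c U I H η) {τ : ℝ} (hτ : τ ∈ I) :
    ContDiffOn ℝ ∞ (psi k p c U (H τ)) {0}ᶜ :=
  speed_smooth h.smoothU (h.slice hτ) h.posU (h.pos τ hτ) _ _ _ _

theorem psi_posHom (h : HomFlow k p c U I H η) {τ : ℝ} (hτ : τ ∈ I) :
    PosHom 0 (psi k p c U (H τ)) :=
  speed_posHom (h.slice hτ) h.posU (h.pos τ hτ) h.homU (h.hom τ hτ) c (by ring)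

theorem exists_frame (h : HomFlow k p c U I H η) {τ : ℝ} (hτ : τ ∈ I) (x : Sph n) :
    ∃ (e : OrthonormalBasis (Fin (n + 1)) ℝ (Amb n)) (l : Fin (n + 1) → ℝ) (o : Fin (n + 1)),
      IsEigenframe (H τ) x e l o :=
  exists_isEigenframe (h.slice hτ) (h.hom τ hτ) x (h.conv τ hτ x)

theorem rhs_smooth (h : HomFlow k p c U I H η) {τ : ℝ} (hτ : τ ∈ I) :
    ContDiffOn ℝ ∞ (fun y => H τ y * (psi k p c U (H τ) y - η τ)) {0}ᶜ :=
  (h.slice hτ).mul ((h.psi_smooth hτ).sub contDiffOn_const)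

theorem pd_hasDerivAt (h : HomFlow k p c U I H η) {τ : ℝ} (hτ : τ ∈ interior I) (v : Amb n)
    {y : Amb n} (hy : y ≠ 0) : HasDerivAt (fun s => pd v (H s) y)
      (pd v (fun y => H τ y * (psi k p c U (H τ) y - η τ)) y) τ :=
  pd_hasDerivAt_time h.smooth (G := fun τ y => H τ y * (psi k p c U (H τ) y - η τ)) h.pde hτ v hy

theorem pd_pd_hasDerivAt (h : HomFlow k p c U I H η) {τ : ℝ} (hτ : τ ∈ interior I) (v w : Amb n)
    {y : Amb n} (hy : y ≠ 0) : HasDerivAt (fun s => pd v (pd w (H s)) y)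
      (pd v (pd w (fun y => H τ y * (psi k p c U (H τ) y - η τ))) y) τ :=
  pd_hasDerivAt_time (pd_smooth_joint h.uniq h.smooth w)
    (G := fun τ => pd w (fun y => H τ y * (psi k p c U (H τ) y - η τ)))
    (fun _ hs _ hz => h.pd_hasDerivAt hs w hz) hτ v hy

/-- The Hessian of `H (Ψ - η)` is `(Ψ - η) D²H` plus terms containing derivatives of `Ψ`. By Euler's
relation for `σ_k` the first part contributes the factor `k`, the power `H ^ (1 - p)` contributes `1
- p`, and the rest is a linearized operator that has a sign at extrema of `Ψ`. -/
theorem psi_hasDerivAt (h : HomFlow k p c U I H η) {τ : ℝ} (hτ : τ ∈ interior I) {x : Sph n}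
    {e : OrthonormalBasis (Fin (n + 1)) ℝ (Amb n)} {l : Fin (n + 1) → ℝ} {o : Fin (n + 1)}
    (he : IsEigenframe (H τ) x e l o) :
    HasDerivAt (fun s => psi k p c U (H s) x)
      ((1 - p + k) * psi k p c U (H τ) x * (psi k p c U (H τ) x - η τ) +
        c * (U x ^ (p + k - 1) * H τ x ^ (1 - p)) * ∑ i, esymmD k l i *
          (2 * pd (e i) (H τ) x * pd (e i) (psi k p c U (H τ)) x +
            H τ x * pd (e i) (pd (e i) (psi k p c U (H τ))) x)) τ := by
  have hτI := interior_subset hτ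
  have hx := x.coe_ne_zero
  have hF := h.slice hτI
  have hpos := h.pos τ hτI x hx
  set Ψ := psi k p c U (H τ) with hΨ
  have hG2 : ∀ i, pd (e i) (pd (e i) (fun y => H τ y * (Ψ y - η τ))) x =
      l i * (Ψ x - η τ) + (2 * pd (e i) (H τ) x * pd (e i) Ψ x + H τ x * pd (e i) (pd (e i) Ψ) x)
      := by
    intro i
    have j1 := jet2_line hF hx (e i)
    have j2 := (jet2_line (h.psi_smooth hτI) hx (e i)).sub (Jet2.const (η τ))
    have := ((jet2_line (h.rhs_smooth hτI) hx (e i)).unique (j1.mul j2)).2.2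
    rw [this, he.entry_self, ← hΨ]
    ring
  have hsig : HasDerivAt (fun s => sig k (H s) x)
      (∑ j, esymmD k l j * pd (e j) (pd (e j) (fun y => H τ y * (Ψ y - η τ))) x) τ := by
    have h1 := minorSum_hasDerivAt (M := fun s => hessMat e (H s) x)
      (M' := Matrix.of fun i j => pd (e i) (pd (e j) (fun y => H τ y * (Ψ y - η τ))) x) k
      (fun i j => h.pd_pd_hasDerivAt hτ (e i) (e j) hx) he.diag
    refine h1.congr_of_eventuallyEq ?_
    filter_upwards [isOpen_interior.mem_nhds hτ] with s hs
    exact sig_eq_minorSum (h.slice (interior_subset hs)) hx e k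
  have hr := (h.pde τ hτ x hx).rpow_const (p := 1 - p) (Or.inl hpos.ne')
  have hmain := ((hr.const_mul (U x ^ (p + k - 1))).const_mul c).mul hsig
  refine hmain.congr_deriv ?_
  simp only [hG2, mul_add, Finset.sum_add_distrib]
  have hs1 : ∑ i, esymmD k l i * (l i * (Ψ x - η τ)) = k * sig k (H τ) x * (Ψ x - η τ) := by
    rw [he.sig_eq hF, ← sum_esymmD_mul_self, Finset.sum_mul]
    exact Finset.sum_congr rfl fun i _ => by ring
  rw [hs1]
  have hr1 : H τ x ^ (1 - p - 1) * H τ x = H τ x ^ (1 - p) := by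
    rw [Real.rpow_sub_one hpos.ne', div_mul_cancel₀ _ hpos.ne']
  have hdef : Ψ x = c * (U x ^ (p + k - 1) * H τ x ^ (1 - p)) * sig k (H τ) x := rfl
  have hdef2 : speed c (p + k - 1) (1 - p) k U (H τ) x = Ψ x := rfl
  rw [hdef2]
  linear_combination (c * U x ^ (p + k - 1) * (1 - p) * (Ψ x - η τ) * sig k (H τ) x) * hr1 -
    ((1 - p + k) * (Ψ x - η τ)) * hdef

end HomFlow

/-! ### The gradient estimate -/

theorem norm_gradient_sq (e : OrthonormalBasis (Fin (n + 1)) ℝ (Amb n)) (F : Amb n → ℝ) (y : Amb n) :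
    ‖gradient F y‖ ^ 2 = ∑ j, pd (e j) F y ^ 2 := by
  rw [← e.sum_sq_norm_inner_left]
  exact Finset.sum_congr rfl fun j _ => by rw [inner_gradient_eq_pd, Real.norm_eq_abs, sq_abs]

theorem sum_pd_mul_pd_le (e : OrthonormalBasis (Fin (n + 1)) ℝ (Amb n)) (U F : Amb n → ℝ)
    (y : Amb n) : ∑ j, pd (e j) U y * pd (e j) F y ≤ ‖gradient U y‖ * ‖gradient F y‖ := by
  refine le_trans (le_of_eq ?_) (real_inner_le_norm (gradient U y) (gradient F y))
  rw [← e.sum_inner_mul_inner]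
  refine Finset.sum_congr rfl fun j _ => ?_
  rw [inner_gradient_eq_pd, real_inner_comm (gradient F y), inner_gradient_eq_pd]

theorem norm_gradient_smul {F : Amb n → ℝ} (hF : ContDiffOn ℝ ∞ F {0}ᶜ) (hom : PosHom 1 F) {a : ℝ}
    (ha : 0 < a) {y : Amb n} (hy : y ≠ 0) : gradient F (a • y) = gradient F y := by
  refine ext_inner_right ℝ fun w => ?_
  rw [inner_gradient_eq_pd, inner_gradient_eq_pd, hom.pd hF w a ha y hy]
  simp

/-- First and second order conditions at a point where `|∇F|² ≤ K F²` becomes an equality. -/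
theorem IsEigenframe.gradient_conditions {F : Amb n → ℝ} {x : Sph n}
    {e : OrthonormalBasis (Fin (n + 1)) ℝ (Amb n)} {l : Fin (n + 1) → ℝ} {o : Fin (n + 1)}
    (h : IsEigenframe F x e l o) (hF : ContDiffOn ℝ ∞ F {0}ᶜ) (hom : PosHom 1 F)
    {K : ℝ} (hle : ∀ y : Sph n, ‖gradient F y‖ ^ 2 ≤ K * F y ^ 2)
    (heq : ‖gradient F x‖ ^ 2 = K * F x ^ 2) {i : Fin (n + 1)} (hi : i ≠ o) :
    pd (e i) F x * (K * F x - l i) = 0 ∧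
      ∑ j, pd (e j) F x * pd (e i) (pd (e i) (pd (e j) F)) x ≤
        K * (pd (e i) F x ^ 2 + F x * l i) - l i ^ 2 - K * F x ^ 2 := by
  have hx := x.coe_ne_zero
  have ht := h.tangent hi
  have he : ‖e i‖ = 1 := e.orthonormal.1 i
  have jF := jet2_line hF hx (e i)
  have jg := Jet2.sum univ fun j _ => (jet2_line (pd_smooth hF (e j)) hx (e i)).mul
    (jet2_line (pd_smooth hF (e j)) hx (e i))
  -- The gradient has degree zero and `F²` degree two, so on the tangent line the bound reads `K F²
  -- - (1 + t²) |∇F|² ≥ 0`, with equality at `t = 0`.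
  have j := ((jF.mul jF).const_mul K).sub (((Jet2.const 1).add (Jet2.id.mul Jet2.id)).mul jg)
  have hsq : ∑ j, pd (e j) F x * pd (e j) F x = K * F x ^ 2 := by
    rw [← heq, norm_gradient_sq e]
    exact Finset.sum_congr rfl fun j _ => (sq _).symm
  have hb : ∑ j, (pd (e i) (pd (e j) F) x * pd (e j) F x + pd (e j) F x * pd (e i) (pd (e j) F) x)
      = 2 * (l i * pd (e i) F x) := by
    rw [Finset.sum_eq_single i]
    · rw [h.entry_self]; ring
    · intro j _ hj
      rw [h.entry_ne hj.symm]; ring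
    · simp
  have hc : ∑ j, (pd (e i) (pd (e i) (pd (e j) F)) x * pd (e j) F x +
      2 * pd (e i) (pd (e j) F) x * pd (e i) (pd (e j) F) x +
      pd (e j) F x * pd (e i) (pd (e i) (pd (e j) F)) x) =
      2 * ∑ j, pd (e j) F x * pd (e i) (pd (e i) (pd (e j) F)) x + 2 * l i ^ 2 := by
    have hc1 : ∑ j, 2 * pd (e i) (pd (e j) F) x * pd (e i) (pd (e j) F) x = 2 * l i ^ 2 := by
      rw [Finset.sum_eq_single i]
      · rw [h.entry_self]; ring
      · intro j _ hj
        rw [h.entry_ne hj.symm]; ring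
      · simp
    rw [← hc1, Finset.mul_sum, ← Finset.sum_add_distrib]
    exact Finset.sum_congr rfl fun j _ => by ring
  rw [hsq, hb, hc, h.entry_self] at j
  obtain ⟨h1, h2⟩ := (j.congr (a' := 0) (by ring) rfl rfl).of_nonneg (.of_forall fun t => by
    have hy := add_smul_ne_zero ht t
    have hn : 0 < ‖(x : Amb n) + t • e i‖⁻¹ := inv_pos.mpr (norm_pos_iff.mpr hy)
    have h3 := hom _ hn _ hy
    have h4 := hle (toSph ((x : Amb n) + t • e i))
    rw [coe_toSph hy, norm_gradient_smul hF hom hn hy, h3, zpow_one, mul_pow, inv_pow,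
      norm_add_smul_sq ht he] at h4
    have h6 : 0 < 1 + t ^ 2 := by positivity
    have h7 : (1 + t ^ 2) * ‖gradient F ((x : Amb n) + t • e i)‖ ^ 2 ≤
        K * F ((x : Amb n) + t • e i) ^ 2 := by
      calc _ ≤ (1 + t ^ 2) * (K * ((1 + t ^ 2)⁻¹ * F ((x : Amb n) + t • e i) ^ 2)) :=
            mul_le_mul_of_nonneg_left h4 h6.le
        _ = _ := by field_simp
    rw [norm_gradient_sq e] at h7
    have h8 : ∑ j, pd (e j) F ((x : Amb n) + t • e i) * pd (e j) F ((x : Amb n) + t • e i) =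
        ∑ j, pd (e j) F ((x : Amb n) + t • e i) ^ 2 :=
      Finset.sum_congr rfl fun j _ => (sq _).symm
    rw [h8]
    nlinarith)
  constructor <;> nlinarith

theorem IsEigenframe.esymmFn_pos {F : Amb n → ℝ} {x : Sph n}
    {e : OrthonormalBasis (Fin (n + 1)) ℝ (Amb n)} {l : Fin (n + 1) → ℝ} {o : Fin (n + 1)}
    (h : IsEigenframe F x e l o) {k : ℕ} (hkn : k ≤ n) : 0 < esymmFn k l := by
  have hne : ∃ r, 0 < r ∧ ∀ i, i ≠ o → r ≤ l i := by
    by_cases hn : (univ.erase o).Nonempty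
    · obtain ⟨m, hm, hmin⟩ := Finset.exists_min_image (univ.erase o) l hn
      exact ⟨l m, h.pos m (Finset.ne_of_mem_erase hm), fun i hi => hmin i (by simp [hi])⟩
    · exact ⟨1, one_pos, fun i hi => absurd ⟨i, by simp [hi]⟩ hn⟩
  obtain ⟨r, hr, hr2⟩ := hne
  exact (pow_pos hr k).trans_le (pow_le_esymmFn hr.le h.nonneg hr2 (by simpa using hkn))

theorem IsEigenframe.pd_speed {U F : Amb n → ℝ} {x : Sph n}
    {e : OrthonormalBasis (Fin (n + 1)) ℝ (Amb n)} {l : Fin (n + 1) → ℝ} {o : Fin (n + 1)}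
    (he : IsEigenframe F x e l o) (hU : ContDiffOn ℝ ∞ U {0}ᶜ) (hF : ContDiffOn ℝ ∞ F {0}ᶜ)
    (hU0 : ∀ y, y ≠ 0 → 0 < U y) (hF0 : ∀ y, y ≠ 0 → 0 < F y) (c q r : ℝ) (k : ℕ) (v : Amb n) :
    pd v (speed c q r k U F) x = speed c q r k U F x * (q * (pd v U x / U x) +
      r * (pd v F x / F x)) + c * (U x ^ q * F x ^ r) *
        ∑ i, esymmD k l i * pd v (pd (e i) (pd (e i) F)) x := by
  have hx := x.coe_ne_zero
  have hUp := hU0 x hx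
  have hFp := hF0 x hx
  have j1 := (jet2_line hU hx v).rpow hUp q
  have j2 := (jet2_line hF hx v).rpow hFp r
  have j3 := ((j1.mul j2).const_mul c).mul (he.sig_jet2 hF k v)
  rw [((jet2_line (speed_smooth hU hF hU0 hF0 c q r k) hx v).unique j3).2.1, speed, he.sig_eq hF,
    Real.rpow_sub_one hUp.ne', Real.rpow_sub_one hFp.ne']
  field_simp

/-- After the `η` terms cancel, what remains is `(p - 1 - k) K W F`, nonnegative since `p ≥ k + 1`,
plus `ψ F P` times the gap in `h5`. -/
theorem gradient_scalar_estimate {K F G W ψ σ S P p k CU η A : ℝ} (hWx : W = ψ * σ)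
    (hG : G = W - η * F) (hψ : 0 < ψ) (hσ : 0 < σ) (hF : 0 < F) (hK : 0 < K) (hp : k + 1 ≤ p)
    (hP : P = √K) (hA : A ≤ W * ((p + k - 1) * (CU * (P * F)) + (2 - p) * (K * F)) +
      ψ * (K * F * (k * σ) - K * F ^ 2 * S) - η * (K * F ^ 2))
    (h5 : (p + k - 1) * CU * σ < P * (F * S)) : 0 < K * F * G - A := by
  have hPP : P * P = K := by rw [hP]; exact Real.mul_self_sqrt hK.le
  have hP0 : 0 < P := by rw [hP]; exact Real.sqrt_pos.mpr hK
  have h9 : 0 < ψ * F * P * (P * (F * S) - (p + k - 1) * CU * σ) :=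
    mul_pos (mul_pos (mul_pos hψ hF) hP0) (by linarith)
  have h10 : 0 ≤ (p - 1 - k) * K * (ψ * σ * F) :=
    mul_nonneg (mul_nonneg (by linarith) hK.le) (mul_pos (mul_pos hψ hσ) hF).le
  have h12 : ψ * F * P * (P * (F * S) - (p + k - 1) * CU * σ) =
      ψ * F * (K * (F * S)) - ψ * F * P * ((p + k - 1) * CU * σ) := by
    rw [← hPP]; ring
  subst hG hWx
  linarith

/-- The second order condition yields the good term `-K F² S`, where `S` is the tangential trace of
the derivative of `σ_k`. The bad term comes from the gradient of `U` and is only of order `√K`.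
Comparing `σ_k` with `S` through `hsig` makes the good term win for large `K`. -/
theorem HomFlow.gradient_touch {k : ℕ} {p c : ℝ} {U : Amb n → ℝ} {I : Set ℝ} {H : ℝ → Amb n → ℝ}
    {η : ℝ → ℝ} (h : HomFlow k p c U I H η) (hk : 1 ≤ k) (hkn : k ≤ n) (hp : (k : ℝ) + 1 ≤ p)
    (hc : 0 < c) {τ : ℝ} (hτ : τ ∈ interior I) {x : Sph n} {K M CU : ℝ} (hK : 0 < K) (hM : 0 < M)
    (hle : ∀ y : Sph n, ‖gradient (H τ) y‖ ^ 2 ≤ K * H τ y ^ 2)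
    (heq : ‖gradient (H τ) x‖ ^ 2 = K * H τ x ^ 2)
    (hCU : ‖gradient U x‖ ≤ CU * U x)
    (hsig : sig k (H τ) x ≤ (M * H τ x) ^ k) (hKM : (p + k - 1) * CU * M < √K) :
    ∃ d, 0 < d ∧ HasDerivAt (fun s => K * H s x ^ 2 - ‖gradient (H s) x‖ ^ 2) d τ := by
  have hτI := interior_subset hτ
  have hx := x.coe_ne_zero
  have hF := h.slice hτI
  have hhom := h.hom τ hτI
  obtain ⟨e, l, o, he⟩ := h.exists_frame hτI x
  set F := H τ with hFdef
  set Ψ := psi k p c U F with hΨ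
  set G : Amb n → ℝ := fun y => F y * (Ψ y - η τ) with hG
  have hFp : 0 < F x := h.pos τ hτI x hx
  have hUp : 0 < U x := h.posU x hx
  have hσ : 0 < esymmFn k l := he.esymmFn_pos hkn
  have hder : HasDerivAt (fun s => K * H s x ^ 2 - ‖gradient (H s) x‖ ^ 2)
      (2 * (K * F x * G x - ∑ j, pd (e j) F x * pd (e j) G x)) τ := by
    have h1 := ((h.pde τ hτ x hx).fun_pow 2).const_mul K
    have h2 : HasDerivAt (fun s => ∑ j, pd (e j) (H s) x ^ 2)
        (∑ j, 2 * pd (e j) F x ^ 1 * pd (e j) G x) τ :=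
      HasDerivAt.fun_sum fun j _ => (h.pd_hasDerivAt hτ (e j) hx).fun_pow 2
    simp only [norm_gradient_sq e]
    refine (h1.sub h2).congr_deriv ?_
    have h3 : ∑ j, 2 * pd (e j) F x ^ 1 * pd (e j) G x =
        2 * ∑ j, pd (e j) F x * pd (e j) G x := by
      rw [Finset.mul_sum]
      exact Finset.sum_congr rfl fun j _ => by ring
    rw [h3]
    change K * ((2 : ℕ) * F x ^ (2 - 1) * (F x * (Ψ x - η τ))) - _ = _
    simp only [hG]
    push_cast
    ring
  refine ⟨_, ?_, hder⟩
  set W := speed c (p + k - 1) (2 - p) k U F with hW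
  have hWs : ContDiffOn ℝ ∞ W {0}ᶜ := speed_smooth h.smoothU hF h.posU (h.pos τ hτI) _ _ _ _
  have hGW : ∀ y, y ≠ 0 → G y = W y - η τ * F y := by
    intro y hy
    have h1 := mul_speed (U := U) (h.pos τ hτI y hy) c (p + k - 1) (1 - p) k
    rw [show (1 : ℝ) - p + 1 = 2 - p by ring] at h1
    simp only [hG, hW, hΨ, psi]
    rw [← h1]
    ring
  have hGj : ∀ j, pd (e j) G x = pd (e j) W x - η τ * pd (e j) F x := by
    intro j
    rw [pd_congr hGW _ hx, pd_sub hWs (contDiffOn_const.mul hF) _ hx, pd_const_mul hF _ _ hx]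
  set ψ := c * (U x ^ (p + k - 1) * F x ^ (2 - p)) with hψ
  have hψp : 0 < ψ := mul_pos hc (mul_pos (Real.rpow_pos_of_pos hUp _) (Real.rpow_pos_of_pos hFp _))
  have hWx : W x = ψ * esymmFn k l := by rw [hW, speed, he.sig_eq hF]
  have hWj : ∀ j, pd (e j) W x = W x * ((p + k - 1) * (pd (e j) U x / U x) +
      (2 - p) * (pd (e j) F x / F x)) +
      ψ * ∑ i, esymmD k l i * pd (e j) (pd (e i) (pd (e i) F)) x := fun j =>
    he.pd_speed h.smoothU hF h.posU (h.pos τ hτI) _ _ _ _ (e j)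
  have hsum : ∑ j, pd (e j) F x * pd (e j) G x = W x * ((p + k - 1) *
      ((∑ j, pd (e j) U x * pd (e j) F x) / U x) + (2 - p) * (K * F x)) +
      ψ * ∑ i, esymmD k l i * ∑ j, pd (e j) F x * pd (e i) (pd (e i) (pd (e j) F)) x -
      η τ * (K * F x ^ 2) := by
    rw [← heq, norm_gradient_sq e]
    have h1 : K * F x = (∑ j, pd (e j) F x ^ 2) / F x := by
      rw [← norm_gradient_sq e, heq]; field_simp
    rw [h1]
    simp only [hGj, hWj, Finset.mul_sum, Finset.sum_div]
    rw [Finset.sum_comm (s := univ) (t := univ)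
      (f := fun i j => ψ * (esymmD k l i * (pd (e j) F x * pd (e i) (pd (e i) (pd (e j) F)) x)))]
    rw [← Finset.sum_add_distrib, Finset.mul_sum, ← Finset.sum_add_distrib,
      ← Finset.sum_sub_distrib]
    refine Finset.sum_congr rfl fun j _ => ?_
    have h2 : ∑ i, ψ * (esymmD k l i * (pd (e j) F x * pd (e i) (pd (e i) (pd (e j) F)) x)) =
        pd (e j) F x * ∑ i, ψ * (esymmD k l i * pd (e j) (pd (e i) (pd (e i) F)) x) := by
      rw [Finset.mul_sum]
      refine Finset.sum_congr rfl fun i _ => ?_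
      rw [pd3_rotate hF hx (e j) (e i) (e i)]
      ring
    rw [h2]
    ring
  have hgrad : ∑ j, pd (e j) U x * pd (e j) F x ≤ CU * U x * (√K * F x) := by
    refine (sum_pd_mul_pd_le e U F x).trans ?_
    have h1 : ‖gradient F x‖ = √K * F x := by
      rw [← Real.sqrt_sq (norm_nonneg (gradient F x)), heq, Real.sqrt_mul hK.le,
        Real.sqrt_sq hFp.le]
    rw [h1]
    exact mul_le_mul_of_nonneg_right hCU (by positivity)
  have hterm : ∀ i, esymmD k l i * ∑ j, pd (e j) F x * pd (e i) (pd (e i) (pd (e j) F)) x ≤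
      K * F x * (esymmD k l i * l i) - K * F x ^ 2 * (if i = o then 0 else esymmD k l i) := by
    intro i
    by_cases hi : i = o
    · subst hi
      have h0 : ∀ j, pd (e i) (pd (e i) (pd (e j) F)) x = 0 := fun j => by
        rw [he.base]; exact pd_self_self_pd hF hhom hx _
      simp [h0, he.zero]
    · obtain ⟨h1, h2⟩ := he.gradient_conditions hF hhom hle heq hi
      -- By the first order condition either the derivative vanishes or `l i = K F`; in the second
      -- case `F_i² ≤ |∇F|² = K F²`. The bound lets the `- l i ^ 2` of the second order condition
      -- absorb the gradient term.
      have h3 : K * pd (e i) F x ^ 2 ≤ l i ^ 2 := by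
        rcases mul_eq_zero.mp h1 with h4 | h4
        · rw [h4]; nlinarith [sq_nonneg (l i)]
        · have h5 : l i = K * F x := by linarith
          have h6 : pd (e i) F x ^ 2 ≤ K * F x ^ 2 := by
            rw [← heq, norm_gradient_sq e]
            exact Finset.single_le_sum (f := fun j => pd (e j) F x ^ 2)
              (fun j _ => sq_nonneg _) (mem_univ i)
          rw [h5]
          nlinarith
      rw [if_neg hi]
      have h7 := mul_le_mul_of_nonneg_left h2 (esymmD_nonneg k he.nonneg i)
      have h8 := mul_le_mul_of_nonneg_left h3 (esymmD_nonneg k he.nonneg i)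
      nlinarith
  have hS := Finset.sum_le_sum fun i (_ : i ∈ univ) => hterm i
  rw [Finset.sum_sub_distrib, ← Finset.mul_sum, ← Finset.mul_sum, sum_esymmD_mul_self] at hS
  have hSo : ∑ i, (if i = o then 0 else esymmD k l i) = ∑ i ∈ univ.erase o, esymmD k l i := by
    rw [← Finset.sum_erase_add _ _ (mem_univ o), if_pos rfl, add_zero]
    exact Finset.sum_congr rfl fun i hi => if_neg (Finset.ne_of_mem_erase hi)
  rw [hSo] at hS
  set S := ∑ i ∈ univ.erase o, esymmD k l i with hSdef
  have hmac : esymmFn k l ≤ M * F x * S := by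
    rw [he.sig_eq hF] at hsig
    exact esymmFn_le_mul_sum_esymmD hk he.nonneg he.zero (mul_pos hM hFp) hsig
  set σ := esymmFn k l with hσdef
  have hGx : G x = W x - η τ * F x := hGW x hx
  have hq : 0 ≤ p + k - 1 := by
    have : (1 : ℝ) ≤ k := by exact_mod_cast hk
    linarith
  have h1 : (∑ j, pd (e j) U x * pd (e j) F x) / U x ≤ CU * (√K * F x) := by
    rw [div_le_iff₀ hUp]
    linarith
  have hWp : 0 < W x := by rw [hWx]; exact mul_pos hψp hσ
  have h2 := mul_le_mul_of_nonneg_left (mul_le_mul_of_nonneg_left h1 hq) hWp.le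
  have h3 := mul_le_mul_of_nonneg_left hS hψp.le
  have h4 : ∑ j, pd (e j) F x * pd (e j) G x ≤ W x * ((p + k - 1) * (CU * (√K * F x)) +
      (2 - p) * (K * F x)) + ψ * (K * F x * (k * σ) - K * F x ^ 2 * S) - η τ * (K * F x ^ 2) := by
    rw [hsum]
    linarith
  have hsK0 : 0 < √K := Real.sqrt_pos.mpr hK
  have h5 : (p + k - 1) * CU * σ < √K * (F x * S) := by
    have h6 : (p + k - 1) * CU * M * σ < √K * σ := mul_lt_mul_of_pos_right hKM hσ
    have h7 : √K * σ ≤ √K * (M * F x * S) := mul_le_mul_of_nonneg_left hmac hsK0.le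
    have h8 : M * ((p + k - 1) * CU * σ) < M * (√K * (F x * S)) := by linarith
    exact lt_of_mul_lt_mul_left h8 hM.le
  have h6 := gradient_scalar_estimate hWx hGx hψp hσ hFp hK hp rfl h4 h5
  linarith

end Flow

/-! ### Second order conditions at a minimum of `F D²F` over unit tangent vectors -/

section HessianEstimate

variable {n : ℕ}

theorem pd_pd_smul {F : Amb n → ℝ} (hF : ContDiffOn ℝ ∞ F {0}ᶜ) {y : Amb n} (hy : y ≠ 0) (a : ℝ)
    (v : Amb n) : pd (a • v) (pd (a • v) F) y = a ^ 2 * pd v (pd v F) y := by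
  have h := pd_pd_add hF hy 0 v a
  have h0 : ∀ G : Amb n → ℝ, pd 0 G y = 0 := fun G => map_zero _
  simpa [h0] using h

/-- A lower bound for `F D²F` on unit tangent vectors, extended to all vectors and base points. -/
theorem hess_bound_extend {F : Amb n → ℝ} (hF : ContDiffOn ℝ ∞ F {0}ᶜ) (hom : PosHom 1 F) {μ : ℝ}
    (hle : ∀ (x : Sph n) (v : Amb n), ⟪(x : Amb n), v⟫ = 0 → ‖v‖ = 1 →
      μ ≤ F x * pd v (pd v F) x) {y : Amb n} (hy : y ≠ 0) (v : Amb n) :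
    μ * (‖v‖ ^ 2 * ‖y‖ ^ 2 - ⟪v, y⟫ ^ 2) ≤ ‖y‖ ^ 2 * (F y * pd v (pd v F) y) := by
  have hr : 0 < ‖y‖ := norm_pos_iff.mpr hy
  set x := toSph y with hx
  set r := ‖y‖ with hrdef
  have hyx : y = r • (x : Amb n) := by
    rw [hx, coe_toSph hy, smul_smul, mul_inv_cancel₀ hr.ne', one_smul]
  have hx0 := x.coe_ne_zero
  have h1 : F y = r * F x := by rw [hyx, hom r hr _ hx0, zpow_one]
  have h2 : pd v (pd v F) y = r⁻¹ * pd v (pd v F) x := by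
    rw [hyx, ((hom.pd hF v).pd (pd_smooth hF v) v) r hr _ hx0]
    norm_num
  have h3 : ⟪v, y⟫ = r * ⟪(x : Amb n), v⟫ := by
    rw [hyx, inner_smul_right, real_inner_comm]
  set b := ⟪(x : Amb n), v⟫ with hb
  -- The Hessian does not see the radial component of `v`, so only the tangential part `w` matters.
  set w := v + (-b) • (x : Amb n) with hw
  have hwx : ⟪(x : Amb n), w⟫ = 0 := by
    rw [hw, inner_add_right, inner_smul_right, real_inner_self_eq_norm_sq, x.norm_coe]
    ring
  have hwn : ‖w‖ ^ 2 = ‖v‖ ^ 2 - b ^ 2 := by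
    rw [hw, norm_add_sq_real, inner_smul_right, real_inner_comm, norm_smul, x.norm_coe, ← hb]
    simp only [Real.norm_eq_abs, mul_one, sq_abs]
    ring
  have hwp : pd w (pd w F) x = pd v (pd v F) x := by
    rw [hw, pd_pd_add hF hx0, pd_comm hF v (x : Amb n) hx0, pd_self_pd hF hom hx0, pd_self_pd hF hom hx0]
    ring
  have key : μ * ‖w‖ ^ 2 ≤ F x * pd w (pd w F) x := by
    by_cases hw0 : w = 0
    · rw [hw0]
      have h0 : pd 0 (pd 0 F) (x : Amb n) = 0 := map_zero _
      simp [h0]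
    · have hn : 0 < ‖w‖ := norm_pos_iff.mpr hw0
      have h4 := hle x (‖w‖⁻¹ • w) (by rw [inner_smul_right, hwx, mul_zero])
        (by rw [norm_smul, norm_inv, norm_norm, inv_mul_cancel₀ hn.ne'])
      rw [pd_pd_smul hF hx0] at h4
      have h5 := mul_le_mul_of_nonneg_right h4 (sq_nonneg ‖w‖)
      refine h5.trans (le_of_eq ?_)
      field_simp
  rw [h1, h2, h3]
  rw [hwn, hwp] at key
  have h6 := mul_le_mul_of_nonneg_left key (sq_nonneg r)
  have h7 : r ^ 2 * (r * F x * (r⁻¹ * pd v (pd v F) x)) = r ^ 2 * (F x * pd v (pd v F) x) := by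
    field_simp
  rw [h7]
  linarith

namespace IsEigenframe

variable {F : Amb n → ℝ} {x : Sph n} {e : OrthonormalBasis (Fin (n + 1)) ℝ (Amb n)}
  {l : Fin (n + 1) → ℝ} {o : Fin (n + 1)}

theorem pd_sum_smul_pd (h : IsEigenframe F x e l o) (c : Fin (n + 1) → ℝ) (m : Fin (n + 1)) :
    pd (∑ j, c j • e j) (pd (e m) F) x = c m * l m := by
  rw [pd_sum_left, Finset.sum_eq_single m]
  · rw [pd_smul_left, h.entry_self]
  · intro j _ hj
    rw [pd_smul_left, h.entry_ne hj, mul_zero]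
  · simp

theorem pd_sum_smul_pd_self (h : IsEigenframe F x e l o) (hF : ContDiffOn ℝ ∞ F {0}ᶜ)
    (c : Fin (n + 1) → ℝ) :
    pd (∑ j, c j • e j) (pd (∑ j, c j • e j) F) x = ∑ j, c j ^ 2 * l j := by
  conv_lhs => rw [pd_sum_left]
  refine Finset.sum_congr rfl fun j _ => ?_
  rw [pd_smul_left, pd_comm hF _ _ x.coe_ne_zero, h.pd_sum_smul_pd]
  ring

/-- Along the variation `x + t e_i`, `e_m + t Σ c_j e_j`, the second order condition at a point
where `F D²F(e_m, e_m)` is minimal among all unit tangent vectors. -/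
theorem hess_variation (h : IsEigenframe F x e l o) (hF : ContDiffOn ℝ ∞ F {0}ᶜ)
    (hom : PosHom 1 F) {μ : ℝ} (hle : ∀ (x : Sph n) (v : Amb n), ⟪(x : Amb n), v⟫ = 0 → ‖v‖ = 1 →
      μ ≤ F x * pd v (pd v F) x) {m : Fin (n + 1)} (hm : m ≠ o) (hμ : F x * l m = μ)
    {i : Fin (n + 1)} (hi : i ≠ o) (c : Fin (n + 1) → ℝ) (hcm : c m = 0)
    (hco : c o = -(if i = m then 1 else 0)) :
    pd (e i) F x * l m + F x * pd (e m) (pd (e i) (pd (e m) F)) x = 0 ∧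
      0 ≤ l i * l m + 2 * pd (e i) F x * pd (e m) (pd (e i) (pd (e m) F)) x +
        F x * (pd (e m) (pd (e m) (pd (e i) (pd (e i) F))) x +
          4 * ∑ j, c j * pd (e m) (pd (e i) (pd (e j) F)) x + 2 * ∑ j, c j ^ 2 * l j) -
        2 * μ * ∑ j, c j ^ 2 := by
  have hx := x.coe_ne_zero
  have ht := h.tangent hi
  have he : ‖e i‖ = 1 := e.orthonormal.1 i
  set ζ := ∑ j, c j • e j with hζ
  have hin : ∀ j, ⟪e j, ζ⟫ = c j := fun j => e.orthonormal.inner_right_fintype c j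
  have hζn : ‖ζ‖ ^ 2 = ∑ j, c j ^ 2 := by
    rw [← e.sum_sq_norm_inner_right]
    exact Finset.sum_congr rfl fun j _ => by rw [hin, Real.norm_eq_abs, sq_abs]
  have jF := jet2_line hF hx (e i)
  have jmm := jet2_line (pd_smooth (pd_smooth hF (e m)) (e m)) hx (e i)
  have jmz := jet2_line (pd_smooth (pd_smooth hF ζ) (e m)) hx (e i)
  have jzz := jet2_line (pd_smooth (pd_smooth hF ζ) ζ) hx (e i)
  have jn := (Jet2.const 1).add (Jet2.id.mul Jet2.id)
  have jv := (Jet2.const 1).add ((Jet2.id.mul Jet2.id).const_mul (‖ζ‖ ^ 2))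
  have jvy := (Jet2.id.mul Jet2.id).const_mul (c i)
  have jQ := (jmm.add ((Jet2.id.mul jmz).const_mul 2)).add ((Jet2.id.mul Jet2.id).mul jzz)
  have j := (jn.mul (jF.mul jQ)).sub (((jv.mul jn).sub (jvy.mul jvy)).const_mul μ)
  have e1 : pd (e m) (pd ζ F) x = 0 := by
    rw [pd_comm hF _ _ hx, h.pd_sum_smul_pd, hcm, zero_mul]
  have e2 : pd (e i) (pd (e m) (pd (e m) F)) x = pd (e m) (pd (e i) (pd (e m) F)) x :=
    pd_comm (pd_smooth hF _) _ _ hx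
  have e3 : pd (e i) (pd (e m) (pd ζ F)) x = ∑ j, c j * pd (e m) (pd (e i) (pd (e j) F)) x := by
    rw [pd3_rotate hF hx, pd3_rotate hF hx, pd_sum_left]
    refine Finset.sum_congr rfl fun j _ => ?_
    rw [pd_smul_left, pd_comm (pd_smooth hF _) _ _ hx, pd3_rotate hF hx, pd3_rotate hF hx]
  have e4 := pd4_swap hF hx (e i) (e m)
  rw [h.entry_self, e1, h.pd_sum_smul_pd_self hF, e2, e3, e4, h.entry_self] at j
  obtain ⟨h1, h2⟩ := (j.congr (a' := 0) (by rw [← hμ]; ring) rfl rfl).of_nonneg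
    (.of_forall fun t => by
      have hy := add_smul_ne_zero ht t
      have h3 := hess_bound_extend hF hom hle hy (e m + t • ζ)
      rw [pd_pd_add hF hy, norm_add_smul_sq ht he] at h3
      have h4 : ‖e m + t • ζ‖ ^ 2 = 1 + ‖ζ‖ ^ 2 * (t * t) := by
        rw [norm_add_sq_real, inner_smul_right, hin, hcm, e.orthonormal.1 m, norm_smul, mul_pow,
          Real.norm_eq_abs, sq_abs]
        ring
      -- The prescribed `c o` keeps the varied vector tangent to first order, and `c m = 0` keeps
      -- its length. The failure of tangency is of order `t²` and enters the inequality squared,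
      -- without effect on second order.
      have h5 : ⟪e m + t • ζ, (x : Amb n) + t • e i⟫ = c i * (t * t) := by
        have h6 : ⟪ζ, (x : Amb n)⟫ = c o := by rw [real_inner_comm, ← h.base, hin]
        have h7 : ⟪e m, (x : Amb n)⟫ = 0 := by rw [real_inner_comm, h.tangent hm]
        have h8 : ⟪e m, e i⟫ = if i = m then (1 : ℝ) else 0 := by
          rw [orthonormal_iff_ite.mp e.orthonormal]
          simp only [eq_comm]
        rw [inner_add_left, inner_add_right, inner_add_right, inner_smul_left, inner_smul_right,
          inner_smul_right, inner_smul_left, h7, h6, h8, real_inner_comm, hin, hco]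
        simp only [RCLike.conj_to_real]
        ring
      rw [h4, h5] at h3
      nlinarith)
  rw [hζn] at h2
  constructor
  · linarith
  · have hμ' := hμ
    nlinarith

/-- The second order condition with the optimal variation. -/
theorem hess_conditions (h : IsEigenframe F x e l o) (hF : ContDiffOn ℝ ∞ F {0}ᶜ)
    (hom : PosHom 1 F) (hFx : 0 < F x) {μ : ℝ}
    (hle : ∀ (x : Sph n) (v : Amb n), ⟪(x : Amb n), v⟫ = 0 → ‖v‖ = 1 →
      μ ≤ F x * pd v (pd v F) x) {m : Fin (n + 1)} (hm : m ≠ o) (hμ : F x * l m = μ)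
    {i : Fin (n + 1)} (hi : i ≠ o) :
    2 * ∑ j ∈ univ.erase o, pd (e m) (pd (e i) (pd (e j) F)) x ^ 2 / l j -
      (if i = m then 2 * l m else 0) - l i * (l m / F x) ≤
      pd (e m) (pd (e m) (pd (e i) (pd (e i) F))) x := by
  have hx := x.coe_ne_zero
  set B : Fin (n + 1) → ℝ := fun j => pd (e m) (pd (e i) (pd (e j) F)) x with hB
  -- The choice `-(B j / l j)` minimizes `4 c B + 2 c² l` and produces `-2 B² / l`. The further term
  -- `-2 l m c²` is negative and is dropped; only at `o`, where it combines with `B o`, does it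
  -- count.
  set c : Fin (n + 1) → ℝ := fun j =>
    if j = o then -(if i = m then 1 else 0) else if j = m then 0 else -(B j / l j) with hc
  have hlm := h.pos m hm
  obtain ⟨h1, h2⟩ := h.hess_variation hF hom hle hm hμ hi c (by simp [hc, hm]) (by simp [hc])
  have hBm : pd (e m) (pd (e i) (pd (e m) F)) x = B m := rfl
  rw [hBm] at h1 h2
  have hBo : B o = -(if i = m then l m else 0) := by
    change pd (e m) (pd (e i) (pd (e o) F)) x = _
    rw [pd3_rotate hF hx, pd3_rotate hF hx, h.base, pd_self_pd_pd hF hom hx, h.entry,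
      Matrix.diagonal_apply]
    by_cases him : i = m
    · subst him; simp
    · simp [him, Ne.symm him]
  have hsplit : ∀ f : Fin (n + 1) → ℝ,
      ∑ j, f j = f o + (f m + ∑ j ∈ (univ.erase o).erase m, f j) := fun f => by
    rw [← Finset.add_sum_erase univ f (mem_univ o),
      ← Finset.add_sum_erase (univ.erase o) f (Finset.mem_erase.mpr ⟨hm, mem_univ m⟩)]
  have hS : 4 * ∑ j, c j * B j + 2 * ∑ j, c j ^ 2 * l j - 2 * l m * ∑ j, c j ^ 2 ≤
      (if i = m then 2 * l m else 0) - 2 * ∑ j ∈ (univ.erase o).erase m, B j ^ 2 / l j := by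
    rw [hsplit fun j => c j * B j, hsplit fun j => c j ^ 2 * l j, hsplit fun j => c j ^ 2]
    have hco : c o = -(if i = m then 1 else 0) := by simp [hc]
    have hcm : c m = 0 := by simp [hc, hm]
    rw [hco, hcm, hBo, h.zero]
    have hR : ∑ j ∈ (univ.erase o).erase m, (4 * (c j * B j) + 2 * (c j ^ 2 * l j) -
        2 * l m * c j ^ 2) ≤ ∑ j ∈ (univ.erase o).erase m, -2 * (B j ^ 2 / l j) := by
      refine Finset.sum_le_sum fun j hj => ?_
      have hjm := Finset.ne_of_mem_erase hj
      have hjo := Finset.ne_of_mem_erase (Finset.mem_of_mem_erase hj)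
      have hlj := h.pos j hjo
      have hcj : c j = -(B j / l j) := by simp [hc, hjm, hjo]
      have h3 : 0 ≤ l m * c j ^ 2 := by positivity
      have h4 : c j * B j = -(B j ^ 2 / l j) := by rw [hcj]; ring
      have h5 : c j ^ 2 * l j = B j ^ 2 / l j := by rw [hcj]; field_simp
      rw [h4, h5]
      linarith
    rw [Finset.sum_sub_distrib, Finset.sum_add_distrib, ← Finset.mul_sum, ← Finset.mul_sum,
      ← Finset.mul_sum, ← Finset.mul_sum] at hR
    by_cases him : i = m
    · simp only [him, if_true]; nlinarith
    · simp only [him, if_false]; nlinarith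
  rw [← Finset.add_sum_erase (univ.erase o) _ (Finset.mem_erase.mpr ⟨hm, mem_univ m⟩)]
  change 2 * (B m ^ 2 / l m + ∑ j ∈ (univ.erase o).erase m, B j ^ 2 / l j) - _ - _ ≤ _
  -- No variation in the direction `m` is allowed; the missing square is supplied by the first order
  -- condition.
  have h3 : pd (e i) F x * B m = -(F x * (B m ^ 2 / l m)) := by
    have : pd (e i) F x = -(F x * B m) / l m := by
      rw [eq_div_iff hlm.ne']; linarith
    rw [this]; ring
  have h4 : l i * l m = F x * (l i * (l m / F x)) := by field_simp
  rw [← hμ] at h2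
  have h5 := mul_le_mul_of_nonneg_left hS hFx.le
  refine le_of_mul_le_mul_left ?_ hFx
  nlinarith

end IsEigenframe

end HessianEstimate

/-! ### The second derivative of the speed, and the touching argument for the smallest radius -/

section CurvatureTouch

variable {n : ℕ}

/-- The joint convexity of `u^(1+α) f^(-α)` for `α = s / (k + 1)`, in terms of logarithmic
derivatives: the two sides differ by `q s (a - g)² / (k + 1)`. It applies to the `(k + 1)`-th root
of the prefactor of `σ_k`. -/
theorem power_concavity {k q s a g u f : ℝ} (hk : 0 < k) (hs : 0 ≤ s) (hq : q = s + (k + 1)) :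
    q * u - s * f ≤ ((q * a - s * g) ^ 2 + q * (u - a ^ 2) - s * (f - g ^ 2)) -
      k / (k + 1) * (q * a - s * g) ^ 2 := by
  have h0 : 0 < k + 1 := by linarith
  have h1 : ((q * a - s * g) ^ 2 + q * (u - a ^ 2) - s * (f - g ^ 2)) -
      k / (k + 1) * (q * a - s * g) ^ 2 - (q * u - s * f) = q * s * (a - g) ^ 2 / (k + 1) := by
    rw [hq]; field_simp; ring
  have h2 : 0 ≤ q * s * (a - g) ^ 2 / (k + 1) := by
    have : 0 ≤ q := by linarith
    positivity
  linarith

/-- The weights `(k + 1) / k` and `k / (k + 1)` are reciprocal, so the cross term `2 ψ1 σ1`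
completes a square. -/
theorem product_concavity {k σ σ1 σ2 ψ ψ1 ψ2 s : ℝ} (hk : 0 < k) (hσ : 0 < σ) (hψ : 0 < ψ)
    (h : (k + 1) / k * (σ1 ^ 2 / σ) - k * σ * s ≤ σ2) :
    σ * (ψ2 - k / (k + 1) * (ψ1 ^ 2 / ψ)) - k * (ψ * σ) * s ≤ ψ2 * σ + 2 * ψ1 * σ1 + ψ * σ2 := by
  have h1 := mul_le_mul_of_nonneg_left h hψ.le
  have h0 : 0 < k + 1 := by linarith
  have h2 : 2 * ψ1 * σ1 + ψ * ((k + 1) / k * (σ1 ^ 2 / σ)) + σ * (k / (k + 1) * (ψ1 ^ 2 / ψ)) =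
      (k * σ * ψ1 + (k + 1) * ψ * σ1) ^ 2 / (k * (k + 1) * σ * ψ) := by
    field_simp
    ring
  have h3 : 0 ≤ (k * σ * ψ1 + (k + 1) * ψ * σ1) ^ 2 / (k * (k + 1) * σ * ψ) := by positivity
  nlinarith

/-- The second derivative of the speed in a direction of minimal principal radius. -/
theorem IsEigenframe.pd_pd_speed {U F : Amb n → ℝ} {x : Sph n}
    {e : OrthonormalBasis (Fin (n + 1)) ℝ (Amb n)} {l : Fin (n + 1) → ℝ} {o : Fin (n + 1)}
    (he : IsEigenframe F x e l o) (hU : ContDiffOn ℝ ∞ U {0}ᶜ) (hF : ContDiffOn ℝ ∞ F {0}ᶜ)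
    (hU0 : ∀ y, y ≠ 0 → 0 < U y) (hF0 : ∀ y, y ≠ 0 → 0 < F y) (hom : PosHom 1 F) {k : ℕ}
    (hk : 1 ≤ k) (hkn : k ≤ n) {p c : ℝ} (hp : (k : ℝ) + 1 ≤ p) (hc : 0 < c) {μ : ℝ}
    (hle : ∀ (x : Sph n) (v : Amb n), ⟪(x : Amb n), v⟫ = 0 → ‖v‖ = 1 →
      μ ≤ F x * pd v (pd v F) x) {m : Fin (n + 1)} (hm : m ≠ o) (hμ : F x * l m = μ) :
    speed c (p + k - 1) (2 - p) k U F x * ((p + k - 1) * (pd (e m) (pd (e m) U) x / U x) -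
      (p - 2 + k) * (l m / F x)) ≤
      pd (e m) (pd (e m) (speed c (p + k - 1) (2 - p) k U F)) x := by
  have hx := x.coe_ne_zero
  have hUp := hU0 x hx
  have hFp := hF0 x hx
  have hk0 : (0 : ℝ) < k := by exact_mod_cast hk
  have hk1 : (1 : ℝ) ≤ k := by exact_mod_cast hk
  have hσ : 0 < esymmFn k l := he.esymmFn_pos hkn
  have jU := jet2_line hU hx (e m)
  have jF := jet2_line hF hx (e m)
  have hψ : 0 < c * (U x ^ (p + k - 1) * F x ^ (2 - p)) :=
    mul_pos hc (mul_pos (Real.rpow_pos_of_pos hUp _) (Real.rpow_pos_of_pos hFp _))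
  set ψ := c * (U x ^ (p + k - 1) * F x ^ (2 - p)) with hψdef
  set a := pd (e m) U x / U x with ha
  set g := pd (e m) F x / F x with hg
  set u2 := pd (e m) (pd (e m) U) x / U x with hu2
  set f2 := l m / F x with hf2
  have jψ := (((jU.rpow hUp (p + k - 1)).mul (jF.rpow hFp (2 - p))).const_mul c).congr
    (a' := ψ) (b' := ψ * ((p + k - 1) * a - (p - 2) * g))
    (c' := ψ * (((p + k - 1) * a - (p - 2) * g) ^ 2 + (p + k - 1) * (u2 - a ^ 2) -
      (p - 2) * (f2 - g ^ 2))) rfl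
    (by
      rw [hψdef, ha, hg, Real.rpow_sub_one hUp.ne', Real.rpow_sub_one hFp.ne']
      field_simp
      ring)
    (by
      rw [hψdef, ha, hg, hu2, hf2, he.entry_self, Real.rpow_sub_one hUp.ne',
        Real.rpow_sub_one hFp.ne', Real.rpow_sub hUp _ 2, Real.rpow_sub hFp _ 2, Real.rpow_two,
        Real.rpow_two]
      field_simp
      ring)
  have j := jψ.mul (he.sig_jet2 hF k (e m))
  rw [((jet2_line (speed_smooth hU hF hU0 hF0 c (p + k - 1) (2 - p) k) hx (e m)).unique j).2.2]
  -- The radial entries `0`, `-l m` and `2 l m` come from the Euler identities; the tangential lower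
  -- bound for `C` is the optimized second variation.
  have hB := inverse_concavity hk hm he.zero he.pos
    (B := Matrix.of fun i j => pd (e m) (pd (e i) (pd (e j) F)) x)
    (C := Matrix.of fun i j => pd (e m) (pd (e m) (pd (e i) (pd (e j) F))) x) (s := l m / F x)
    (fun i j => pd_congr (fun z hz => pd_comm hF _ _ hz) _ hx)
    (by
      have h1 : pd (e m) (pd (e o) (pd (e o) F)) x = 0 := by
        rw [pd3_rotate hF hx, he.base, pd_self_self_pd hF hom hx]
      exact h1)
    (by
      have h1 : pd (e m) (pd (e o) (pd (e m) F)) x = -l m := by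
        rw [pd_comm (pd_smooth hF _) _ _ hx, he.base, pd_self_pd_pd hF hom hx, he.entry_self]
      exact h1)
    (fun j hj => by
      have h1 : pd (e m) (pd (e o) (pd (e j) F)) x = 0 := by
        rw [pd_comm (pd_smooth hF _) _ _ hx, he.base, pd_self_pd_pd hF hom hx,
          he.entry_ne hj.symm, neg_zero]
      exact h1)
    (fun i hi => he.hess_conditions hF hom hFp hle hm hμ hi)
    (by
      have h1 : pd (e m) (pd (e m) (pd (e o) (pd (e o) F))) x = 2 * l m := by
        rw [pd4_swap hF hx, he.base, pd_self_self_pd_pd hF hom hx, he.entry_self]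
      exact h1)
    hσ
  refine le_trans ?_ (product_concavity hk0 hσ hψ hB)
  have hW : speed c (p + k - 1) (2 - p) k U F x = ψ * esymmFn k l := by
    rw [speed, he.sig_eq hF]
  have h1 := power_concavity (q := p + k - 1) (s := p - 2) (a := a) (g := g) (u := u2) (f := f2)
    hk0 (by linarith) (by ring)
  have h2 := mul_le_mul_of_nonneg_left h1 (mul_pos hψ hσ).le
  have h3 : (ψ * ((p + k - 1) * a - (p - 2) * g)) ^ 2 / ψ =
      ψ * ((p + k - 1) * a - (p - 2) * g) ^ 2 := by field_simp
  rw [hW, h3]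
  linarith

/-- In the direction `e m` the time derivative of `F l m` is at least `(p + k - 1) u F² Ψ - μ ((p +
k - 3) Ψ + 2 η)`, which `hsmall` makes positive. -/
theorem HomFlow.hess_touch {k : ℕ} {p c : ℝ} {U : Amb n → ℝ} {I : Set ℝ} {H : ℝ → Amb n → ℝ}
    {η : ℝ → ℝ} (h : HomFlow k p c U I H η) (hk : 1 ≤ k) (hkn : k ≤ n) (hp : (k : ℝ) + 1 ≤ p)
    (hc : 0 < c) {τ : ℝ} (hτ : τ ∈ interior I) {x : Sph n} {v : Amb n}
    (hv : ⟪(x : Amb n), v⟫ = 0) (hv1 : ‖v‖ = 1) {μ u : ℝ}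
    (hle : ∀ (x : Sph n) (v : Amb n), ⟪(x : Amb n), v⟫ = 0 → ‖v‖ = 1 →
      μ ≤ H τ x * pd v (pd v (H τ)) x)
    (heq : H τ x * pd v (pd v (H τ)) x = μ)
    (hu : ∀ w, ⟪(x : Amb n), w⟫ = 0 → ‖w‖ = 1 → u * U x ≤ pd w (pd w U) x)
    (hsmall : μ * ((p + k - 3) * psi k p c U (H τ) x + 2 * η τ) <
      (p + k - 1) * u * (H τ x ^ 2 * psi k p c U (H τ) x)) :
    ∃ w, ⟪(x : Amb n), w⟫ = 0 ∧ ‖w‖ = 1 ∧ H τ x * pd w (pd w (H τ)) x = μ ∧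
      ∃ d, 0 < d ∧ HasDerivAt (fun s => H s x * pd w (pd w (H s)) x) d τ := by
  have hτI := interior_subset hτ
  have hx := x.coe_ne_zero
  have hF := h.slice hτI
  have hhom := h.hom τ hτI
  obtain ⟨e, l, o, he⟩ := h.exists_frame hτI x
  set F := H τ with hFdef
  set Ψ := psi k p c U F with hΨ
  have hFp : 0 < F x := h.pos τ hτI x hx
  have hUp : 0 < U x := h.posU x hx
  -- The touching vector `v` need not belong to the frame. Its Rayleigh quotient is an average of
  -- the tangential eigenvalues, so attaining the minimum forces some eigenvector to attain it too.
  obtain ⟨m, hm, hμ⟩ : ∃ m, m ≠ o ∧ F x * l m = μ := by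
    by_contra! hne
    have hlt : ∀ i, i ≠ o → μ < F x * l i := fun i hi => by
      have h1 := hle x (e i) (he.tangent hi) (e.orthonormal.1 i)
      rw [he.entry_self] at h1
      exact lt_of_le_of_ne h1 (hne i hi).symm
    have hco : ⟪e o, v⟫ = 0 := by rw [he.base, hv]
    have hvs : v = ∑ j, ⟪e j, v⟫ • e j := (e.sum_repr' v).symm
    have h1 : pd v (pd v F) x = ∑ j, ⟪e j, v⟫ ^ 2 * l j := by
      conv_lhs => rw [hvs]
      exact he.pd_sum_smul_pd_self hF _
    have h2 : ∑ j, ⟪e j, v⟫ ^ 2 = 1 := by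
      have := e.sum_sq_norm_inner_right v
      rw [hv1, one_pow] at this
      rw [← this]
      exact Finset.sum_congr rfl fun j _ => by rw [Real.norm_eq_abs, sq_abs]
    have h3 : ∑ j, ⟪e j, v⟫ ^ 2 * (F x * l j - μ) = 0 := by
      rw [← sub_eq_zero] at heq
      rw [← heq, h1, Finset.mul_sum]
      simp only [mul_sub, Finset.sum_sub_distrib]
      rw [← Finset.sum_mul, h2, one_mul]
      refine congrArg (· - μ) (Finset.sum_congr rfl fun j _ => by ring)
    have h4 : ∀ j, ⟪e j, v⟫ ^ 2 * (F x * l j - μ) = 0 := fun j =>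
      (Finset.sum_eq_zero_iff_of_nonneg fun j _ => by
        by_cases hj : j = o
        · rw [hj, hco]; simp
        · exact mul_nonneg (sq_nonneg _) (sub_nonneg.mpr (hlt j hj).le)).mp h3 j (mem_univ j)
    have h5 : ∑ j, ⟪e j, v⟫ ^ 2 = 0 := Finset.sum_eq_zero fun j _ => by
      by_cases hj : j = o
      · rw [hj, hco]; simp
      · exact (mul_eq_zero.mp (h4 j)).resolve_right (sub_pos.mpr (hlt j hj)).ne'
    rw [h2] at h5
    exact one_ne_zero h5
  refine ⟨e m, he.tangent hm, e.orthonormal.1 m, by rw [he.entry_self, hμ], _, ?_,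
    (h.pde τ hτ x hx).fun_mul (h.pd_pd_hasDerivAt hτ (e m) (e m) hx)⟩
  set W := speed c (p + k - 1) (2 - p) k U F with hW
  have hWs : ContDiffOn ℝ ∞ W {0}ᶜ := speed_smooth h.smoothU hF h.posU (h.pos τ hτI) _ _ _ _
  have hGW : ∀ y, y ≠ 0 → F y * (Ψ y - η τ) = W y - η τ * F y := by
    intro y hy
    have h1 := mul_speed (U := U) (h.pos τ hτI y hy) c (p + k - 1) (1 - p) k
    rw [show (1 : ℝ) - p + 1 = 2 - p by ring] at h1
    simp only [hW, hΨ, psi]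
    rw [← h1]
    ring
  have hG2 : pd (e m) (pd (e m) fun y => F y * (Ψ y - η τ)) x =
      pd (e m) (pd (e m) W) x - η τ * l m := by
    rw [((jet2_line (h.rhs_smooth hτI) hx (e m)).congr_fun fun t => rfl).unique
      (((jet2_line hWs hx (e m)).sub ((jet2_line hF hx (e m)).const_mul (η τ))).congr_of_eventuallyEq
        ?_) |>.2.2, he.entry_self]
    exact .of_forall fun t => (hGW _ (add_smul_ne_zero (he.tangent hm) t)).symm
  have h1 := he.pd_pd_speed h.smoothU hF h.posU (h.pos τ hτI) hhom hk hkn hp hc hle hm hμ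
  have h2 := hu (e m) (he.tangent hm) (e.orthonormal.1 m)
  have hWx : W x = F x * Ψ x := by linarith [hGW x hx]
  have hk1 : (1 : ℝ) ≤ k := by exact_mod_cast hk
  have hσ : 0 < esymmFn k l := he.esymmFn_pos hkn
  have hΨp : 0 < Ψ x := by
    simp only [hΨ, psi, speed, he.sig_eq hF]
    exact mul_pos (mul_pos hc (mul_pos (Real.rpow_pos_of_pos hUp _) (Real.rpow_pos_of_pos hFp _))) hσ
  have h3 : u ≤ pd (e m) (pd (e m) U) x / U x := by rwa [le_div_iff₀ hUp]
  rw [← hW, hWx] at h1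
  have h4 := mul_le_mul_of_nonneg_left h1 hFp.le
  have h5 : F x * (F x * Ψ x * ((p + k - 1) * (pd (e m) (pd (e m) U) x / U x) -
      (p - 2 + k) * (l m / F x))) = (p + k - 1) * (pd (e m) (pd (e m) U) x / U x) *
      (F x ^ 2 * Ψ x) - (p - 2 + k) * (F x * l m) * Ψ x := by
    field_simp
  have h6 : (p + k - 1) * u * (F x ^ 2 * Ψ x) ≤
      (p + k - 1) * (pd (e m) (pd (e m) U) x / U x) * (F x ^ 2 * Ψ x) :=
    mul_le_mul_of_nonneg_right (mul_le_mul_of_nonneg_left h3 (by linarith)) (by positivity)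
  change 0 < F x * (Ψ x - η τ) * pd (e m) (pd (e m) F) x +
    F x * pd (e m) (pd (e m) fun y => F y * (Ψ y - η τ)) x
  rw [hG2, he.entry_self]
  rw [← hμ] at hsmall
  nlinarith

end CurvatureTouch

/-! ### Time intervals and parametric integrals over the sphere -/

section TimeInterval

variable {T : EReal}

theorem Icc_subset_timeInterval {τ : ℝ} (hτ : τ ∈ timeInterval T) :
    0 ≤ τ ∧ Set.Icc 0 τ ⊆ timeInterval T :=
  ⟨hτ.1, fun _ hs => ⟨hs.1, (EReal.coe_le_coe_iff.mpr hs.2).trans_lt hτ.2⟩⟩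

theorem isOpen_coe_lt (T : EReal) : IsOpen {τ : ℝ | (τ : EReal) < T} :=
  isOpen_Iio.preimage continuous_coe_real_ereal

theorem mem_interior_timeInterval {τ : ℝ} (hτ : τ ∈ timeInterval T) (h0 : 0 < τ) :
    τ ∈ interior (timeInterval T) :=
  mem_interior.mpr ⟨Set.Ioi 0 ∩ {τ : ℝ | (τ : EReal) < T}, fun _ hs => ⟨le_of_lt hs.1, hs.2⟩,
    isOpen_Ioi.inter (isOpen_coe_lt T), h0, hτ.2⟩

theorem isLocallyClosed_timeInterval (T : EReal) : IsLocallyClosed (timeInterval T) :=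
  (isClosed_Ici (a := (0 : ℝ))).isLocallyClosed.inter (isOpen_coe_lt T).isLocallyClosed

theorem uniqueDiffOn_timeInterval {τ : ℝ} (hτ : τ ∈ timeInterval T) :
    UniqueDiffOn ℝ (timeInterval T) := by
  refine uniqueDiffOn_convex (Set.OrdConnected.convex ⟨fun a ha b hb s hs =>
    ⟨ha.1.trans hs.1, (EReal.coe_le_coe_iff.mpr hs.2).trans_lt hb.2⟩⟩) ?_
  obtain ⟨s, hs1, hs2⟩ := EReal.lt_iff_exists_real_btwn.mp hτ.2
  have hs : 0 < s := hτ.1.trans_lt (EReal.coe_lt_coe_iff.mp hs1)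
  exact ⟨s, mem_interior_timeInterval ⟨hs.le, hs2⟩ hs⟩

end TimeInterval

section Integrals

variable {n : ℕ}

instance : IsFiniteMeasure (sphMeasure n) := by
  unfold sphMeasure; infer_instance

instance : (sphMeasure n).IsOpenPosMeasure := by
  unfold sphMeasure; infer_instance

theorem integrable_sph {f : Sph n → ℝ} (hf : Continuous f) : Integrable f (sphMeasure n) :=
  hf.integrable_of_hasCompactSupport (HasCompactSupport.of_compactSpace f)

theorem integral_sph_pos {f : Sph n → ℝ} (hf : Continuous f) (h0 : ∀ x, 0 < f x) (x : Sph n) :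
    0 < ∫ x, f x ∂(sphMeasure n) :=
  hf.integral_pos_of_hasCompactSupport_nonneg_nonzero (HasCompactSupport.of_compactSpace f)
    (fun x => (h0 x).le) (h0 x).ne'

theorem continuousOn_integral_sph {I : Set ℝ} (hI : IsLocallyClosed I) {f : ℝ → Sph n → ℝ}
    (hf : ContinuousOn (fun q : ℝ × Sph n => f q.1 q.2) (I ×ˢ Set.univ)) :
    ContinuousOn (fun τ => ∫ x, f τ x ∂(sphMeasure n)) I := by
  rw [continuousOn_iff_continuous_domRestrict]
  have := hI.locallyCompactSpace
  have h1 : Continuous (Function.uncurry fun (τ : I) x => f τ x) :=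
    hf.comp_continuous (by fun_prop : Continuous fun q : I × Sph n => ((q.1 : ℝ), q.2))
      fun q => ⟨q.1.2, Set.mem_univ _⟩
  have h2 := continuous_parametric_integral_of_continuous (μ := sphMeasure n) h1 isCompact_univ
  simp only [Measure.restrict_univ] at h2
  exact h2

theorem hasDerivAt_integral_sph {I : Set ℝ} {f f' : ℝ → Sph n → ℝ}
    (hf : ContinuousOn (fun q : ℝ × Sph n => f q.1 q.2) (I ×ˢ Set.univ))
    (hf' : ContinuousOn (fun q : ℝ × Sph n => f' q.1 q.2) (I ×ˢ Set.univ))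
    (hd : ∀ τ ∈ interior I, ∀ x, HasDerivAt (fun s => f s x) (f' τ x) τ) {τ : ℝ}
    (hτ : τ ∈ interior I) :
    HasDerivAt (fun τ => ∫ x, f τ x ∂(sphMeasure n)) (∫ x, f' τ x ∂(sphMeasure n)) τ := by
  obtain ⟨r, hr, hsub⟩ := Metric.nhds_basis_closedBall.mem_iff.mp (isOpen_interior.mem_nhds hτ)
  have hslice : ∀ {g : ℝ → Sph n → ℝ} {s : ℝ}, s ∈ I →
      ContinuousOn (fun q : ℝ × Sph n => g q.1 q.2) (I ×ˢ Set.univ) → Continuous (g s) :=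
    fun hs hg => hg.comp_continuous (f := fun x => (_, x)) (by fun_prop) fun x => ⟨hs, Set.mem_univ _⟩
  have hc : IsCompact (Metric.closedBall τ r ×ˢ (Set.univ : Set (Sph n))) :=
    (isCompact_closedBall τ r).prod isCompact_univ
  obtain ⟨M, hM⟩ := hc.exists_bound_of_continuousOn
    (hf'.mono (Set.prod_mono (hsub.trans interior_subset) subset_rfl))
  refine (hasDerivAt_integral_of_dominated_loc_of_deriv_le (bound := fun _ => M)
    (Metric.closedBall_mem_nhds τ hr) ?_ (integrable_sph (hslice (interior_subset hτ) hf))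
    (hslice (interior_subset hτ) hf').aestronglyMeasurable
    (.of_forall fun x s hs => hM (s, x) ⟨hs, Set.mem_univ _⟩) (integrable_const M)
    (.of_forall fun x s hs => hd s (hsub hs) x)).2
  filter_upwards [isOpen_interior.mem_nhds hτ] with s hs
  exact (hslice (interior_subset hs) hf).aestronglyMeasurable

end Integrals

/-! ### The flow of support functions -/

section Solution

variable {n k : ℕ} {p : ℝ} {φ h₀ : Sph n → ℝ}

/-- The assumptions on the data of the flow. -/
structure FlowData (k : ℕ) (p : ℝ) (φ h₀ : Sph n → ℝ) : Prop where
  one_le : 1 ≤ k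
  le_dim : k ≤ n
  le_exponent : (k : ℝ) + 1 ≤ p
  smooth : ContMDiff (𝓡 n) 𝓘(ℝ, ℝ) ∞ φ
  pos : ∀ x, 0 < φ x
  convex : SphStrictlyConvex fun x => φ x ^ (1 / (p + (k : ℝ) - 1))
  initial : IsConvexSupport h₀

/-- The homogeneous extension of `φ ^ (1 / (p + k - 1))`. -/
noncomputable def weightExt (k : ℕ) (p : ℝ) (φ : Sph n → ℝ) : Amb n → ℝ :=
  homExt fun x => φ x ^ (1 / (p + (k : ℝ) - 1))

/-- The function `φ f ^ (1 - p) σ_k`, extended to be constant along rays. -/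
noncomputable def flowPsi (k : ℕ) (p : ℝ) (φ f : Sph n → ℝ) : Amb n → ℝ :=
  psi k p (n.choose k : ℝ)⁻¹ (weightExt k p φ) (homExt f)

theorem homExt_pos {f : Sph n → ℝ} (hf : ∀ x, 0 < f x) {y : Amb n} (hy : y ≠ 0) :
    0 < homExt f y := by
  rw [homExt_eq f hy]
  exact mul_pos (norm_pos_iff.mpr hy) (hf _)

namespace FlowData

theorem one_le_cast (D : FlowData k p φ h₀) : (1 : ℝ) ≤ k := by exact_mod_cast D.one_le

theorem root_smooth (D : FlowData k p φ h₀) :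
    ContMDiff (𝓡 n) 𝓘(ℝ, ℝ) ∞ fun x => φ x ^ (1 / (p + (k : ℝ) - 1)) := by
  intro x
  have h1 : ContDiffAt ℝ ∞ (fun t : ℝ => t ^ (1 / (p + (k : ℝ) - 1))) (φ x) :=
    Real.contDiffAt_rpow_const_of_ne (D.pos x).ne'
  exact h1.contMDiffAt.comp x (D.smooth x)

end FlowData

end Solution

/-! ### The weighted mean of `h ^ p`, the quantity `η`, and their evolution -/

section Solution

variable {n k : ℕ} {p : ℝ} {φ h₀ : Sph n → ℝ}

/-- Functions on the sphere that arise from jointly smooth extensions are jointly continuous. -/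
theorem continuousOn_sph {I : Set ℝ} {F : ℝ → Amb n → ℝ}
    (hF : ContDiffOn ℝ ∞ (fun q : ℝ × Amb n => F q.1 q.2) (I ×ˢ {0}ᶜ)) :
    ContinuousOn (fun q : ℝ × Sph n => F q.1 q.2) (I ×ˢ Set.univ) :=
  hF.continuousOn.comp (f := fun q : ℝ × Sph n => (q.1, (q.2 : Amb n))) (by fun_prop)
    fun q hq => ⟨hq.1, q.2.coe_ne_zero⟩

/-- The mean of `h ^ p` with respect to the weight `1 / φ`. -/
noncomputable def powerMean (p : ℝ) (φ f : Sph n → ℝ) : ℝ :=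
  (∫ x, f x ^ p / φ x ∂(sphMeasure n)) / ∫ x, 1 / φ x ∂(sphMeasure n)

namespace FlowData

theorem choose_pos (D : FlowData k p φ h₀) : (0 : ℝ) < (n.choose k : ℝ)⁻¹ :=
  inv_pos.mpr (by exact_mod_cast Nat.choose_pos D.le_dim)

theorem weightExt_smooth (D : FlowData k p φ h₀) :
    ContDiffOn ℝ ∞ (weightExt k p φ) {0}ᶜ := homExt_smooth D.root_smooth

theorem weightExt_pos (D : FlowData k p φ h₀) {y : Amb n} (hy : y ≠ 0) : 0 < weightExt k p φ y :=
  homExt_pos (fun x => Real.rpow_pos_of_pos (D.pos x) _) hy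

theorem weightExt_rpow (D : FlowData k p φ h₀) (x : Sph n) :
    weightExt k p φ x ^ (p + k - 1) = φ x := by
  have h1 : p + k - 1 ≠ 0 := by linarith [D.one_le_cast, D.le_exponent]
  rw [weightExt, homExt_coe, ← Real.rpow_mul (D.pos x).le, one_div_mul_cancel h1, Real.rpow_one]

theorem flowPsi_coe (D : FlowData k p φ h₀) {f : Sph n → ℝ} (hf : IsConvexSupport f) (x : Sph n) :
    flowPsi k p φ f x = φ x * f x ^ (1 - p) * sigmaK k f x := by
  rw [flowPsi, psi, speed, D.weightExt_rpow, homExt_coe, sigmaK_eq_sig hf.smooth hf.convex]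
  ring

theorem mul_flowPsi (D : FlowData k p φ h₀) {f : Sph n → ℝ} (hf : IsConvexSupport f) (x : Sph n) :
    f x * flowPsi k p φ f x = φ x * f x ^ (2 - p) * sigmaK k f x := by
  rw [D.flowPsi_coe hf, show (2 : ℝ) - p = 1 - p + 1 by ring, Real.rpow_add (hf.pos x),
    Real.rpow_one]
  ring

theorem flowPsi_posHom (D : FlowData k p φ h₀) {f : Sph n → ℝ} (hf : IsConvexSupport f) :
    PosHom 0 (flowPsi k p φ f) :=
  speed_posHom (homExt_smooth hf.smooth) (fun _ hy => D.weightExt_pos hy)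
    (fun _ hy => homExt_pos hf.pos hy) (homExt_posHom _) (homExt_posHom _) _ (by ring)

theorem flowPsi_pos (D : FlowData k p φ h₀) {f : Sph n → ℝ} (hf : IsConvexSupport f) (x : Sph n) :
    0 < flowPsi k p φ f x := by
  obtain ⟨e, l, o, he⟩ := exists_isEigenframe (homExt_smooth hf.smooth) (homExt_posHom f) x
    (homExt_convex hf.smooth hf.convex x)
  rw [flowPsi, psi, speed, he.sig_eq (homExt_smooth hf.smooth)]
  exact mul_pos (mul_pos D.choose_pos (mul_pos (Real.rpow_pos_of_pos
    (D.weightExt_pos x.coe_ne_zero) _) (Real.rpow_pos_of_pos (homExt_pos hf.pos x.coe_ne_zero) _)))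
    (he.esymmFn_pos D.le_dim)

theorem flowPsi_continuous (D : FlowData k p φ h₀) {f : Sph n → ℝ} (hf : IsConvexSupport f) :
    Continuous fun x : Sph n => flowPsi k p φ f x :=
  (speed_smooth D.weightExt_smooth (homExt_smooth hf.smooth) (fun _ hy => D.weightExt_pos hy)
    (fun _ hy => homExt_pos hf.pos hy) _ _ _ _).continuousOn.comp_continuous
    continuous_subtype_val fun x => x.coe_ne_zero

theorem weight_continuous (D : FlowData k p φ h₀) : Continuous fun x => 1 / φ x :=
  continuous_const.div D.smooth.continuous fun x => (D.pos x).ne'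

theorem weight_pos (D : FlowData k p φ h₀) (x : Sph n) :
    0 < ∫ x, 1 / φ x ∂(sphMeasure n) :=
  integral_sph_pos D.weight_continuous (fun x => one_div_pos.mpr (D.pos x)) x

theorem rpow_weight_continuous (D : FlowData k p φ h₀) {f : Sph n → ℝ}
    (hf : IsConvexSupport f) : Continuous fun x => f x ^ p / φ x :=
  (hf.smooth.continuous.rpow_const fun x => Or.inl (hf.pos x).ne').div D.smooth.continuous
    fun x => (D.pos x).ne'

theorem powerMean_pos (D : FlowData k p φ h₀) {f : Sph n → ℝ}
    (hf : IsConvexSupport f) (x : Sph n) : 0 < powerMean p φ f :=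
  div_pos (integral_sph_pos (D.rpow_weight_continuous hf)
    (fun x => div_pos (Real.rpow_pos_of_pos (hf.pos x) _) (D.pos x)) x) (D.weight_pos x)

theorem powerMean_le (D : FlowData k p φ h₀) {f : Sph n → ℝ}
    (hf : IsConvexSupport f) {R : ℝ} (hR : ∀ x, f x ≤ R) (x : Sph n) : powerMean p φ f ≤ R ^ p := by
  rw [powerMean, div_le_iff₀ (D.weight_pos x), ← integral_const_mul]
  refine integral_mono (integrable_sph (D.rpow_weight_continuous hf))
    ((integrable_sph D.weight_continuous).const_mul _) fun y => ?_
  have hp : 0 ≤ p := by linarith [D.one_le_cast, D.le_exponent]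
  change f y ^ p / φ y ≤ R ^ p * (1 / φ y)
  rw [mul_one_div]
  exact div_le_div_of_nonneg_right (Real.rpow_le_rpow (hf.pos y).le (hR y) hp) (D.pos y).le

theorem le_powerMean (D : FlowData k p φ h₀) {f : Sph n → ℝ}
    (hf : IsConvexSupport f) {r : ℝ} (hr0 : 0 ≤ r) (hr : ∀ x, r ≤ f x) (x : Sph n) :
    r ^ p ≤ powerMean p φ f := by
  rw [powerMean, le_div_iff₀ (D.weight_pos x), ← integral_const_mul]
  refine integral_mono ((integrable_sph D.weight_continuous).const_mul _)
    (integrable_sph (D.rpow_weight_continuous hf)) fun y => ?_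
  have hp : 0 ≤ p := by linarith [D.one_le_cast, D.le_exponent]
  change r ^ p * (1 / φ y) ≤ f y ^ p / φ y
  rw [mul_one_div]
  exact div_le_div_of_nonneg_right (Real.rpow_le_rpow hr0 (hr y) hp) (D.pos y).le

/-- `η` as a weighted integral of `flowPsi`. -/
theorem eta_eq (D : FlowData k p φ h₀) {f : Sph n → ℝ}
    (hf : IsConvexSupport f) : etaFlow k φ f =
      (∫ x, f x ^ p / φ x * flowPsi k p φ f x ∂(sphMeasure n)) / ∫ x, 1 / φ x ∂(sphMeasure n) := by
  rw [etaFlow]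
  congr 2
  funext x
  have h1 : f x ^ p * f x ^ (1 - p) = f x := by
    rw [← Real.rpow_add (hf.pos x), add_sub_cancel, Real.rpow_one]
  rw [D.flowPsi_coe hf]
  have := (D.pos x).ne'
  field_simp
  linear_combination -sigmaK k f x * h1

/-- The quotient of `η` by the power mean is the average of `Ψ` with weight `f ^ p / φ`, hence lies
between the extrema of `Ψ`. -/
theorem eta_le (D : FlowData k p φ h₀) {f : Sph n → ℝ}
    (hf : IsConvexSupport f) {M : ℝ} (hM : ∀ x : Sph n, flowPsi k p φ f x ≤ M) (x : Sph n) :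
    etaFlow k φ f ≤ M * powerMean p φ f := by
  rw [D.eta_eq hf, powerMean, ← mul_div_assoc, ← integral_const_mul]
  refine div_le_div_of_nonneg_right (integral_mono (integrable_sph
    ((D.rpow_weight_continuous hf).mul (D.flowPsi_continuous hf)))
    ((integrable_sph (D.rpow_weight_continuous hf)).const_mul _) fun y => ?_) (D.weight_pos x).le
  change f y ^ p / φ y * flowPsi k p φ f y ≤ M * (f y ^ p / φ y)
  rw [mul_comm]
  exact mul_le_mul_of_nonneg_right (hM y)
    (div_pos (Real.rpow_pos_of_pos (hf.pos y) _) (D.pos y)).le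

theorem le_eta (D : FlowData k p φ h₀) {f : Sph n → ℝ}
    (hf : IsConvexSupport f) {M : ℝ} (hM : ∀ x : Sph n, M ≤ flowPsi k p φ f x) (x : Sph n) :
    M * powerMean p φ f ≤ etaFlow k φ f := by
  rw [D.eta_eq hf, powerMean, ← mul_div_assoc, ← integral_const_mul]
  refine div_le_div_of_nonneg_right (integral_mono
    ((integrable_sph (D.rpow_weight_continuous hf)).const_mul _) (integrable_sph
    ((D.rpow_weight_continuous hf).mul (D.flowPsi_continuous hf))) fun y => ?_) (D.weight_pos x).le
  change M * (f y ^ p / φ y) ≤ f y ^ p / φ y * flowPsi k p φ f y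
  rw [mul_comm]
  exact mul_le_mul_of_nonneg_left (hM y)
    (div_pos (Real.rpow_pos_of_pos (hf.pos y) _) (D.pos y)).le

theorem eta_pos (D : FlowData k p φ h₀) {f : Sph n → ℝ}
    (hf : IsConvexSupport f) (x : Sph n) : 0 < etaFlow k φ f := by
  rw [D.eta_eq hf]
  exact div_pos (integral_sph_pos ((D.rpow_weight_continuous hf).mul (D.flowPsi_continuous hf))
    (fun y => mul_pos (div_pos (Real.rpow_pos_of_pos (hf.pos y) _) (D.pos y)) (D.flowPsi_pos hf y)) x)
    (D.weight_pos x)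

end FlowData

namespace IsNormalizedFlow

variable {T : EReal} {h : ℝ → Sph n → ℝ}

theorem homFlow (hh : IsNormalizedFlow k p φ h₀ T h) (D : FlowData k p φ h₀) {τ₀ : ℝ}
    (hτ₀ : τ₀ ∈ timeInterval T) :
    HomFlow k p (n.choose k : ℝ)⁻¹ (weightExt k p φ) (timeInterval T) (fun τ => homExt (h τ))
      (fun τ => etaFlow k φ (h τ)) where
  uniq := uniqueDiffOn_timeInterval hτ₀
  smoothU := D.weightExt_smooth
  homU := homExt_posHom _
  posU _ hy := D.weightExt_pos hy
  smooth := homExt_smooth_joint hh.smooth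
  hom _ _ := homExt_posHom _
  pos τ hτ _ hy := homExt_pos (hh.support τ hτ).pos hy
  conv τ hτ := homExt_convex (hh.support τ hτ).smooth (hh.support τ hτ).convex
  pde τ hτ y hy := by
    have hτI := interior_subset hτ
    have hs := hh.support τ hτI
    have h1 := ((hh.evolution τ hτI (toSph y)).hasDerivAt (mem_interior_iff_mem_nhds.mp hτ)).const_mul
      ‖y‖
    have h2 := D.flowPsi_posHom hs ‖y‖⁻¹ (inv_pos.mpr (norm_pos_iff.mpr hy)) y hy
    rw [← coe_toSph hy, zpow_zero, one_mul] at h2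
    have h3 : speed (n.choose k : ℝ)⁻¹ (p + k - 1) (1 - p) k (weightExt k p φ) (homExt (h τ)) y =
        flowPsi k p φ (h τ) (toSph y) := h2.symm
    rw [h3]
    refine (h1.congr_deriv ?_).congr_of_eventuallyEq (.of_forall fun s => homExt_eq (h s) hy)
    rw [← D.mul_flowPsi hs, homExt_eq _ hy]
    ring

theorem continuousOn_support (hh : IsNormalizedFlow k p φ h₀ T h) :
    ContinuousOn (fun q : ℝ × Sph n => h q.1 q.2) (timeInterval T ×ˢ Set.univ) := by
  have h1 := continuousOn_sph (F := fun τ => homExt (h τ)) (homExt_smooth_joint hh.smooth)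
  simpa only [homExt_coe] using h1

theorem continuousOn_flowPsi (hh : IsNormalizedFlow k p φ h₀ T h) (D : FlowData k p φ h₀) :
    ContinuousOn (fun q : ℝ × Sph n => flowPsi k p φ (h q.1) q.2)
      (timeInterval T ×ˢ Set.univ) := by
  rcases (timeInterval T).eq_empty_or_nonempty with h0 | ⟨τ₀, hτ₀⟩
  · rw [h0, Set.empty_prod]; exact continuousOn_empty _
  have H := hh.homFlow D hτ₀
  have h1 : ContDiffOn ℝ ∞ (fun q : ℝ × Amb n => sig k (homExt (h q.1)) q.2)
      (timeInterval T ×ˢ {0}ᶜ) :=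
    contDiffOn_minorSum k fun i j => pd_smooth_joint H.uniq
      (F := fun τ => pd (EuclideanSpace.basisFun (Fin (n + 1)) ℝ j) (homExt (h τ)))
      (pd_smooth_joint H.uniq (F := fun τ => homExt (h τ)) H.smooth _) _
  refine continuousOn_sph (F := fun τ => flowPsi k p φ (h τ)) ?_
  refine (contDiffOn_const.mul (ContDiffOn.mul ?_ ?_)).mul h1
  · exact (D.weightExt_smooth.rpow_const_of_ne fun y hy => (D.weightExt_pos hy).ne').comp
      contDiffOn_snd fun q hq => hq.2
  · exact H.smooth.rpow_const_of_ne fun q hq => (H.pos q.1 hq.1 q.2 hq.2).ne'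

theorem hasDerivAt_support (hh : IsNormalizedFlow k p φ h₀ T h) (D : FlowData k p φ h₀) {τ : ℝ}
    (hτ : τ ∈ interior (timeInterval T)) (x : Sph n) :
    HasDerivAt (fun s => h s x) (h τ x * (flowPsi k p φ (h τ) x - etaFlow k φ (h τ))) τ := by
  have h1 := (hh.homFlow D (interior_subset hτ)).pde τ hτ x x.coe_ne_zero
  simp only [homExt_coe] at h1
  exact h1

theorem continuousOn_rpow_weight (hh : IsNormalizedFlow k p φ h₀ T h) (D : FlowData k p φ h₀) :
    ContinuousOn (fun q : ℝ × Sph n => h q.1 q.2 ^ p / φ q.2) (timeInterval T ×ˢ Set.univ) :=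
  (hh.continuousOn_support.rpow_const fun q hq => Or.inl ((hh.support q.1 hq.1).pos q.2).ne').div
    (D.smooth.continuous.comp continuous_snd).continuousOn fun q _ => (D.pos q.2).ne'

theorem continuousOn_powerMean (hh : IsNormalizedFlow k p φ h₀ T h) (D : FlowData k p φ h₀) :
    ContinuousOn (fun τ => powerMean p φ (h τ)) (timeInterval T) :=
  (continuousOn_integral_sph (isLocallyClosed_timeInterval T)
    (f := fun τ x => h τ x ^ p / φ x) (hh.continuousOn_rpow_weight D)).div_const _

theorem continuousOn_eta (hh : IsNormalizedFlow k p φ h₀ T h) (D : FlowData k p φ h₀) :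
    ContinuousOn (fun τ => etaFlow k φ (h τ)) (timeInterval T) := by
  have h1 := (continuousOn_integral_sph (isLocallyClosed_timeInterval T)
    (f := fun τ x => h τ x ^ p / φ x * flowPsi k p φ (h τ) x)
    ((hh.continuousOn_rpow_weight D).mul (hh.continuousOn_flowPsi D))).div_const
      (∫ x, 1 / φ x ∂(sphMeasure n))
  exact h1.congr fun τ hτ => D.eta_eq (hh.support τ hτ)

/-- Pointwise `h ^ p` changes at the rate `p h ^ p (Ψ - η)`. Integrated against `1 / φ`, the part
with `Ψ` is `η` times the total weight, by the choice of `η`. -/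
theorem powerMean_hasDerivAt (hh : IsNormalizedFlow k p φ h₀ T h) (D : FlowData k p φ h₀) {τ : ℝ}
    (hτ : τ ∈ interior (timeInterval T)) (x : Sph n) :
    HasDerivAt (fun s => powerMean p φ (h s))
      (p * etaFlow k φ (h τ) * (1 - powerMean p φ (h τ))) τ := by
  have hs := hh.support τ (interior_subset hτ)
  have h1 := (hasDerivAt_integral_sph (f := fun τ x => h τ x ^ p / φ x)
    (f' := fun τ x => p * (h τ x ^ p / φ x * flowPsi k p φ (h τ) x -
      h τ x ^ p / φ x * etaFlow k φ (h τ)))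
    (hh.continuousOn_rpow_weight D) (continuousOn_const.mul
      (((hh.continuousOn_rpow_weight D).mul (hh.continuousOn_flowPsi D)).sub
      ((hh.continuousOn_rpow_weight D).mul ((hh.continuousOn_eta D).comp continuousOn_fst
        fun q hq => hq.1))))
    (fun s hs x => by
      have hp := (hh.support s (interior_subset hs)).pos x
      refine (((hh.hasDerivAt_support D hs x).rpow_const (p := p)
        (Or.inl hp.ne')).div_const (φ x)).congr_deriv ?_
      rw [Real.rpow_sub_one hp.ne']
      field_simp) hτ).div_const (∫ x, 1 / φ x ∂(sphMeasure n))
  refine h1.congr_deriv ?_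
  have hw := (D.weight_pos x).ne'
  have i1 := integrable_sph (D.rpow_weight_continuous hs)
  have i2 : Integrable (fun x : Sph n => h τ x ^ p / φ x * flowPsi k p φ (h τ) x) (sphMeasure n) :=
    integrable_sph ((D.rpow_weight_continuous hs).mul (D.flowPsi_continuous hs))
  have h2 : ∫ x, h τ x ^ p / φ x * flowPsi k p φ (h τ) x ∂(sphMeasure n) =
      etaFlow k φ (h τ) * ∫ x, 1 / φ x ∂(sphMeasure n) := by
    rw [D.eta_eq hs, div_mul_cancel₀ _ hw]
  rw [integral_const_mul, integral_sub i2 (i1.mul_const _), integral_mul_const, h2, powerMean]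
  field_simp

end IsNormalizedFlow

end Solution

theorem IsCompact.exists_bounds_of_pos {X : Type*} [TopologicalSpace X] {K : Set X}
    (hK : IsCompact K) {f : X → ℝ} (hf : ContinuousOn f K) (h0 : ∀ x ∈ K, 0 < f x) :
    ∃ m M, 0 < m ∧ 0 < M ∧ ∀ x ∈ K, m < f x ∧ f x < M := by
  rcases K.eq_empty_or_nonempty with rfl | hne
  · exact ⟨1, 1, one_pos, one_pos, by simp⟩
  obtain ⟨x, hx, hmin⟩ := hK.exists_isMinOn hne hf
  obtain ⟨y, hy, hmax⟩ := hK.exists_isMaxOn hne hf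
  refine ⟨f x / 2, f y + 1, half_pos (h0 x hx), by linarith [h0 y hy], fun z hz => ?_⟩
  have h1 := isMinOn_iff.mp hmin z hz
  have h2 := isMaxOn_iff.mp hmax z hz
  have := h0 x hx
  constructor <;> linarith

/-! ### Uniform bounds for the power mean and for `Ψ` -/

section Solution

variable {n k : ℕ} {p : ℝ} {φ h₀ : Sph n → ℝ}

theorem exists_bounds_of_pos_sph {f : Sph n → ℝ} (hf : Continuous f) (h0 : ∀ x, 0 < f x) :
    ∃ m M, 0 < m ∧ 0 < M ∧ ∀ x, m < f x ∧ f x < M := by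
  obtain ⟨m, M, hm, hM, h⟩ := isCompact_univ.exists_bounds_of_pos hf.continuousOn fun x _ => h0 x
  exact ⟨m, M, hm, hM, fun x => h x (Set.mem_univ x)⟩

theorem nonempty_sph (n : ℕ) : Nonempty (Sph n) :=
  (NormedSpace.sphere_nonempty.mpr zero_le_one).to_subtype

namespace HomFlow

variable {c : ℝ} {U : Amb n → ℝ} {I : Set ℝ} {H : ℝ → Amb n → ℝ} {η : ℝ → ℝ}

/-- The time derivative of `psi` at a spatial maximum. -/
theorem psi_hasDerivAt_max (h : HomFlow k p c U I H η) (hc : 0 < c) {τ : ℝ} (hτ : τ ∈ interior I)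
    {x : Sph n} (hmax : ∀ y : Sph n, psi k p c U (H τ) y ≤ psi k p c U (H τ) x) :
    ∃ d ≤ (1 - p + k) * psi k p c U (H τ) x * (psi k p c U (H τ) x - η τ),
      HasDerivAt (fun s => psi k p c U (H s) x) d τ := by
  have hτI := interior_subset hτ
  obtain ⟨e, l, o, he⟩ := h.exists_frame hτI x
  refine ⟨_, ?_, h.psi_hasDerivAt hτ he⟩
  have h1 : ∀ i, esymmD k l i * (2 * pd (e i) (H τ) x * pd (e i) (psi k p c U (H τ)) x +
      H τ x * pd (e i) (pd (e i) (psi k p c U (H τ))) x) ≤ 0 := fun i => by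
    obtain ⟨h2, h3⟩ := PosHom.max_conditions (h.psi_smooth hτI) (h.psi_posHom hτI) hmax (e i)
    rw [h2, mul_zero, zero_add]
    exact mul_nonpos_of_nonneg_of_nonpos (esymmD_nonneg k he.nonneg i)
      (mul_nonpos_of_nonneg_of_nonpos (h.pos τ hτI x x.coe_ne_zero).le h3)
  have h2 : 0 < c * (U x ^ (p + k - 1) * H τ x ^ (1 - p)) :=
    mul_pos hc (mul_pos (Real.rpow_pos_of_pos (h.posU x x.coe_ne_zero) _)
      (Real.rpow_pos_of_pos (h.pos τ hτI x x.coe_ne_zero) _))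
  have h3 := mul_nonpos_of_nonneg_of_nonpos h2.le (Finset.sum_nonpos fun i (_ : i ∈ univ) => h1 i)
  linarith

/-- The time derivative of `psi` at a spatial minimum. -/
theorem psi_hasDerivAt_min (h : HomFlow k p c U I H η) (hc : 0 < c) {τ : ℝ} (hτ : τ ∈ interior I)
    {x : Sph n} (hmin : ∀ y : Sph n, psi k p c U (H τ) x ≤ psi k p c U (H τ) y) :
    ∃ d, (1 - p + k) * psi k p c U (H τ) x * (psi k p c U (H τ) x - η τ) ≤ d ∧
      HasDerivAt (fun s => psi k p c U (H s) x) d τ := by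
  have hτI := interior_subset hτ
  obtain ⟨e, l, o, he⟩ := h.exists_frame hτI x
  refine ⟨_, ?_, h.psi_hasDerivAt hτ he⟩
  have h1 : ∀ i, 0 ≤ esymmD k l i * (2 * pd (e i) (H τ) x * pd (e i) (psi k p c U (H τ)) x +
      H τ x * pd (e i) (pd (e i) (psi k p c U (H τ))) x) := fun i => by
    obtain ⟨h2, h3⟩ := PosHom.min_conditions (h.psi_smooth hτI) (h.psi_posHom hτI) hmin (e i)
    rw [h2, mul_zero, zero_add]
    exact mul_nonneg (esymmD_nonneg k he.nonneg i)
      (mul_nonneg (h.pos τ hτI x x.coe_ne_zero).le h3)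
  have h2 : 0 < c * (U x ^ (p + k - 1) * H τ x ^ (1 - p)) :=
    mul_pos hc (mul_pos (Real.rpow_pos_of_pos (h.posU x x.coe_ne_zero) _)
      (Real.rpow_pos_of_pos (h.pos τ hτI x x.coe_ne_zero) _))
  have h3 := mul_nonneg h2.le (Finset.sum_nonneg fun i (_ : i ∈ univ) => h1 i)
  linarith

end HomFlow

namespace FlowData

theorem exponent_pos (D : FlowData k p φ h₀) : 0 < p := by
  linarith [D.one_le_cast, D.le_exponent]

/-- Since `η > 0`, the mean drifts towards `1`, so a level below `1` cannot be reached from above,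
nor a level above `1` from below. Space plays no role, so the touching lemma is applied over a
one-point space. -/
theorem powerMean_bounds (D : FlowData k p φ h₀) : ∃ A B, 0 < A ∧ 0 < B ∧
    ∀ (T : EReal) (h : ℝ → Sph n → ℝ), IsNormalizedFlow k p φ h₀ T h → ∀ τ ∈ timeInterval T,
      A < powerMean p φ (h τ) ∧ powerMean p φ (h τ) < B := by
  obtain ⟨x⟩ := nonempty_sph n
  have h0 := D.powerMean_pos D.initial x
  set a := powerMean p φ h₀ with ha
  refine ⟨min 1 a / 2, max 1 a + 1, by positivity, by positivity, fun T h hh => ?_⟩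
  have hm : min 1 a / 2 < min 1 a := half_lt_self (by positivity)
  have hp := D.exponent_pos
  have hlow := pos_of_first_touch (X := Unit) isCompact_univ
    (fun τ (hτ : τ ∈ timeInterval T) => Icc_subset_timeInterval hτ)
    (f := fun τ _ => powerMean p φ (h τ) - min 1 a / 2)
    (((hh.continuousOn_powerMean D).comp continuousOn_fst fun q hq => hq.1).sub continuousOn_const)
    (fun _ _ => by
      rw [hh.initial]
      linarith [min_le_right 1 a])
    (fun τ hτ hτ0 _ _ hzero _ => ⟨(), Set.mem_univ _, hzero, _, ?_,
      (hh.powerMean_hasDerivAt D (mem_interior_timeInterval hτ hτ0) x).sub_const _⟩)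
  · have hupp := pos_of_first_touch (X := Unit) isCompact_univ
      (fun τ (hτ : τ ∈ timeInterval T) => Icc_subset_timeInterval hτ)
      (f := fun τ _ => max 1 a + 1 - powerMean p φ (h τ))
      (continuousOn_const.sub ((hh.continuousOn_powerMean D).comp continuousOn_fst
        fun q hq => hq.1))
      (fun _ _ => by
        rw [hh.initial]
        linarith [le_max_right 1 a])
      (fun τ hτ hτ0 _ _ hzero _ => ⟨(), Set.mem_univ _, hzero, _, ?_,
        (hh.powerMean_hasDerivAt D (mem_interior_timeInterval hτ hτ0) x).const_sub _⟩)
    · exact fun τ hτ => ⟨by linarith [hlow τ hτ () (Set.mem_univ _)],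
        by linarith [hupp τ hτ () (Set.mem_univ _)]⟩
    · have h1 := D.eta_pos (hh.support τ hτ) x
      have h2 : 0 < powerMean p φ (h τ) - 1 := by linarith [le_max_left 1 a]
      have h3 := mul_pos (mul_pos hp h1) h2
      linarith
  · have h1 := D.eta_pos (hh.support τ hτ) x
    have h2 : 0 < 1 - powerMean p φ (h τ) := by linarith [min_le_left 1 a]
    exact mul_pos (mul_pos hp h1) h2

/-- The function `φ h ^ (1 - p) σ_k`, normalized by a power of the mean of `h ^ p`. -/
noncomputable def _root_.normPsi (k : ℕ) (p : ℝ) (φ f : Sph n → ℝ) (x : Sph n) : ℝ :=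
  flowPsi k p φ f x * powerMean p φ f ^ ((p - k - 1) / p)

theorem normPsi_pos (D : FlowData k p φ h₀) {f : Sph n → ℝ} (hf : IsConvexSupport f) (x : Sph n) :
    0 < normPsi k p φ f x :=
  mul_pos (D.flowPsi_pos hf x) (Real.rpow_pos_of_pos (D.powerMean_pos hf x) _)

theorem _root_.IsNormalizedFlow.continuousOn_normPsi {T : EReal} {h : ℝ → Sph n → ℝ}
    (hh : IsNormalizedFlow k p φ h₀ T h) (D : FlowData k p φ h₀) :
    ContinuousOn (fun q : ℝ × Sph n => normPsi k p φ (h q.1) q.2)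
      (timeInterval T ×ˢ Set.univ) :=
  (hh.continuousOn_flowPsi D).mul (((hh.continuousOn_powerMean D).comp continuousOn_fst
    fun _ hq => hq.1).rpow_const fun q hq =>
      Or.inl (D.powerMean_pos (hh.support q.1 hq.1) q.2).ne')

/-- The exponent `(p - k - 1) / p` makes the bare `η` cancel against that in the evolution of `Ψ` at
an extremum, leaving `(p - k - 1) Ψ (η / m - Ψ)`. -/
theorem _root_.IsNormalizedFlow.normPsi_hasDerivAt {T : EReal} {h : ℝ → Sph n → ℝ}
    (hh : IsNormalizedFlow k p φ h₀ T h) (D : FlowData k p φ h₀) {τ d : ℝ}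
    (hτ : τ ∈ interior (timeInterval T)) {x : Sph n}
    (hd : HasDerivAt (fun s => flowPsi k p φ (h s) x) d τ) :
    HasDerivAt (fun s => normPsi k p φ (h s) x)
      (powerMean p φ (h τ) ^ ((p - k - 1) / p) * (d + (p - k - 1) * flowPsi k p φ (h τ) x *
        (etaFlow k φ (h τ) / powerMean p φ (h τ) - etaFlow k φ (h τ)))) τ := by
  have ha := D.powerMean_pos (hh.support τ (interior_subset hτ)) x
  have h1 := (hh.powerMean_hasDerivAt D hτ x).rpow_const (p := (p - k - 1) / p) (Or.inl ha.ne')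
  refine (hd.mul h1).congr_deriv ?_
  rw [Real.rpow_sub_one ha.ne']
  have := D.exponent_pos.ne'
  field_simp

/-- At a spatial maximum of `Ψ` the average `η / m` is at most `Ψ`, at a minimum at least `Ψ`, and
`p - k - 1 ≥ 0`; so the extrema of the normalized function move inwards. -/
theorem normPsi_bounds (D : FlowData k p φ h₀) : ∃ A B, 0 < A ∧ 0 < B ∧
    ∀ (T : EReal) (h : ℝ → Sph n → ℝ), IsNormalizedFlow k p φ h₀ T h → ∀ τ ∈ timeInterval T,
      ∀ x, A ≤ normPsi k p φ (h τ) x ∧ normPsi k p φ (h τ) x ≤ B := by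
  obtain ⟨A, B, hA, hB, hAB⟩ := exists_bounds_of_pos_sph (f := normPsi k p φ h₀)
    ((D.flowPsi_continuous D.initial).mul continuous_const) fun x => D.normPsi_pos D.initial x
  refine ⟨A, B, hA, hB, fun T h hh τ hτ x => ?_⟩
  -- The inequalities for the derivatives are not strict; a barrier growing like `ε τ` makes them
  -- strict and is removed at the end by letting `ε` tend to zero at fixed time.
  have hεcont : ∀ ε : ℝ, ContinuousOn (fun q : ℝ × Sph n => ε * q.1)
      (timeInterval T ×ˢ Set.univ) := fun ε => by fun_prop
  have hεder : ∀ ε s : ℝ, HasDerivAt (fun s : ℝ => ε * s) ε s := fun ε s => by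
    simpa using (hasDerivAt_id s).const_mul ε
  have hγ : 0 ≤ p - k - 1 := by linarith [D.le_exponent]
  have hlow : ∀ ε > 0, 0 < normPsi k p φ (h τ) x + (ε * τ - A) := fun ε hε => by
    refine pos_of_first_touch (X := Sph n) isCompact_univ
      (fun τ (hτ : τ ∈ timeInterval T) => Icc_subset_timeInterval hτ)
      (f := fun τ x => normPsi k p φ (h τ) x + (ε * τ - A))
      ((hh.continuousOn_normPsi D).add ((hεcont ε).sub continuousOn_const))
      (fun y _ => by
        rw [hh.initial]
        linarith [(hAB y).1])
      (fun τ hτ hτ0 y _ hzero hnn => ⟨y, Set.mem_univ _, hzero, ?_⟩) τ hτ x (Set.mem_univ _)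
    have hi := mem_interior_timeInterval hτ hτ0
    have hs := hh.support τ hτ
    have ha := D.powerMean_pos hs y
    have hag := Real.rpow_pos_of_pos ha ((p - k - 1) / p)
    have hmin : ∀ z : Sph n, flowPsi k p φ (h τ) y ≤ flowPsi k p φ (h τ) z := fun z => by
      have h1 := hnn z (Set.mem_univ _)
      have h2 : normPsi k p φ (h τ) y ≤ normPsi k p φ (h τ) z := by linarith
      exact le_of_mul_le_mul_right h2 hag
    obtain ⟨d, hd1, hd2⟩ := (hh.homFlow D hτ).psi_hasDerivAt_min D.choose_pos hi hmin
    refine ⟨_, ?_, (hh.normPsi_hasDerivAt D hi hd2).add ((hεder ε τ).sub_const A)⟩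
    have h3 : flowPsi k p φ (h τ) y ≤ etaFlow k φ (h τ) / powerMean p φ (h τ) := by
      rw [le_div_iff₀ ha]
      exact D.le_eta hs hmin y
    have h4 := mul_nonneg (mul_nonneg hγ (D.flowPsi_pos hs y).le) (sub_nonneg.mpr h3)
    have h5 : 0 ≤ d + (p - k - 1) * flowPsi k p φ (h τ) y *
        (etaFlow k φ (h τ) / powerMean p φ (h τ) - etaFlow k φ (h τ)) := by
      change (1 - p + k) * flowPsi k p φ (h τ) y * (flowPsi k p φ (h τ) y - etaFlow k φ (h τ)) ≤ d
        at hd1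
      linarith
    have h6 := mul_nonneg hag.le h5
    linarith
  have hupp : ∀ ε > 0, 0 < B + ε * τ - normPsi k p φ (h τ) x := fun ε hε => by
    refine pos_of_first_touch (X := Sph n) isCompact_univ
      (fun τ (hτ : τ ∈ timeInterval T) => Icc_subset_timeInterval hτ)
      (f := fun τ x => B + ε * τ - normPsi k p φ (h τ) x)
      ((continuousOn_const.add (hεcont ε)).sub (hh.continuousOn_normPsi D))
      (fun y _ => by
        rw [hh.initial]
        linarith [(hAB y).2])
      (fun τ hτ hτ0 y _ hzero hnn => ⟨y, Set.mem_univ _, hzero, ?_⟩) τ hτ x (Set.mem_univ _)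
    have hi := mem_interior_timeInterval hτ hτ0
    have hs := hh.support τ hτ
    have ha := D.powerMean_pos hs y
    have hag := Real.rpow_pos_of_pos ha ((p - k - 1) / p)
    have hmax : ∀ z : Sph n, flowPsi k p φ (h τ) z ≤ flowPsi k p φ (h τ) y := fun z => by
      have h1 := hnn z (Set.mem_univ _)
      have h2 : normPsi k p φ (h τ) z ≤ normPsi k p φ (h τ) y := by linarith
      exact le_of_mul_le_mul_right h2 hag
    obtain ⟨d, hd1, hd2⟩ := (hh.homFlow D hτ).psi_hasDerivAt_max D.choose_pos hi hmax
    refine ⟨_, ?_, ((hεder ε τ).const_add B).sub (hh.normPsi_hasDerivAt D hi hd2)⟩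
    have h3 : etaFlow k φ (h τ) / powerMean p φ (h τ) ≤ flowPsi k p φ (h τ) y := by
      rw [div_le_iff₀ ha]
      exact D.eta_le hs hmax y
    have h4 := mul_nonneg (mul_nonneg hγ (D.flowPsi_pos hs y).le) (sub_nonneg.mpr h3)
    have h5 : 0 ≤ -(d + (p - k - 1) * flowPsi k p φ (h τ) y *
        (etaFlow k φ (h τ) / powerMean p φ (h τ) - etaFlow k φ (h τ))) := by
      change d ≤ (1 - p + k) * flowPsi k p φ (h τ) y * (flowPsi k p φ (h τ) y - etaFlow k φ (h τ))
        at hd1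
      linarith
    have h6 := mul_nonneg hag.le h5
    linarith
  have hτ0 : 0 ≤ τ := hτ.1
  constructor
  · refine le_of_forall_pos_lt_add fun δ hδ => ?_
    have h1 := hlow (δ / (τ + 1)) (by positivity)
    have h2 : δ / (τ + 1) * τ ≤ δ := by
      rw [div_mul_eq_mul_div, div_le_iff₀ (by positivity)]
      nlinarith
    linarith
  · refine le_of_forall_pos_lt_add fun δ hδ => ?_
    have h1 := hupp (δ / (τ + 1)) (by positivity)
    have h2 : δ / (τ + 1) * τ ≤ δ := by
      rw [div_mul_eq_mul_div, div_le_iff₀ (by positivity)]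
      nlinarith
    linarith

theorem flowPsi_bounds (D : FlowData k p φ h₀) : ∃ A B, 0 < A ∧ 0 < B ∧
    ∀ (T : EReal) (h : ℝ → Sph n → ℝ), IsNormalizedFlow k p φ h₀ T h → ∀ τ ∈ timeInterval T,
      ∀ x : Sph n, A ≤ flowPsi k p φ (h τ) x ∧ flowPsi k p φ (h τ) x ≤ B := by
  obtain ⟨a, b, ha, hb, hab⟩ := D.powerMean_bounds
  obtain ⟨A, B, hA, hB, hAB⟩ := D.normPsi_bounds
  have hγ : 0 ≤ (p - k - 1) / p := div_nonneg (by linarith [D.le_exponent]) D.exponent_pos.le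
  have hag := Real.rpow_pos_of_pos ha ((p - k - 1) / p)
  have hbg := Real.rpow_pos_of_pos hb ((p - k - 1) / p)
  refine ⟨A / b ^ ((p - k - 1) / p), B / a ^ ((p - k - 1) / p), by positivity, by positivity,
    fun T h hh τ hτ x => ?_⟩
  obtain ⟨h1, h2⟩ := hab T h hh τ hτ
  obtain ⟨h3, h4⟩ := hAB T h hh τ hτ x
  have h5 := (D.flowPsi_pos (hh.support τ hτ) x).le
  constructor
  · rw [div_le_iff₀ hbg]
    exact h3.trans (mul_le_mul_of_nonneg_left
      (Real.rpow_le_rpow (ha.le.trans h1.le) h2.le hγ) h5)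
  · rw [le_div_iff₀ hag]
    exact le_trans (mul_le_mul_of_nonneg_left (Real.rpow_le_rpow ha.le h1.le hγ) h5) h4

end FlowData

end Solution

/-! ### Gradient bound, Harnack inequality and bounds for the support function -/

section Solution

variable {n k : ℕ} {p : ℝ} {φ h₀ : Sph n → ℝ}

theorem continuous_sph {F : Amb n → ℝ} (hF : ContDiffOn ℝ ∞ F {0}ᶜ) :
    Continuous fun x : Sph n => F x :=
  hF.continuousOn.comp_continuous continuous_subtype_val fun x => x.coe_ne_zero

theorem continuous_norm_gradient_sq {F : Amb n → ℝ} (hF : ContDiffOn ℝ ∞ F {0}ᶜ) :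
    Continuous fun x : Sph n => ‖gradient F x‖ ^ 2 := by
  simp only [norm_gradient_sq (EuclideanSpace.basisFun (Fin (n + 1)) ℝ)]
  exact continuous_finsetSum _ fun j _ => (continuous_sph (pd_smooth hF _)).pow 2

theorem exists_norm_gradient_sq_lt {F : Amb n → ℝ} (hF : ContDiffOn ℝ ∞ F {0}ᶜ) :
    ∃ G, 0 < G ∧ ∀ x : Sph n, ‖gradient F x‖ ^ 2 < G := by
  obtain ⟨G, hG⟩ := isCompact_univ.exists_bound_of_continuousOn
    (continuous_norm_gradient_sq hF).continuousOn
  refine ⟨|G| + 1, by positivity, fun x => ?_⟩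
  have h1 := (le_abs_self _).trans (hG x (Set.mem_univ x))
  linarith [le_abs_self G]

theorem continuousOn_norm_gradient_sq {I : Set ℝ} (hI : UniqueDiffOn ℝ I) {F : ℝ → Amb n → ℝ}
    (hF : ContDiffOn ℝ ∞ (fun q : ℝ × Amb n => F q.1 q.2) (I ×ˢ {0}ᶜ)) :
    ContinuousOn (fun q : ℝ × Sph n => ‖gradient (F q.1) q.2‖ ^ 2) (I ×ˢ Set.univ) := by
  simp only [norm_gradient_sq (EuclideanSpace.basisFun (Fin (n + 1)) ℝ)]
  exact continuousOn_finsetSum _ fun j _ => (continuousOn_sph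
    (F := fun τ => pd (EuclideanSpace.basisFun (Fin (n + 1)) ℝ j) (F τ))
    (pd_smooth_joint hI hF _)).pow 2

/-! ### A Harnack inequality from the gradient bound -/

theorem exp_bound_of_deriv_le {g g' : ℝ → ℝ} {L : ℝ}
    (hg : ∀ t ∈ Set.Icc (0 : ℝ) 1, HasDerivAt g (g' t) t)
    (hle : ∀ t ∈ Set.Icc (0 : ℝ) 1, g' t ≤ L * g t) : g 1 ≤ Real.exp L * g 0 := by
  have hd : ∀ t ∈ Set.Icc (0 : ℝ) 1, HasDerivAt (fun t => Real.exp (-L * t) * g t)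
      (Real.exp (-L * t) * (g' t - L * g t)) t := fun t ht => by
    have h1 : HasDerivAt (fun t : ℝ => Real.exp (-L * t)) (Real.exp (-L * t) * -L) t := by
      simpa using ((hasDerivAt_id t).const_mul (-L)).exp
    exact (h1.mul (hg t ht)).congr_deriv (by ring)
  have hanti : AntitoneOn (fun t => Real.exp (-L * t) * g t) (Set.Icc 0 1) := by
    refine antitoneOn_of_deriv_nonpos (convex_Icc 0 1)
      (fun t ht => (hd t ht).continuousAt.continuousWithinAt)
      (fun t ht => (hd t (interior_subset ht)).differentiableAt.differentiableWithinAt)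
      fun t ht => ?_
    rw [(hd t (interior_subset ht)).deriv]
    exact mul_nonpos_of_nonneg_of_nonpos (Real.exp_pos _).le
      (sub_nonpos.mpr (hle t (interior_subset ht)))
  have h1 := hanti (Set.left_mem_Icc.mpr zero_le_one) (Set.right_mem_Icc.mpr zero_le_one)
    zero_le_one
  simp only [mul_one, mul_zero, Real.exp_zero, one_mul] at h1
  have h2 := mul_le_mul_of_nonneg_left h1 (Real.exp_pos L).le
  rwa [← mul_assoc, ← Real.exp_add, add_neg_cancel, Real.exp_zero, one_mul] at h2

/-- The segment from `y` to `x` keeps distance at least `1 / 2` from the origin and has length at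
most `2`; rescaling to the sphere costs a factor `2`, so the logarithmic derivative of `F` along it
is at most `4 P`. -/
theorem harnack_of_inner_nonneg {F : Amb n → ℝ} (hF : ContDiffOn ℝ ∞ F {0}ᶜ) (hom : PosHom 1 F)
    (hpos : ∀ y, y ≠ 0 → 0 < F y) {P : ℝ} (hP : 0 ≤ P)
    (hgrad : ∀ x : Sph n, ‖gradient F x‖ ≤ P * F x) {x y : Sph n}
    (hxy : 0 ≤ ⟪(x : Amb n), (y : Amb n)⟫) : F x ≤ Real.exp (4 * P) * F y := by
  have hnorm : ∀ t ∈ Set.Icc (0 : ℝ) 1, 1 / 2 ≤ ‖(y : Amb n) + t • ((x : Amb n) - y)‖ := by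
    intro t ht
    have h1 : ‖(y : Amb n) + t • ((x : Amb n) - y)‖ ^ 2 =
        (1 - t) ^ 2 + t ^ 2 + 2 * (t * (1 - t)) * ⟪(x : Amb n), (y : Amb n)⟫ := by
      rw [show (y : Amb n) + t • ((x : Amb n) - y) = (1 - t) • (y : Amb n) + t • (x : Amb n) by
        module, norm_add_sq_real, norm_smul, norm_smul, x.norm_coe, y.norm_coe, inner_smul_left,
        inner_smul_right, real_inner_comm]
      simp only [Real.norm_eq_abs, mul_one, sq_abs, RCLike.conj_to_real]
      ring
    have h2 : 0 ≤ t * (1 - t) := mul_nonneg ht.1 (by linarith [ht.2])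
    have h3 := mul_nonneg h2 hxy
    refine (sq_le_sq₀ (by norm_num) (norm_nonneg _)).mp ?_
    rw [h1]
    nlinarith [sq_nonneg (2 * t - 1)]
  have hne : ∀ t ∈ Set.Icc (0 : ℝ) 1, (y : Amb n) + t • ((x : Amb n) - y) ≠ 0 := fun t ht h0 => by
    have := hnorm t ht
    rw [h0, norm_zero] at this
    norm_num at this
  have h1 := exp_bound_of_deriv_le (L := 4 * P)
    (fun t ht => hasDerivAt_line hF (y : Amb n) ((x : Amb n) - y) (hne t ht)) fun t ht => by
      set z := (y : Amb n) + t • ((x : Amb n) - y) with hz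
      have hz0 := hne t ht
      have hn := hnorm t ht
      have hi : 0 < ‖z‖⁻¹ := inv_pos.mpr (norm_pos_iff.mpr hz0)
      have h2 := hgrad (toSph z)
      rw [coe_toSph hz0, norm_gradient_smul hF hom hi hz0, hom _ hi _ hz0, zpow_one] at h2
      have h3 : ‖z‖⁻¹ ≤ 2 := by
        rw [inv_le_comm₀ (norm_pos_iff.mpr hz0) two_pos]; linarith
      have h4 : ‖(x : Amb n) - y‖ ≤ 2 := (norm_sub_le _ _).trans (by
        rw [x.norm_coe, y.norm_coe]; norm_num)
      have hFz := (hpos z hz0).le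
      have h5 : ‖gradient F z‖ ≤ P * (2 * F z) :=
        h2.trans (mul_le_mul_of_nonneg_left (mul_le_mul_of_nonneg_right h3 hFz) hP)
      rw [← inner_gradient_eq_pd]
      calc _ ≤ ‖gradient F z‖ * ‖(x : Amb n) - y‖ := real_inner_le_norm _ _
        _ ≤ P * (2 * F z) * 2 := mul_le_mul h5 h4 (norm_nonneg _) (by positivity)
        _ = _ := by ring
  simpa using h1

/-- Two steps through an intermediate point making no obtuse angle with either end: the normalized
sum, or for antipodal points any orthogonal direction, which exists because `n ≥ 1`. -/
theorem harnack {F : Amb n → ℝ} (hn : 1 ≤ n) (hF : ContDiffOn ℝ ∞ F {0}ᶜ) (hom : PosHom 1 F)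
    (hpos : ∀ y, y ≠ 0 → 0 < F y) {P : ℝ} (hP : 0 ≤ P)
    (hgrad : ∀ x : Sph n, ‖gradient F x‖ ≤ P * F x) (x y : Sph n) :
    F x ≤ Real.exp (4 * P) * Real.exp (4 * P) * F y := by
  obtain ⟨z, hz1, hz2⟩ : ∃ z : Sph n, 0 ≤ ⟪(x : Amb n), (z : Amb n)⟫ ∧
      0 ≤ ⟪(z : Amb n), (y : Amb n)⟫ := by
    by_cases h0 : (x : Amb n) + y = 0
    · have hfin : Module.finrank ℝ (TSph x) = n := by
        have : Fact (Module.finrank ℝ (Amb n) = n + 1) := ⟨by simp⟩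
        exact Submodule.finrank_orthogonal_span_singleton x.coe_ne_zero
      have : Nontrivial (TSph x) := Module.nontrivial_of_finrank_pos (R := ℝ) (by omega)
      obtain ⟨v, hv⟩ := exists_ne (0 : TSph x)
      have hv0 : (v : Amb n) ≠ 0 := fun h => hv (Subtype.ext h)
      have hxv : ⟪(x : Amb n), (toSph (v : Amb n) : Amb n)⟫ = 0 := by
        rw [coe_toSph hv0, inner_smul_right, inner_coe_tangent, mul_zero]
      refine ⟨toSph v, hxv.ge, ?_⟩
      rw [show (y : Amb n) = -x from eq_neg_of_add_eq_zero_right h0, inner_neg_right,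
        real_inner_comm, hxv, neg_zero]
    · have h1 : -1 ≤ ⟪(x : Amb n), (y : Amb n)⟫ := by
        have := neg_le_of_abs_le (abs_real_inner_le_norm (x : Amb n) y)
        rwa [x.norm_coe, y.norm_coe, mul_one] at this
      have h2 : 0 ≤ ‖(x : Amb n) + y‖⁻¹ := by positivity
      refine ⟨toSph ((x : Amb n) + y), ?_, ?_⟩
      · rw [coe_toSph h0, inner_smul_right, inner_add_right, real_inner_self_eq_norm_sq, x.norm_coe]
        exact mul_nonneg h2 (by linarith)
      · rw [coe_toSph h0, real_inner_smul_left, inner_add_left, real_inner_self_eq_norm_sq,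
          y.norm_coe]
        exact mul_nonneg h2 (by linarith)
  rw [mul_assoc]
  exact (harnack_of_inner_nonneg hF hom hpos hP hgrad hz1).trans
    (mul_le_mul_of_nonneg_left (harnack_of_inner_nonneg hF hom hpos hP hgrad hz2)
      (Real.exp_pos _).le)

namespace FlowData

/-- Bounds for `flowPsi` control `σ_k` by the `k`-th power of the support function. -/
theorem sig_le (D : FlowData k p φ h₀) {A B : ℝ} (hA : 0 < A) (hB : 0 < B) : ∃ M, 0 < M ∧
    ∀ f : Sph n → ℝ, IsConvexSupport f →
      (∀ x : Sph n, A ≤ flowPsi k p φ f x ∧ flowPsi k p φ f x ≤ B) →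
      ∀ x : Sph n, sig k (homExt f) x ≤ (M * f x) ^ k := by
  obtain ⟨a, b, ha, hb, hab⟩ := exists_bounds_of_pos_sph D.smooth.continuous D.pos
  have hc := D.choose_pos
  set c := (n.choose k : ℝ)⁻¹ with hcdef
  set N : ℝ := ((n + 1).choose k : ℝ) with hN
  have hN0 : 0 < N := by
    rw [hN]; exact_mod_cast Nat.choose_pos (D.le_dim.trans n.le_succ)
  set Q := B / (c * a) * (c * b * N / A) with hQ
  have hQ0 : 0 < Q := by positivity
  -- The estimate found below is `σ_k ≤ Q f ^ k`; taking the maximum with `1` gives `Q ≤ M ≤ M ^ k`.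
  refine ⟨max 1 Q, by positivity, fun f hf hpsi x => ?_⟩
  obtain ⟨z, -, hz⟩ := isCompact_univ.exists_isMaxOn
    (@Set.univ_nonempty _ (nonempty_sph n)) hf.smooth.continuous.continuousOn
  have hmax : ∀ y, f y ≤ f z := fun y => isMaxOn_iff.mp hz y (Set.mem_univ _)
  have hF := homExt_smooth hf.smooth
  have hpsieq : ∀ y : Sph n, flowPsi k p φ f y =
      c * (φ y * f y ^ (1 - p)) * sig k (homExt f) y := fun y => by
    rw [flowPsi, psi, speed, D.weightExt_rpow, homExt_coe]
  have hexp : ∀ y, f y ^ (1 - p) * f y ^ k * f y ^ (p - 1 - k) = 1 := fun y => by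
    rw [← Real.rpow_natCast, ← Real.rpow_add (hf.pos y), ← Real.rpow_add (hf.pos y),
      show 1 - p + k + (p - 1 - k) = 0 by ring, Real.rpow_zero]
  have hexp0 : ∀ y, 0 < f y ^ (p - 1 - k) := fun y => Real.rpow_pos_of_pos (hf.pos y) _
  obtain ⟨e, l, o, he⟩ := exists_isEigenframe hF (homExt_posHom f) z
    (homExt_convex hf.smooth hf.convex z)
  have hl : ∀ i, l i ≤ f z := fun i => by
    have := he.le_of_max hF (homExt_posHom f) (fun y hy => homExt_pos hf.pos hy)
      (fun y => by rw [homExt_coe, homExt_coe]; exact hmax y) i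
    rwa [homExt_coe] at this
  have h1 : sig k (homExt f) z ≤ N * f z ^ k := by
    rw [he.sig_eq hF]
    refine (esymmFn_le_pow k he.nonneg hl).trans (le_of_eq ?_)
    rw [Fintype.card_fin, hN]
  -- At the maximum point all radii are at most `f z`, so `A ≤ Ψ` bounds a nonnegative power of the
  -- maximum; for `p = k + 1` that power is `1` and the inequality still holds.
  have h2 : f z ^ (p - 1 - k) ≤ c * b * N / A := by
    rw [le_div_iff₀ hA]
    have h3 : A ≤ c * (b * f z ^ (1 - p)) * (N * f z ^ k) := by
      refine (hpsi z).1.trans ?_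
      rw [hpsieq]
      have h4 := Real.rpow_pos_of_pos (hf.pos z) (1 - p)
      have h5 := (D.pos z).le
      have h6 := (hab z).2.le
      have h7 : 0 ≤ N * f z ^ k := mul_nonneg hN0.le (pow_nonneg (hf.pos z).le k)
      refine mul_le_mul (mul_le_mul_of_nonneg_left (mul_le_mul_of_nonneg_right h6 h4.le) hc.le) h1
        ?_ (by positivity)
      rw [he.sig_eq hF]
      exact esymmFn_nonneg k he.nonneg
    calc f z ^ (p - 1 - k) * A ≤ f z ^ (p - 1 - k) *
          (c * (b * f z ^ (1 - p)) * (N * f z ^ k)) :=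
          mul_le_mul_of_nonneg_left h3 (hexp0 z).le
      _ = c * b * N * (f z ^ (1 - p) * f z ^ k * f z ^ (p - 1 - k)) := by ring
      _ = c * b * N := by rw [hexp, mul_one]
  have h3 : f x ^ (p - 1 - k) ≤ c * b * N / A :=
    (Real.rpow_le_rpow (hf.pos x).le (hmax x) (by linarith [D.le_exponent])).trans h2
  have h4 : sig k (homExt f) x ≤ Q * f x ^ k := by
    have h5 : c * φ x * sig k (homExt f) x ≤ B * (f x ^ (p - 1 - k) * f x ^ k) := by
      have h6 := mul_le_mul_of_nonneg_right (hpsi x).2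
        (mul_nonneg (hexp0 x).le (pow_nonneg (hf.pos x).le k))
      rw [hpsieq] at h6
      refine le_trans (le_of_eq ?_) h6
      linear_combination (-c * φ x * sig k (homExt f) x) * hexp x
    have h7 : B * (f x ^ (p - 1 - k) * f x ^ k) ≤ B * (c * b * N / A * f x ^ k) :=
      mul_le_mul_of_nonneg_left (mul_le_mul_of_nonneg_right h3 (pow_nonneg (hf.pos x).le k)) hB.le
    have h8 : c * a * sig k (homExt f) x ≤ c * φ x * sig k (homExt f) x := by
      refine mul_le_mul_of_nonneg_right (mul_le_mul_of_nonneg_left (hab x).1.le hc.le) ?_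
      obtain ⟨e', l', o', he'⟩ := exists_isEigenframe hF (homExt_posHom f) x
        (homExt_convex hf.smooth hf.convex x)
      rw [he'.sig_eq hF]
      exact esymmFn_nonneg k he'.nonneg
    have h9 := h8.trans (h5.trans h7)
    rw [hQ, div_mul_eq_mul_div, div_mul_eq_mul_div, le_div_iff₀ (mul_pos hc ha)]
    linarith
  refine h4.trans ?_
  rw [mul_pow]
  refine mul_le_mul_of_nonneg_right ?_ (pow_nonneg (hf.pos x).le k)
  exact (le_max_right 1 Q).trans (le_self_pow₀ (le_max_left 1 Q) (by linarith [D.one_le]))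

theorem weightExt_gradient_le (D : FlowData k p φ h₀) : ∃ C, 0 < C ∧
    ∀ x : Sph n, ‖gradient (weightExt k p φ) x‖ ≤ C * weightExt k p φ x := by
  obtain ⟨G, hG, h1⟩ := exists_norm_gradient_sq_lt D.weightExt_smooth
  obtain ⟨m, _, hm, _, h2⟩ := exists_bounds_of_pos_sph (continuous_sph D.weightExt_smooth)
    fun x => D.weightExt_pos x.coe_ne_zero
  refine ⟨(G + 1) / m, by positivity, fun x => ?_⟩
  have h3 := h1 x
  have h4 := (h2 x).1
  have h5 : G + 1 ≤ (G + 1) / m * weightExt k p φ x := by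
    rw [div_mul_eq_mul_div, le_div_iff₀ hm]
    exact mul_le_mul_of_nonneg_left h4.le (by linarith)
  refine le_trans ?_ h5
  nlinarith [sq_nonneg (‖gradient (weightExt k p φ) x‖ - 1)]

/-- The gradient estimate along the flow. -/
theorem gradient_bound (D : FlowData k p φ h₀) : ∃ K, 0 < K ∧
    ∀ (T : EReal) (h : ℝ → Sph n → ℝ), IsNormalizedFlow k p φ h₀ T h → ∀ τ ∈ timeInterval T,
      ∀ x : Sph n, ‖gradient (homExt (h τ)) x‖ ^ 2 < K * h τ x ^ 2 := by
  obtain ⟨A, B, hA, hB, hAB⟩ := D.flowPsi_bounds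
  obtain ⟨M, hM, hsig⟩ := D.sig_le hA hB
  obtain ⟨C, hC, hU⟩ := D.weightExt_gradient_le
  obtain ⟨G, hG, h1⟩ := exists_norm_gradient_sq_lt (homExt_smooth D.initial.smooth)
  obtain ⟨m, _, hm, _, h2⟩ := exists_bounds_of_pos_sph D.initial.smooth.continuous D.initial.pos
  set q := (p + k - 1) * C * M with hq
  have hK : 0 < G / m ^ 2 + (q ^ 2 + 1) := by positivity
  -- The first summand takes care of the initial hypersurface, the second of the requirement `q <
  -- √K` at a touching point.
  refine ⟨G / m ^ 2 + (q ^ 2 + 1), hK, fun T h hh τ hτ x => ?_⟩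
  set K := G / m ^ 2 + (q ^ 2 + 1) with hKdef
  have hqK : q < √K := Real.lt_sqrt_of_sq_lt (by
    have : 0 < G / m ^ 2 := by positivity
    linarith)
  have H := hh.homFlow D hτ
  rw [← sub_pos]
  refine pos_of_first_touch (X := Sph n) isCompact_univ
    (fun τ (hτ : τ ∈ timeInterval T) => Icc_subset_timeInterval hτ)
    (f := fun τ x => K * h τ x ^ 2 - ‖gradient (homExt (h τ)) x‖ ^ 2)
    ((continuousOn_const.mul (hh.continuousOn_support.pow 2)).sub
      (continuousOn_norm_gradient_sq H.uniq (F := fun τ => homExt (h τ)) H.smooth))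
    (fun y _ => ?_) (fun s hs hs0 y _ hzero hnn => ⟨y, Set.mem_univ _, hzero, ?_⟩) τ hτ x
    (Set.mem_univ _)
  · rw [hh.initial]
    have h3 : G ≤ G / m ^ 2 * h₀ y ^ 2 := by
      rw [div_mul_eq_mul_div, le_div_iff₀ (by positivity)]
      exact mul_le_mul_of_nonneg_left (pow_le_pow_left₀ hm.le (h2 y).1.le 2) hG.le
    have h4 := h1 y
    have h5 : 0 ≤ (q ^ 2 + 1) * h₀ y ^ 2 := by positivity
    have h6 : K * h₀ y ^ 2 = G / m ^ 2 * h₀ y ^ 2 + (q ^ 2 + 1) * h₀ y ^ 2 := by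
      rw [hKdef]; ring
    linarith
  · have h3 := H.gradient_touch D.one_le D.le_dim D.le_exponent D.choose_pos
      (mem_interior_timeInterval hs hs0) (x := y) hK hM
      (fun z => by
        have := hnn z (Set.mem_univ _)
        rw [homExt_coe]
        linarith)
      (by rw [homExt_coe]; linarith) (hU y)
      (by
        rw [homExt_coe]
        exact hsig _ (hh.support s hs) (hAB T h hh s hs) y) hqK
    simpa only [homExt_coe] using h3

/-- Uniform two-sided bounds for the support functions. -/
theorem support_bounds (D : FlowData k p φ h₀) : ∃ r R, 0 < r ∧ 0 < R ∧
    ∀ (T : EReal) (h : ℝ → Sph n → ℝ), IsNormalizedFlow k p φ h₀ T h → ∀ τ ∈ timeInterval T,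
      ∀ x : Sph n, r ≤ h τ x ∧ h τ x ≤ R := by
  obtain ⟨a, b, ha, hb, hab⟩ := D.powerMean_bounds
  obtain ⟨K, hK, hgrad⟩ := D.gradient_bound
  set E := Real.exp (4 * √K) * Real.exp (4 * √K) with hE
  have hE0 : 0 < E := by positivity
  have hp := D.exponent_pos
  have har := Real.rpow_pos_of_pos ha p⁻¹
  have hbr := Real.rpow_pos_of_pos hb p⁻¹
  refine ⟨a ^ p⁻¹ / E, E * b ^ p⁻¹, by positivity, by positivity, fun T h hh τ hτ x => ?_⟩
  have hs := hh.support τ hτ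
  have hgr : ∀ y : Sph n, ‖gradient (homExt (h τ)) y‖ ≤ √K * homExt (h τ) y := fun y => by
    refine (sq_le_sq₀ (norm_nonneg _)
      (mul_nonneg (Real.sqrt_nonneg K) (homExt_pos hs.pos y.coe_ne_zero).le)).mp ?_
    rw [mul_pow, Real.sq_sqrt hK.le, homExt_coe]
    exact (hgrad T h hh τ hτ y).le
  have hH : ∀ y z : Sph n, h τ y ≤ E * h τ z := fun y z => by
    have := harnack (D.one_le.trans D.le_dim) (homExt_smooth hs.smooth) (homExt_posHom _)
      (fun y hy => homExt_pos hs.pos hy) (Real.sqrt_nonneg K) hgr y z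
    rwa [homExt_coe, homExt_coe] at this
  obtain ⟨h1, h2⟩ := hab T h hh τ hτ
  -- By Harnack the mean lies between `(h / E) ^ p` and `(E h) ^ p` for the value of `h` at any
  -- point, so bounds for the mean transfer to `h`.
  have h3 := D.powerMean_le hs (fun y => hH y x) x
  have h4 := D.le_powerMean hs (div_nonneg (hs.pos x).le hE0.le) (fun y => by
    rw [div_le_iff₀ hE0, mul_comm]; exact hH x y) x
  constructor
  · rw [div_le_iff₀ hE0, mul_comm, Real.rpow_inv_le_iff_of_pos ha.le
      (mul_nonneg hE0.le (hs.pos x).le) hp]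
    exact h1.le.trans h3
  · rw [← div_le_iff₀' hE0, Real.le_rpow_inv_iff_of_pos (div_nonneg (hs.pos x).le hE0.le) hb.le hp]
    exact h4.trans h2.le

end FlowData

end Solution

/-! ### Bounds for the principal radii and curvatures -/

section Solution

variable {n k : ℕ} {p : ℝ} {φ h₀ : Sph n → ℝ}

/-- The unit tangent bundle of the sphere. -/
def unitTangent (n : ℕ) : Set (Sph n × Amb n) := {q | ⟪(q.1 : Amb n), q.2⟫ = 0 ∧ ‖q.2‖ = 1}

theorem isCompact_unitTangent (n : ℕ) : IsCompact (unitTangent n) := by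
  have h1 : IsClosed (unitTangent n) :=
    (isClosed_eq (by fun_prop) continuous_const).inter (isClosed_eq (by fun_prop) continuous_const)
  refine (isCompact_univ.prod (isCompact_closedBall (0 : Amb n) 1)).of_isClosed_subset h1 ?_
  exact fun q hq => ⟨Set.mem_univ _, mem_closedBall_zero_iff.mpr hq.2.le⟩

theorem pd_pd_eq_sum {F : Amb n → ℝ} (hF : ContDiffOn ℝ ∞ F {0}ᶜ) {y : Amb n} (hy : y ≠ 0)
    (e : OrthonormalBasis (Fin (n + 1)) ℝ (Amb n)) (v : Amb n) : pd v (pd v F) y =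
      ∑ i, ∑ j, ⟪e i, v⟫ * (⟪e j, v⟫ * pd (e j) (pd (e i) F) y) := by
  have h1 : ∀ G : Amb n → ℝ, pd v G y = ∑ i, ⟪e i, v⟫ * pd (e i) G y := fun G => by
    conv_lhs => rw [← e.sum_repr' v, pd_sum_left]
    exact Finset.sum_congr rfl fun i _ => pd_smul_left _ _ _ _
  rw [h1]
  refine Finset.sum_congr rfl fun i _ => ?_
  rw [pd_comm hF _ _ hy, h1, Finset.mul_sum]

theorem continuousOn_pd_pd {I : Set ℝ} (hI : UniqueDiffOn ℝ I) {F : ℝ → Amb n → ℝ}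
    (hF : ContDiffOn ℝ ∞ (fun q : ℝ × Amb n => F q.1 q.2) (I ×ˢ {0}ᶜ)) :
    ContinuousOn (fun q : ℝ × (Sph n × Amb n) => pd q.2.2 (pd q.2.2 (F q.1)) q.2.1)
      (I ×ˢ unitTangent n) := by
  set e := EuclideanSpace.basisFun (Fin (n + 1)) ℝ
  have h1 : ∀ i j, ContinuousOn (fun q : ℝ × (Sph n × Amb n) => pd (e j) (pd (e i) (F q.1)) q.2.1)
      (I ×ˢ unitTangent n) := fun i j =>
    (continuousOn_sph (F := fun τ => pd (e j) (pd (e i) (F τ)))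
      (pd_smooth_joint hI (F := fun τ => pd (e i) (F τ)) (pd_smooth_joint hI hF _) _)).comp
      (f := fun q : ℝ × (Sph n × Amb n) => (q.1, q.2.1)) (by fun_prop)
      fun q hq => ⟨hq.1, Set.mem_univ _⟩
  have h2 : ∀ i, ContinuousOn (fun q : ℝ × (Sph n × Amb n) => ⟪e i, q.2.2⟫)
      (I ×ˢ unitTangent n) := fun i => by fun_prop
  refine (continuousOn_finsetSum univ fun i _ => continuousOn_finsetSum univ fun j _ =>
    (h2 i).mul ((h2 j).mul (h1 i j))).congr fun q hq => ?_
  exact pd_pd_eq_sum (smooth_slice hF hq.1) q.2.1.coe_ne_zero e q.2.2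

theorem exists_bounds_pd_pd {f : Sph n → ℝ} (hf : ContMDiff (𝓡 n) 𝓘(ℝ, ℝ) ∞ f)
    (hconv : SphStrictlyConvex f) (hpos : ∀ x, 0 < f x) : ∃ m, 0 < m ∧ ∀ (x : Sph n) (v : Amb n),
      ⟪(x : Amb n), v⟫ = 0 → ‖v‖ = 1 → m < f x * pd v (pd v (homExt f)) x := by
  have h1 := continuousOn_pd_pd uniqueDiffOn_univ (F := fun _ => homExt f)
    ((homExt_smooth hf).comp contDiffOn_snd fun q (hq : q ∈ Set.univ ×ˢ {0}ᶜ) => hq.2)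
  have h2 : ContinuousOn (fun q : Sph n × Amb n => pd q.2 (pd q.2 (homExt f)) q.1)
      (unitTangent n) :=
    h1.comp (f := fun q : Sph n × Amb n => ((0 : ℝ), q)) (by fun_prop)
      fun q hq => ⟨Set.mem_univ _, hq⟩
  obtain ⟨m, _, hm, _, h3⟩ := (isCompact_unitTangent n).exists_bounds_of_pos
    (f := fun q : Sph n × Amb n => f q.1 * pd q.2 (pd q.2 (homExt f)) q.1)
    ((hf.continuous.comp continuous_fst).continuousOn.mul h2) fun q hq =>
      mul_pos (hpos _) (homExt_convex hf hconv q.1 q.2 hq.1 (by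
        intro h0
        have := hq.2
        rw [h0, norm_zero] at this
        exact zero_ne_one this))
  exact ⟨m, hm, fun x v hv hv1 => (h3 (x, v) ⟨hv, hv1⟩).1⟩

namespace FlowData

/-- Compactness of the unit tangent bundle makes the assumed positive definiteness for the root of
`φ` uniform. -/
theorem weightExt_convex (D : FlowData k p φ h₀) : ∃ u, 0 < u ∧ ∀ (x : Sph n) (w : Amb n),
    ⟪(x : Amb n), w⟫ = 0 → ‖w‖ = 1 →
      u * weightExt k p φ x ≤ pd w (pd w (weightExt k p φ)) x := by
  have hpos : ∀ x, 0 < φ x ^ (1 / (p + (k : ℝ) - 1)) := fun x => Real.rpow_pos_of_pos (D.pos x) _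
  obtain ⟨m, hm, h1⟩ := exists_bounds_pd_pd D.root_smooth D.convex hpos
  obtain ⟨_, M, _, hM, h2⟩ := exists_bounds_of_pos_sph D.root_smooth.continuous hpos
  refine ⟨m / M ^ 2, by positivity, fun x w hw hw1 => ?_⟩
  have h3 := h1 x w hw hw1
  have h4 := (h2 x).2
  have h5 := hpos x
  rw [weightExt, homExt_coe]
  set t := φ x ^ (1 / (p + (k : ℝ) - 1))
  have h6 : m / M ^ 2 * t * t ≤ m := by
    rw [div_mul_eq_mul_div, div_mul_eq_mul_div, div_le_iff₀ (by positivity), mul_assoc]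
    exact mul_le_mul_of_nonneg_left (by nlinarith) hm.le
  refine le_of_mul_le_mul_left ?_ h5
  linarith

/-- The lower curvature radius estimate along the flow. -/
theorem hess_bound (D : FlowData k p φ h₀) : ∃ μ, 0 < μ ∧
    ∀ (T : EReal) (h : ℝ → Sph n → ℝ), IsNormalizedFlow k p φ h₀ T h → ∀ τ ∈ timeInterval T,
      ∀ (x : Sph n) (v : Amb n), ⟪(x : Amb n), v⟫ = 0 → ‖v‖ = 1 →
        μ < h τ x * pd v (pd v (homExt (h τ))) x := by
  obtain ⟨A, B, hA, hB, hAB⟩ := D.flowPsi_bounds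
  obtain ⟨_, b, _, hb, hab⟩ := D.powerMean_bounds
  obtain ⟨r, R, hr, hR, hrR⟩ := D.support_bounds
  obtain ⟨u, hu, hU⟩ := D.weightExt_convex
  obtain ⟨μ₀, hμ₀, hinit⟩ := exists_bounds_pd_pd D.initial.smooth D.initial.convex D.initial.pos
  have hk := D.one_le_cast
  have hp := D.le_exponent
  have hq : 0 < p + k - 1 := by linarith
  have hs0 : 0 ≤ p + k - 3 := by linarith
  set N := (p + k - 3) * B + 2 * (B * b) with hN
  have hN0 : 0 < N := by positivity
  set Z := (p + k - 1) * u * (r ^ 2 * A) with hZ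
  have hZ0 : 0 < Z := by positivity
  have hμ : 0 < min μ₀ (Z / (2 * N)) := by positivity
  -- `Z` is a lower bound for the good term and `N` an upper bound for the factor of `μ` in the bad
  -- one, so `μ N ≤ Z / 2 < Z`; `μ₀` accounts for the initial data.
  refine ⟨min μ₀ (Z / (2 * N)), hμ, fun T h hh τ hτ x v hv hv1 => ?_⟩
  set μ := min μ₀ (Z / (2 * N)) with hμdef
  have H := hh.homFlow D hτ
  rw [← sub_pos]
  refine pos_of_first_touch (isCompact_unitTangent n)
    (fun τ (hτ : τ ∈ timeInterval T) => Icc_subset_timeInterval hτ)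
    (f := fun τ (q : Sph n × Amb n) => h τ q.1 * pd q.2 (pd q.2 (homExt (h τ))) q.1 - μ)
    ((ContinuousOn.mul ?_ (continuousOn_pd_pd H.uniq (F := fun τ => homExt (h τ))
      H.smooth)).sub continuousOn_const)
    (fun q hq => ?_) (fun s hs hs0 q hq hzero hnn => ?_) τ hτ (x, v) ⟨hv, hv1⟩
  · exact hh.continuousOn_support.comp (f := fun q : ℝ × (Sph n × Amb n) => (q.1, q.2.1))
      (by fun_prop) fun q hq => ⟨hq.1, Set.mem_univ _⟩
  · rw [hh.initial]
    linarith [hinit q.1 q.2 hq.1 hq.2, min_le_left μ₀ (Z / (2 * N))]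
  · obtain ⟨y, w⟩ := q
    have hsup := hh.support s hs
    obtain ⟨hΨ1, hΨ2⟩ := hAB T h hh s hs y
    have hη : etaFlow k φ (h s) ≤ B * b :=
      (D.eta_le hsup (fun z => (hAB T h hh s hs z).2) y).trans
        (mul_le_mul_of_nonneg_left (hab T h hh s hs).2.le hB.le)
    have hsmall : μ * ((p + k - 3) * flowPsi k p φ (h s) y + 2 * etaFlow k φ (h s)) <
        (p + k - 1) * u * (homExt (h s) y ^ 2 * flowPsi k p φ (h s) y) := by
      rw [homExt_coe]
      have h1 : (p + k - 3) * flowPsi k p φ (h s) y + 2 * etaFlow k φ (h s) ≤ N :=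
        add_le_add (mul_le_mul_of_nonneg_left hΨ2 (by linarith)) (by linarith)
      have h2 : μ * N ≤ Z / 2 := by
        have h3 := mul_le_mul_of_nonneg_right (min_le_right μ₀ (Z / (2 * N))) hN0.le
        refine h3.trans (le_of_eq ?_)
        field_simp
      have h4 : Z ≤ (p + k - 1) * u * (h s y ^ 2 * flowPsi k p φ (h s) y) :=
        mul_le_mul_of_nonneg_left (mul_le_mul (pow_le_pow_left₀ hr.le (hrR T h hh s hs y).1 2) hΨ1
          hA.le (sq_nonneg _)) (by positivity)
      have h5 := mul_le_mul_of_nonneg_left h1 hμ.le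
      linarith
    obtain ⟨w', h1, h2, h3, d, hd, hder⟩ := H.hess_touch D.one_le D.le_dim hp D.choose_pos
      (mem_interior_timeInterval hs hs0) (x := y) (v := w) hq.1 hq.2 (μ := μ)
      (fun z w hz hw => by
        have := hnn (z, w) ⟨hz, hw⟩
        rw [homExt_coe]
        linarith)
      (by rw [homExt_coe]; linarith) (hU y) hsmall
    simp only [homExt_coe] at h3 hder
    exact ⟨(y, w'), ⟨h1, h2⟩, by rw [h3, sub_self], d, hd, hder.sub_const μ⟩

/-- Uniform two-sided bounds for the second fundamental form. -/
theorem pd_pd_bounds (D : FlowData k p φ h₀) : ∃ a b, 0 < a ∧ 0 < b ∧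
    ∀ (T : EReal) (h : ℝ → Sph n → ℝ), IsNormalizedFlow k p φ h₀ T h → ∀ τ ∈ timeInterval T,
      ∀ (x : Sph n) (v : Amb n), ⟪(x : Amb n), v⟫ = 0 →
        a * ‖v‖ ^ 2 ≤ pd v (pd v (homExt (h τ))) x ∧
          pd v (pd v (homExt (h τ))) x ≤ b * ‖v‖ ^ 2 := by
  obtain ⟨A, B, hA, hB, hAB⟩ := D.flowPsi_bounds
  obtain ⟨M, hM, hsig⟩ := D.sig_le hA hB
  obtain ⟨r, R, hr, hR, hrR⟩ := D.support_bounds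
  obtain ⟨μ, hμ, hhess⟩ := D.hess_bound
  -- The lower bound is `μ` divided by the largest value of `h`. For the upper bound, a radius times
  -- `k - 1` copies of the lower bound is at most `σ_k ≤ (M R) ^ k`.
  refine ⟨μ / R, (M * R) ^ k / (μ / R) ^ (k - 1), by positivity, by positivity,
    fun T h hh τ hτ x v hv => ?_⟩
  have hs := hh.support τ hτ
  have hF := homExt_smooth hs.smooth
  obtain ⟨e, l, o, he⟩ := exists_isEigenframe hF (homExt_posHom _) x
    (homExt_convex hs.smooth hs.convex x)
  have hlow : ∀ i, i ≠ o → μ / R ≤ l i := fun i hi => by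
    have h1 := hhess T h hh τ hτ x (e i) (he.tangent hi) (e.orthonormal.1 i)
    rw [he.entry_self] at h1
    rw [div_le_iff₀ hR, mul_comm]
    exact h1.le.trans (mul_le_mul_of_nonneg_right (hrR T h hh τ hτ x).2 (he.nonneg i))
  have hupp : ∀ i, i ≠ o → l i ≤ (M * R) ^ k / (μ / R) ^ (k - 1) := fun i hi => by
    rw [le_div_iff₀ (by positivity)]
    have h1 := mul_pow_le_esymmFn (k := k) (div_pos hμ hR).le he.nonneg hlow hi D.one_le
      (by simpa using D.le_dim)
    rw [← he.sig_eq hF] at h1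
    refine h1.trans ((hsig _ hs (hAB T h hh τ hτ) x).trans ?_)
    exact pow_le_pow_left₀ (mul_nonneg hM.le (hs.pos x).le)
      (mul_le_mul_of_nonneg_left (hrR T h hh τ hτ x).2 hM.le) k
  have hco : ⟪e o, v⟫ = 0 := by rw [he.base, hv]
  have h1 : pd v (pd v (homExt (h τ))) x = ∑ j, ⟪e j, v⟫ ^ 2 * l j := by
    conv_lhs => rw [← e.sum_repr' v]
    exact he.pd_sum_smul_pd_self hF _
  have h2 : ‖v‖ ^ 2 = ∑ j, ⟪e j, v⟫ ^ 2 := by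
    rw [← e.sum_sq_norm_inner_right v]
    exact Finset.sum_congr rfl fun j _ => by rw [Real.norm_eq_abs, sq_abs]
  rw [h1, h2, Finset.mul_sum, Finset.mul_sum]
  constructor
  · refine Finset.sum_le_sum fun j _ => ?_
    by_cases hj : j = o
    · rw [hj, hco]; simp
    · rw [mul_comm]
      exact mul_le_mul_of_nonneg_left (hlow j hj) (sq_nonneg _)
  · refine Finset.sum_le_sum fun j _ => ?_
    by_cases hj : j = o
    · rw [hj, hco]; simp
    · rw [mul_comm]
      exact mul_le_mul_of_nonneg_right (hupp j hj) (sq_nonneg _)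

end FlowData

/-- Pair the defining equation of a principal direction with the direction itself: a curvature is
the reciprocal of a Rayleigh quotient of the Hessian. -/
theorem IsPrincipalCurvature.norm_sq_eq {f : Sph n → ℝ} (hf : ContMDiff (𝓡 n) 𝓘(ℝ, ℝ) ∞ f)
    {x : Sph n} {κ : ℝ} (h : IsPrincipalCurvature f x κ) : ∃ v : Amb n, v ≠ 0 ∧
      ⟪(x : Amb n), v⟫ = 0 ∧ ‖v‖ ^ 2 = κ * pd v (pd v (homExt f)) x := by
  obtain ⟨v, hv, h⟩ := h
  refine ⟨v, fun h0 => hv (Subtype.ext h0), inner_coe_tangent x v, ?_⟩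
  rw [← inner_sphDeriv_gaussParam hf, ← real_inner_smul_left, ← h, real_inner_self_eq_norm_sq]

end Solution

end

theorem mainTheorem4 (n k : ℕ) (hk : 1 ≤ k) (hkn : k ≤ n) (p : ℝ) (hp : (k : ℝ) + 1 ≤ p)
    (φ : Sph n → ℝ) (hφ : ContMDiff (𝓡 n) 𝓘(ℝ, ℝ) ∞ φ) (hφ_pos : ∀ x, 0 < φ x)
    (hφ_conv : SphStrictlyConvex fun x => φ x ^ (1 / (p + (k : ℝ) - 1)))
    (h₀ : Sph n → ℝ) (hh₀ : IsConvexSupport h₀) :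
    ∃ l L : ℝ, 0 < l ∧ 0 < L ∧
      ∀ (T : EReal) (h : ℝ → Sph n → ℝ), IsNormalizedFlow k p φ h₀ T h →
        ∀ τ ∈ timeInterval T, ∀ (x : Sph n) (κ : ℝ),
          IsPrincipalCurvature (h τ) x κ → l ≤ κ ∧ κ ≤ L := by
  have D : FlowData k p φ h₀ := ⟨hk, hkn, hp, hφ, hφ_pos, hφ_conv, hh₀⟩
  obtain ⟨a, b, ha, hb, hab⟩ := D.pd_pd_bounds
  refine ⟨b⁻¹, a⁻¹, inv_pos.mpr hb, inv_pos.mpr ha, fun T h hh τ hτ x κ hκ => ?_⟩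
  obtain ⟨v, hv0, hv, hnorm⟩ := hκ.norm_sq_eq (hh.support τ hτ).smooth
  obtain ⟨h1, h2⟩ := hab T h hh τ hτ x v hv
  have hv2 : 0 < ‖v‖ ^ 2 := pow_pos (norm_pos_iff.mpr hv0) 2
  have hQ : 0 < pd v (pd v (homExt (h τ))) (x : Amb n) := (mul_pos ha hv2).trans_le h1
  have hκ0 : 0 < κ := by
    rw [hnorm] at hv2
    exact (mul_pos_iff_of_pos_right hQ).mp hv2
  constructor
  · rw [inv_le_iff_one_le_mul₀ hb]
    have h3 := mul_le_mul_of_nonneg_left h2 hκ0.le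
    rw [← hnorm] at h3
    refine le_of_mul_le_mul_right ?_ hv2
    linarith
  · rw [le_inv_comm₀ hκ0 ha]
    rw [← one_div, le_div_iff₀ hκ0]
    have h3 := mul_le_mul_of_nonneg_left h1 hκ0.le
    rw [← hnorm] at h3
    refine le_of_mul_le_mul_right ?_ hv2
    linarith
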